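/- A rooted bipartite planar map is a finite planar map with a distinguished oriented edge (the root edge), all of whose faces have even degree; the face on the right of the root edge is the root face. For a non-zero sequence $\mathbf q=(q_k)_{k\ge1}$ of non-negative numbers, the Boltzmann weight of such a map $\mathfrak m$ is $w(\mathfrak m)=\prod_{f\in\mathrm{Faces}(\mathfrak m)}q_{\deg(f)/2}$. For $\ell\ge1$ let $W^{(\ell)}=\sum_{\mathfrak m}\prod_{f\ne\text{root face}}q_{\deg(f)/2}$, the sum over the maps whose root face has degree $2\ell$, and let $W^{(0)}=1$. The sequence $\mathbf q$ is admissible if $w$ has finite total mass. It is critical if moreover $Z_{\mathbf q}^2\,f_{\mathbf q}'(Z_{\mathbf q})=1$, where $f_{\mathbf q}(x)=\sum_{k\ge1}\binom{2k-1}{k}q_kx^{k-1}$ (differentiated term by term) and $Z_{\mathbf q}=1+\frac12\sum_{\mathfrak m}\#\mathrm{Vertices}(\mathfrak m)\,w(\mathfrak m)$, the sum over all rooted bipartite planar maps with at least one edge. Lemma. Let $a\in(3/2,5/2)$ and $$q_k=c\,\kappa^{k-1}\frac{\Gamma(\frac12-a+k)}{\Gamma(\frac12+k)}\mathbf 1_{k\ge2},\qquad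 \kappa=\frac1{4a-2},\qquad c=\frac{-\sqrt\pi}{2\,\Gamma(\frac32-a)}.$$ Then $c,\kappa>0$, $q_k\sim c\,\kappa^{k-1}k^{-a}$ as $k\to\infty$, and $\mathbf q$ is admissible and critical. The associated step law $\nu$, defined by $\nu(k)=q_{k+1}\kappa^{-k}$ for $k\ge0$ and $\nu(k)=2W^{(-1-k)}\kappa^{-k}$ for $k\le-1$, is a probability measure on $\mathbb Z$ and is given by $$\nu(k)=c\,\frac{\Gamma(\frac32-a+k)}{\Gamma(\frac32+k)}\mathbf 1_{k\ne0}\qquad(k\in\mathbb Z).$$ Moreover the function $h^\uparrow(\ell)=2\ell\,2^{-2\ell}\binom{2\ell}{\ell}\mathbf 1_{\ell\ge1}$ is $\nu$-harmonic on the positive integers: $\sum_{k\in\mathbb Z}h^\uparrow(\ell+k)\,\nu(k)=h^\uparrow(\ell)$ for all $\ell\ge1$, with absolutely convergent sums. -/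

import Mathlib

open scoped ENNReal

noncomputable section

namespace BoltzmannMaps

/-- The set of orbits (cycles, fixed points included) of a permutation. -/
def Orbit {D : Type} (f : Equiv.Perm D) : Type :=
  Quotient (Equiv.Perm.SameCycle.setoid f)

/-- The orbit of a point. -/
def orbitOf {D : Type} (f : Equiv.Perm D) (d : D) : Orbit f :=
  Quotient.mk (Equiv.Perm.SameCycle.setoid f) d

/-- The number of points of an orbit. -/
def Orbit.size {D : Type} {f : Equiv.Perm D} (o : Orbit f) : ℕ :=
  Nat.card {d : D // orbitOf f d = o}

instance {D : Type} [Finite D] (f : Equiv.Perm D) : Finite (Orbit f) :=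
  inferInstanceAs (Finite (Quotient (Equiv.Perm.SameCycle.setoid f)))

instance {D : Type} [Finite D] (f : Equiv.Perm D) : Fintype (Orbit f) :=
  Fintype.ofFinite _

/-- A rooted bipartite planar map with at least one edge, encoded by its rotation system on the
set `D` of its oriented edges (it is used with `D` finite).

* `rot` sends an oriented edge to the next one in counterclockwise order around its origin,
* `flip` reverses an oriented edge,
* `rot * flip` sends an oriented edge to the next one along the boundary of the face on its right.

Vertices, edges and faces are the orbits of `rot`, `flip` and `rot * flip`. Planarity is Euler's
relation for a connected map, and bipartite means that all faces have even degree. -/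
structure RootedMap (D : Type) where
  rot : Equiv.Perm D
  flip : Equiv.Perm D
  root : D
  flip_flip : ∀ d, flip (flip d) = d
  flip_ne : ∀ d, flip d ≠ d
  connected : ∀ d e, ∃ g ∈ Subgroup.closure {rot, flip}, g d = e
  euler : Nat.card (Orbit rot) + Nat.card (Orbit (rot * flip)) = Nat.card (Orbit flip) + 2
  even_degree : ∀ o : Orbit (rot * flip), Even o.size

namespace RootedMap

variable {D E : Type}

abbrev Vertex (m : RootedMap D) : Type := Orbit m.rot

abbrev Face (m : RootedMap D) : Type := Orbit (m.rot * m.flip)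

/-- The face on the right of the root edge. -/
def rootFace (m : RootedMap D) : m.Face := orbitOf _ m.root

/-- The Boltzmann weight of a map, where a face of degree `2 k` has weight `q k`. -/
def weight [Finite D] (q : ℕ → ℝ) (m : RootedMap D) : ℝ≥0∞ :=
  ∏ f : m.Face, ENNReal.ofReal (q (f.size / 2))

open Classical in
/-- The product of the weights of all faces except the root face. -/
def innerWeight [Finite D] (q : ℕ → ℝ) (m : RootedMap D) : ℝ≥0∞ :=
  ∏ f ∈ Finset.univ.erase m.rootFace, ENNReal.ofReal (q (f.size / 2))

/-- Root preserving isomorphism of maps. -/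
def Iso (m : RootedMap D) (m' : RootedMap E) : Prop :=
  ∃ e : D ≃ E, (∀ d, e (m.rot d) = m'.rot (e d)) ∧ (∀ d, e (m.flip d) = m'.flip (e d)) ∧
    e m.root = m'.root

end RootedMap

section transport

variable {D E : Type} {f : Equiv.Perm D} {g : Equiv.Perm E}

theorem sameCycle_iff_of_conj (e : D ≃ E) (h : ∀ d, e (f d) = g (e d)) (x y : D) :
    g.SameCycle (e x) (e y) ↔ f.SameCycle x y := by
  have hg : g = e.permCongr f := by
    ext z
    simp [Equiv.permCongr_apply, h]
  have key : ∀ (i : ℤ) (x : D), (g ^ i) (e x) = e ((f ^ i) x) := by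
    intro i x
    have hpow : g ^ i = e.permCongr (f ^ i) := by
      rw [hg]
      exact (map_zpow e.permCongrHom f i).symm
    rw [hpow]
    simp [Equiv.permCongr_apply]
  simp [Equiv.Perm.SameCycle, key]

/-- Conjugate permutations have the same orbits. -/
def orbitEquiv (e : D ≃ E) (h : ∀ d, e (f d) = g (e d)) : Orbit f ≃ Orbit g :=
  Quotient.congr e fun x y => (sameCycle_iff_of_conj e h x y).symm

theorem orbitEquiv_orbitOf (e : D ≃ E) (h : ∀ d, e (f d) = g (e d)) (d : D) :
    orbitEquiv e h (orbitOf f d) = orbitOf g (e d) := rfl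

theorem orbitEquiv_size (e : D ≃ E) (h : ∀ d, e (f d) = g (e d)) (o : Orbit f) :
    (orbitEquiv e h o).size = o.size := by
  refine (Nat.card_congr (e.subtypeEquiv fun d => ?_)).symm
  rw [← orbitEquiv_orbitOf e h d, (orbitEquiv e h).apply_eq_iff_eq]

end transport

namespace RootedMap

variable {D E : Type}

theorem Iso.faces {m : RootedMap D} {m' : RootedMap E} (h : m.Iso m') :
    ∃ φ : m.Face ≃ m'.Face, (∀ f, (φ f).size = f.size) ∧ φ m.rootFace = m'.rootFace := by
  obtain ⟨e, h1, h2, h3⟩ := h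
  have hc : ∀ d, e ((m.rot * m.flip) d) = (m'.rot * m'.flip) (e d) := fun d => by
    simp [h1, h2]
  refine ⟨orbitEquiv e hc, orbitEquiv_size e hc, ?_⟩
  rw [rootFace, orbitEquiv_orbitOf, h3, rootFace]

theorem Iso.weight_eq [Finite D] [Finite E] {m : RootedMap D} {m' : RootedMap E}
    (h : m.Iso m') (q : ℕ → ℝ) : m.weight q = m'.weight q := by
  obtain ⟨φ, h1, -⟩ := h.faces
  exact Fintype.prod_equiv φ _ _ fun f => by rw [h1]

theorem Iso.innerWeight_eq [Finite D] [Finite E] {m : RootedMap D} {m' : RootedMap E}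
    (h : m.Iso m') (q : ℕ → ℝ) : m.innerWeight q = m'.innerWeight q := by
  classical
  obtain ⟨φ, h1, h2⟩ := h.faces
  refine Finset.prod_equiv φ (fun f => ?_) fun f _ => by rw [h1]
  simp [← h2]

theorem Iso.rootFace_size_eq {m : RootedMap D} {m' : RootedMap E} (h : m.Iso m') :
    m.rootFace.size = m'.rootFace.size := by
  obtain ⟨φ, h1, h2⟩ := h.faces
  rw [← h2, h1]

theorem Iso.card_vertex_eq {m : RootedMap D} {m' : RootedMap E} (h : m.Iso m') :
    Nat.card m.Vertex = Nat.card m'.Vertex := by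
  obtain ⟨e, h1, -, -⟩ := h
  exact Nat.card_congr (orbitEquiv e h1)

end RootedMap

instance isoSetoid : Setoid (Σ n : ℕ, RootedMap (Fin n)) where
  r m m' := m.2.Iso m'.2
  iseqv :=
    { refl := fun _ => ⟨Equiv.refl _, fun _ => rfl, fun _ => rfl, rfl⟩
      symm := by
        rintro _ _ ⟨e, h1, h2, h3⟩
        exact ⟨e.symm, fun d => by simp [Equiv.symm_apply_eq, h1],
          fun d => by simp [Equiv.symm_apply_eq, h2], by simp [Equiv.symm_apply_eq, h3]⟩
      trans := by
        rintro _ _ _ ⟨e, h1, h2, h3⟩ ⟨e', h1', h2', h3'⟩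
        exact ⟨e.trans e', fun d => by simp [h1, h1'], fun d => by simp [h2, h2'],
          by simp [h3, h3']⟩ }

/-- The countable set of all finite rooted bipartite planar maps with at least one edge, up to
root preserving isomorphism. The vertex map, which has no edge, is treated separately. -/
def PlanarMap : Type := Quotient isoSetoid

namespace PlanarMap

/-- The Boltzmann weight `w(m)`, the product over all faces `f` of `q (deg f / 2)`. -/
def weight (q : ℕ → ℝ) (m : PlanarMap) : ℝ≥0∞ :=
  Quotient.lift (fun m : Σ n : ℕ, RootedMap (Fin n) => m.2.weight q)
    (fun _ _ h => RootedMap.Iso.weight_eq h q) m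

/-- The product over all faces other than the root face. -/
def innerWeight (q : ℕ → ℝ) (m : PlanarMap) : ℝ≥0∞ :=
  Quotient.lift (fun m : Σ n : ℕ, RootedMap (Fin n) => m.2.innerWeight q)
    (fun _ _ h => RootedMap.Iso.innerWeight_eq h q) m

/-- The degree of the root face. -/
def perimeter (m : PlanarMap) : ℕ :=
  Quotient.lift (fun m : Σ n : ℕ, RootedMap (Fin n) => m.2.rootFace.size)
    (fun _ _ h => RootedMap.Iso.rootFace_size_eq h) m

def numVertices (m : PlanarMap) : ℕ :=
  Quotient.lift (fun m : Σ n : ℕ, RootedMap (Fin n) => Nat.card m.2.Vertex)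
    (fun _ _ h => RootedMap.Iso.card_vertex_eq h) m

end PlanarMap

/-- `(q k)_{k ≥ 1}` is a non-zero sequence of non-negative numbers. -/
def IsWeightSequence (q : ℕ → ℝ) : Prop :=
  (∀ k, 1 ≤ k → 0 ≤ q k) ∧ ∃ k, 1 ≤ k ∧ q k ≠ 0

/-- `q` is admissible: the Boltzmann measure on the set of all maps is finite. -/
def IsAdmissible (q : ℕ → ℝ) : Prop :=
  IsWeightSequence q ∧ ∑' m : PlanarMap, m.weight q ≠ ∞

/-- `W^{(ℓ)}`, the partition function of maps with perimeter `2 ℓ`, in which the root face has no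
weight. The only map with perimeter `0` is the vertex map. -/
def partitionFunction (q : ℕ → ℝ) (ℓ : ℕ) : ℝ≥0∞ :=
  if ℓ = 0 then 1 else ∑' m : {m : PlanarMap // m.perimeter = 2 * ℓ}, m.1.innerWeight q

/-- `Z_q`, the partition function of pointed maps with a distinguished edge, which is oriented away
from the distinguished vertex; the vertex map counts with weight `1`. In a bipartite map exactly
one of the two orientations of an edge points away from a given vertex, hence the factor `1 / 2`
in terms of maps rooted at an arbitrary oriented edge. -/
def pointedPartitionFunction (q : ℕ → ℝ) : ℝ≥0∞ :=
  1 + (∑' m : PlanarMap, (m.numVertices : ℝ≥0∞) * m.weight q) / 2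

/-- The derivative `f_q'(x)` of the power series
`f_q(x) = ∑_{k ≥ 1} binom(2 k - 1, k) q_k x ^ (k - 1)`, written with `k = j + 2`
(the term `k = 1` is constant). -/
def derivSeries (q : ℕ → ℝ) (x : ℝ≥0∞) : ℝ≥0∞ :=
  ∑' j : ℕ, ((j + 1 : ℕ) : ℝ≥0∞) * ((2 * j + 3).choose (j + 2) : ℝ≥0∞) *
    ENNReal.ofReal (q (j + 2)) * x ^ j

/-- `q` is critical: it is admissible and `Z_q ^ 2 * f_q'(Z_q) = 1`. -/
def IsCritical (q : ℕ → ℝ) : Prop :=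
  IsAdmissible q ∧
    pointedPartitionFunction q ^ 2 * derivSeries q (pointedPartitionFunction q) = 1

/-- The step weights of the random walk that describes the perimeter:
`q_{k+1} κ ^ (-k)` for `k ≥ 0` and `2 W^{(-1-k)} κ ^ (-k)` for `k ≤ -1`
(here `Int.negSucc n = -(n + 1)`). -/
def stepWeight (q : ℕ → ℝ) (κ : ℝ) : ℤ → ℝ≥0∞
  | Int.ofNat n => ENNReal.ofReal (q (n + 1) * κ ^ (-(n : ℤ)))
  | Int.negSucc n => 2 * partitionFunction q n * ENNReal.ofReal (κ ^ (n + 1))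

/-- `h^↑(ℓ) = 2 ℓ 2 ^ (-2 ℓ) binom(2 ℓ, ℓ)` for `ℓ ≥ 1`, and `0` for `ℓ ≤ 0`. -/
def hUp (ℓ : ℤ) : ℝ :=
  if 0 < ℓ then 2 * ℓ * 2 ^ (-2 * ℓ) * (2 * ℓ.toNat).choose ℓ.toNat else 0

/-- `h` is `ν`-harmonic on the positive integers, with absolutely convergent sums. -/
def IsHarmonicOnPos (ν : PMF ℤ) (h : ℤ → ℝ) : Prop :=
  ∀ ℓ : ℤ, 0 < ℓ → HasSum (fun k : ℤ => h (ℓ + k) * (ν k).toReal) (h ℓ)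

end BoltzmannMaps

end

open scoped ENNReal

noncomputable section

namespace BoltzmannMaps

open Equiv

/-! ### Orbits of permutations and products of weights over them. -/

section Orbits

variable {D E : Type}

/-! Put `b = 3/2 - a`, so `-1 < b < 0`, and write `W_n`, `P_n` for the partition functions of
perimeter `2n`, the second counting each map with its number of vertices. The theorem is a meeting
of two facts: Tutte's equations for `W` and `P`, and an explicit solution of them found by
telescoping.

Combinatorial half. A rooted map is a pair of permutations of its darts (oriented edges, or
half-edges), and the decomposition is stated for maps with a leg, that is, whose root is the only
half-edge; attaching a leg at the root corner turns rooted maps into such maps, and the vertex map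
becomes the single dart. Removing the root edge either merges two faces (`Pre.addEdge` is the
inverse operation) or cuts the map into two maps with a leg (`Pre.join`). In the second case the
edge is a bridge and both pieces are planar because the genus is non-negative (`numOrbits_add_le`, a
dimension count). This gives `W_(n+1) = ∑ q_(k+1) W_(n+1+k) + ∑_(i+j=n) W_i W_j`
(`legSum_inner_succ`) and its linearisation for `P` (`legSum_pointedInner_succ`). Truncating by the
number of darts shows that `W` and `P` lie below every supersolution.

Analytic half. The proposed law is `ν = δ_0 - u`, where `u 0 = 1` and `(3/2 + k) u (k+1) = (b + k) u
k`. If `(γ + m) g (m+1) = (1/2 + m) g m` and the sums converge, telescoping yields `∑ u k * g (ℓ+k)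
= 0` for `ℓ ≥ 1` (`tsum_mul_shift_eq_zero`), that is, `g` is `ν`-harmonic on the positive integers.
Four choices of `g` do everything: the constant `1` gives total mass one; `hUp` gives the
harmonicity asserted; `hDown` solves the equation for `P`; the reflection of `u` turns harmonicity
into the quadratic equation for `W`.

Identification. The explicit solutions dominate `W` and `P`; the rescaled differences are
non-negative, vanish at `0`, tend to `0` and are subharmonic, so they are zero by the maximum
principle (`eq_zero_of_subharmonic`). Hence `2 W_n κ^(n+1) = ν(-1-n)` and `P_n κ^n = hDown n`. Then
`P_1` gives `Z_q = 1/(4κ)`, and harmonicity of `hUp` and `hDown` at `1` evaluates `f_q'(Z_q)` to `16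
κ^2`, which is criticality. -/

theorem orbitOf_eq_iff {f : Perm D} {a b : D} :
    orbitOf f a = orbitOf f b ↔ f.SameCycle a b :=
  Quotient.eq (r := Perm.SameCycle.setoid f)

theorem exists_orbitOf {f : Perm D} (o : Orbit f) : ∃ d, orbitOf f d = o :=
  Quotient.exists_rep o

/-- Together with `sameCycle_of_forall`, this replaces powers of a permutation by invariant
predicates, so that most comparisons of cycles below become one-step checks. -/
theorem iff_of_sameCycle {f : Perm D} {P : D → Prop} (hP : ∀ d, P (f d) ↔ P d) {a b : D}
    (h : f.SameCycle a b) : P a ↔ P b := by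
  obtain ⟨i, rfl⟩ := h
  have key : ∀ (i : ℤ) (a : D), P ((f ^ i) a) ↔ P a := by
    intro i
    induction i with
    | zero => simp
    | succ i ih =>
      intro a
      rw [zpow_add_one, Perm.mul_apply, ih, hP]
    | pred i ih =>
      intro a
      rw [zpow_sub_one, Perm.mul_apply, ih, ← hP]
      simp
  exact (key i a).symm

theorem sameCycle_of_forall {f : Perm D} {a b : D}
    (h : ∀ P : D → Prop, (∀ d, P (f d) ↔ P d) → P a → P b) : f.SameCycle a b :=
  h (fun d => f.SameCycle a d) (fun _ => Perm.sameCycle_apply_right) (Perm.SameCycle.refl _ _)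

theorem size_orbitOf (f : Perm D) (a : D) :
    (orbitOf f a).size = Nat.card {d // f.SameCycle d a} :=
  Nat.card_congr (Equiv.subtypeEquivRight fun _ => orbitOf_eq_iff)

theorem size_congr {f : Perm D} {g : Perm D} {a b : D}
    (h : ∀ d, f.SameCycle d a ↔ g.SameCycle d b) : (orbitOf f a).size = (orbitOf g b).size := by
  rw [size_orbitOf, size_orbitOf]
  exact Nat.card_congr (Equiv.subtypeEquivRight h)

/-- The number of orbits. -/
def numOrbits (f : Perm D) : ℕ := Nat.card (Orbit f)

open Classical in
/-- The product of the weights of all orbits except that of a given point. -/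
def innerProd [Finite D] (q : ℕ → ℝ) (f : Perm D) (x : D) : ℝ≥0∞ :=
  ∏ o ∈ Finset.univ.erase (orbitOf f x), ENNReal.ofReal (q (o.size / 2))

theorem innerProd_congr [Finite D] [Finite E] {q : ℕ → ℝ} {f : Perm D} {g : Perm E} {x : D} {y : E}
    (φ : Orbit f ≃ Orbit g) (hx : φ (orbitOf f x) = orbitOf g y)
    (h : ∀ o, o ≠ orbitOf f x → (φ o).size = o.size) :
    innerProd q f x = innerProd q g y := by
  classical
  refine Finset.prod_equiv φ (fun o => ?_) fun o ho => ?_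
  · simp [← hx]
  · rw [h o (Finset.ne_of_mem_erase ho)]

theorem innerProd_eq_of_sameCycle [Finite D] {q : ℕ → ℝ} {f : Perm D} {x y : D}
    (h : f.SameCycle x y) : innerProd q f x = innerProd q f y := by
  rw [innerProd, innerProd, orbitOf_eq_iff.2 h]

theorem sum_size [Finite D] (f : Perm D) : ∑ o : Orbit f, o.size = Nat.card D := by
  rw [Nat.card_congr (Equiv.sigmaFiberEquiv (orbitOf f)).symm, Nat.card_sigma]
  rfl

theorem size_pos [Finite D] {f : Perm D} (o : Orbit f) : 0 < o.size := by
  obtain ⟨d, rfl⟩ := exists_orbitOf o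
  exact @Nat.card_pos _ ⟨⟨d, rfl⟩⟩ _

theorem minimalPeriod_eq_size [Finite D] (f : Perm D) (x : D) :
    Function.minimalPeriod f x = (orbitOf f x).size := by
  classical
  cases nonempty_fintype D
  have := MulAction.minimalPeriod_eq_card (a := f) (b := x)
  have h2 : ((f • ·) : D → D) = f := rfl
  rw [h2] at this
  rw [this, size_orbitOf, ← Nat.card_eq_fintype_card]
  refine Nat.card_congr (Equiv.subtypeEquivRight fun d => ?_)
  rw [MulAction.mem_orbit_iff, Perm.sameCycle_comm]
  constructor
  · rintro ⟨⟨_, i, rfl⟩, h⟩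
    exact ⟨i, h⟩
  · rintro ⟨i, h⟩
    exact ⟨⟨_, i, rfl⟩, h⟩

end Orbits

/-! ### Deleting one point from a permutation. -/

section RemoveNone

variable {D : Type} {g : Perm (Option D)}

theorem iff_removeNone {P : Option D → Prop} (hP : ∀ d, P (g d) ↔ P d) (d : D) :
    P (some (removeNone g d)) ↔ P (some d) := by
  rcases h : g (some d) with _ | x
  · rw [removeNone_none _ h, hP, ← h, hP]
  · rw [removeNone_some _ ⟨x, h⟩, hP]

/-- The extension of a predicate that is invariant under `removeNone g`. -/
def extendPred (g : Perm (Option D)) (P : D → Prop) : Option D → Prop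
  | some d => P d
  -- `none` takes the value of its successor; the value is `False` when `none` is a fixed point.
  | none => ∃ y, g none = some y ∧ P y

theorem extendPred_apply_iff {P : D → Prop} (hP : ∀ d, P (removeNone g d) ↔ P d) (d : Option D) :
    extendPred g P (g d) ↔ extendPred g P d := by
  have h0 : ∀ y, g none = some y → (extendPred g P none ↔ P y) := fun y hy => by
    simp [extendPred, hy]
  rcases d with _ | d
  · rcases h : g none with _ | y
    · rfl
    · rw [h0 y h]
      rfl
  · change _ ↔ P d
    rcases h : g (some d) with _ | x
    · rw [← hP, h0 _ (removeNone_none _ h).symm]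
    · rw [← hP, ← Option.some_injective _ ((removeNone_some g ⟨x, h⟩).trans h)]
      rfl

/-- Invariant predicates can be moved in both directions: by restriction to `D`, and by
`extendPred`. -/
theorem sameCycle_removeNone_iff {a b : D} :
    Perm.SameCycle (removeNone g) a b ↔ g.SameCycle (some a) (some b) := by
  constructor
  · intro h
    refine sameCycle_of_forall fun P hP ha => ?_
    exact (iff_of_sameCycle (P := fun d => P (some d)) (iff_removeNone hP) h).1 ha
  · intro h
    refine sameCycle_of_forall fun P hP ha => ?_
    exact (iff_of_sameCycle (extendPred_apply_iff hP) h).1 ha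

theorem sameCycle_none {y : D} (hy : g none = some y) : g.SameCycle none (some y) := by
  rw [← hy, Perm.sameCycle_apply_right]

/-- Removing a point which is not fixed does not change the set of orbits. -/
def orbitRemoveNone {y : D} (hy : g none = some y) : Orbit (removeNone g) ≃ Orbit g :=
  Equiv.ofBijective (Quotient.map some fun _ _ h => sameCycle_removeNone_iff.1 h) <| by
    constructor
    · rintro ⟨a⟩ ⟨b⟩ h
      exact orbitOf_eq_iff.2 (sameCycle_removeNone_iff.2 (orbitOf_eq_iff.1 h))
    · rintro ⟨_ | a⟩
      · exact ⟨orbitOf _ y, orbitOf_eq_iff.2 (sameCycle_none hy).symm⟩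
      · exact ⟨orbitOf _ a, rfl⟩

theorem orbitRemoveNone_orbitOf {y : D} (hy : g none = some y) (a : D) :
    orbitRemoveNone hy (orbitOf _ a) = orbitOf g (some a) := rfl

theorem numOrbits_removeNone {y : D} (hy : g none = some y) :
    numOrbits (removeNone g) = numOrbits g :=
  Nat.card_congr (orbitRemoveNone hy)

/-- Removing a fixed point removes one orbit. -/
def orbitRemoveNone' (hy : g none = none) : Option (Orbit (removeNone g)) ≃ Orbit g :=
  Equiv.ofBijective (fun o => o.elim (orbitOf g none)
    (Quotient.map some fun _ _ h => sameCycle_removeNone_iff.1 h)) <| by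
    have key : ∀ a, ¬ g.SameCycle none (some a) := by
      intro a h
      have := h.eq_of_left hy
      simp at this
    constructor
    · rintro (_ | ⟨⟨a⟩⟩) (_ | ⟨⟨b⟩⟩) h
      · rfl
      · exact (key _ (orbitOf_eq_iff.1 h)).elim
      · exact (key _ (orbitOf_eq_iff.1 h).symm).elim
      · exact congrArg some (orbitOf_eq_iff.2 (sameCycle_removeNone_iff.2 (orbitOf_eq_iff.1 h)))
    · rintro ⟨_ | a⟩
      · exact ⟨none, rfl⟩
      · exact ⟨some (orbitOf _ a), rfl⟩

theorem numOrbits_removeNone' [Finite D] (hy : g none = none) :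
    numOrbits g = numOrbits (removeNone g) + 1 := by
  rw [numOrbits, ← Nat.card_congr (orbitRemoveNone' hy), Finite.card_option]
  rfl

theorem card_subtype_option [Finite D] (P : Option D → Prop) [Decidable (P none)] :
    Nat.card {d // P d} = Nat.card {d : D // P (some d)} + if P none then 1 else 0 := by
  classical
  cases nonempty_fintype D
  simp only [Nat.card_eq_fintype_card, Fintype.card_subtype]
  have : (Finset.univ.filter P) =
      (if P none then {none} else ∅) ∪
        (Finset.univ.filter fun d => P (some d)).map Function.Embedding.some := by
    ext (_ | d)
    · by_cases h : P none <;> simp [h]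
    · by_cases h : P none <;> simp [h]
  rw [this, Finset.card_union_of_disjoint, Finset.card_map, add_comm]
  · split_ifs <;> rfl
  · rw [Finset.disjoint_left]
    intro d
    split_ifs <;> simp
    rintro rfl
    simp

theorem size_some_of_not [Finite D] {a : D} (h : ¬ g.SameCycle none (some a)) :
    (orbitOf g (some a)).size = (orbitOf (removeNone g) a).size := by
  classical
  rw [size_orbitOf, size_orbitOf, card_subtype_option, if_neg h, add_zero]
  exact Nat.card_congr (Equiv.subtypeEquivRight fun d => sameCycle_removeNone_iff.symm)

theorem size_none [Finite D] {y : D} (hy : g none = some y) :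
    (orbitOf g none).size = (orbitOf (removeNone g) y).size + 1 := by
  classical
  rw [size_orbitOf, size_orbitOf, card_subtype_option, if_pos (Perm.SameCycle.refl _ _)]
  congr 1
  refine Nat.card_congr (Equiv.subtypeEquivRight fun d => ?_)
  rw [sameCycle_removeNone_iff, ← hy, Perm.sameCycle_apply_right]

theorem size_orbitRemoveNone [Finite D] {y : D} (hy : g none = some y) (o : Orbit (removeNone g))
    (ho : o ≠ orbitOf _ y) : (orbitRemoveNone hy o).size = o.size := by
  obtain ⟨a, rfl⟩ := exists_orbitOf o
  rw [orbitRemoveNone_orbitOf, size_some_of_not]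
  intro h
  exact ho (orbitOf_eq_iff.2 (sameCycle_removeNone_iff.2 (h.symm.trans (sameCycle_none hy))))

/-- Only the orbit of `none` changes its size, and that orbit is the one omitted from the product.
-/
theorem innerProd_removeNone [Finite D] (q : ℕ → ℝ) {y : D} (hy : g none = some y) :
    innerProd q (removeNone g) y = innerProd q g none :=
  innerProd_congr (orbitRemoveNone hy) (orbitOf_eq_iff.2 (sameCycle_none hy).symm)
    (size_orbitRemoveNone hy)

end RemoveNone

/-! ### Multiplication by a transposition: merging and splitting cycles. -/

section Swap

variable {D : Type} [DecidableEq D] {f : Perm D} {x y : D}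

theorem mul_swap_apply_left : (f * swap x y) x = f y := by simp

theorem mul_swap_apply_right : (f * swap x y) y = f x := by simp

theorem mul_swap_apply_of_ne {a : D} (h1 : a ≠ x) (h2 : a ≠ y) : (f * swap x y) a = f a := by
  simp [swap_apply_of_ne_of_ne h1 h2]

/-- From `x` the product jumps to `f y` and then follows the `f`-cycle of `y` until it reaches `y`.
On the way it meets neither `x`, which lies in another cycle, nor `y` before a full period. -/
theorem sameCycle_mul_swap_self [Finite D] (h : ¬ f.SameCycle x y) :
    (f * swap x y).SameCycle x y := by
  have hpos : 0 < Function.minimalPeriod f y := by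
    rw [minimalPeriod_eq_size]; exact size_pos _
  have key : ∀ i, i + 1 ≤ Function.minimalPeriod f y →
      (f * swap x y).SameCycle x ((f ^ (i + 1)) y) := by
    intro i
    induction i with
    | zero =>
      intro _
      rw [zero_add, pow_one, ← mul_swap_apply_left (x := x), Perm.sameCycle_apply_right]
    | succ i ih =>
      intro hi
      have := ih (by omega)
      rw [pow_succ', Perm.mul_apply, ← mul_swap_apply_of_ne (x := x) (y := y),
        Perm.sameCycle_apply_right]
      · exact this
      · intro h3
        exact h ((Perm.SameCycle.symm ⟨(i + 1 : ℕ), by rw [zpow_natCast]; exact h3⟩))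
      · intro h3
        have h4 : Function.IsPeriodicPt f (i + 1) y := by
          rwa [Function.IsPeriodicPt, Function.IsFixedPt, Perm.iterate_eq_pow]
        exact Function.not_isPeriodicPt_of_pos_of_lt_minimalPeriod (by omega) (by omega) h4
  have := key (Function.minimalPeriod f y - 1) (by omega)
  rw [Nat.sub_add_cancel hpos] at this
  have h5 : (f ^ Function.minimalPeriod f y) y = y := by
    rw [← Perm.iterate_eq_pow]
    exact Function.isPeriodicPt_minimalPeriod f y
  rwa [h5] at this

/-- Multiplication by a transposition of points of different orbits merges the orbits. -/
theorem sameCycle_mul_swap_iff [Finite D] (h : ¬ f.SameCycle x y) {a b : D} :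
    (f * swap x y).SameCycle a b ↔ f.SameCycle a b ∨
      ((f.SameCycle a x ∨ f.SameCycle a y) ∧ (f.SameCycle b x ∨ f.SameCycle b y)) := by
  have hxy := sameCycle_mul_swap_self h
  have h1 : ∀ a b, f.SameCycle a b → (f * swap x y).SameCycle a b := by
    intro a b hab
    refine sameCycle_of_forall fun P hP ha => ?_
    have hP' : P x ↔ P y := iff_of_sameCycle hP hxy
    refine (iff_of_sameCycle (f := f) (fun d => ?_) hab).1 ha
    by_cases hx : d = x
    · rw [hx, hP', ← hP y, mul_swap_apply_right]
    by_cases hy : d = y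
    · rw [hy, ← hP', ← hP x, mul_swap_apply_left]
    rw [← hP d, mul_swap_apply_of_ne hx hy]
  have h2 : ∀ a, f.SameCycle a x ∨ f.SameCycle a y → (f * swap x y).SameCycle a x := by
    rintro a (ha | ha)
    · exact h1 _ _ ha
    · exact (h1 _ _ ha).trans hxy.symm
  constructor
  · intro hab
    let P : D → Prop := fun b => f.SameCycle a b ∨
      ((f.SameCycle a x ∨ f.SameCycle a y) ∧ (f.SameCycle b x ∨ f.SameCycle b y))
    refine (iff_of_sameCycle (f := f * swap x y) (P := P) (fun d => ?_) hab).1 (Or.inl .rfl)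
    by_cases hx : d = x
    · subst hx
      simp only [P, mul_swap_apply_left, Perm.sameCycle_apply_left, Perm.sameCycle_apply_right]
      simp only [Perm.SameCycle.refl, true_or, or_true]
      tauto
    by_cases hy : d = y
    · subst hy
      simp only [P, mul_swap_apply_right, Perm.sameCycle_apply_left, Perm.sameCycle_apply_right]
      simp only [Perm.SameCycle.refl, true_or, or_true]
      tauto
    simp only [P, mul_swap_apply_of_ne hx hy, Perm.sameCycle_apply_left,
      Perm.sameCycle_apply_right]
  · rintro (hab | ⟨ha, hb⟩)
    · exact h1 _ _ hab
    · exact (h2 _ ha).trans (h2 _ hb).symm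

/-- The map on orbits induced by the merging of two of them. -/
def mergeMap [Finite D] (h : ¬ f.SameCycle x y) : Orbit f → Orbit (f * swap x y) :=
  Quotient.map id fun _ _ hab => (sameCycle_mul_swap_iff h).2 (Or.inl hab)

theorem mergeMap_orbitOf [Finite D] (h : ¬ f.SameCycle x y) (a : D) :
    mergeMap h (orbitOf f a) = orbitOf _ a := rfl

theorem mergeMap_eq_iff [Finite D] (h : ¬ f.SameCycle x y) {a b : D} :
    mergeMap h (orbitOf f a) = mergeMap h (orbitOf f b) ↔ f.SameCycle a b ∨
      ((f.SameCycle a x ∨ f.SameCycle a y) ∧ (f.SameCycle b x ∨ f.SameCycle b y)) := by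
  rw [mergeMap_orbitOf, mergeMap_orbitOf, orbitOf_eq_iff, sameCycle_mul_swap_iff h]

-- Away from the two merged orbits nothing happens. The general commutative monoid allows two uses:
-- counting orbits in `Multiplicative ℕ`, and comparing weights in `ℝ≥0∞`.
open Classical in
theorem prod_mergeMap [Finite D] {M : Type*} [CommMonoid M] (h : ¬ f.SameCycle x y)
    (F : Orbit f → M) (G : Orbit (f * swap x y) → M)
    (hFG : ∀ a, ¬ f.SameCycle a x → ¬ f.SameCycle a y →
      F (orbitOf f a) = G (mergeMap h (orbitOf f a))) :
    ∏ o ∈ (Finset.univ.erase (orbitOf f x)).erase (orbitOf f y), F o =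
      ∏ o ∈ Finset.univ.erase (orbitOf (f * swap x y) x), G o := by
  refine Finset.prod_nbij (mergeMap h) ?_ ?_ ?_ ?_
  · intro o ho
    obtain ⟨a, rfl⟩ := exists_orbitOf o
    simp only [Finset.mem_erase, Finset.mem_univ, and_true, ne_eq, orbitOf_eq_iff,
      mergeMap_orbitOf, sameCycle_mul_swap_iff h] at ho ⊢
    tauto
  · intro o ho o' ho' hoo
    obtain ⟨a, rfl⟩ := exists_orbitOf o
    obtain ⟨b, rfl⟩ := exists_orbitOf o'
    simp only [Finset.coe_erase, Set.mem_sdiff, Set.mem_singleton_iff,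
      Finset.coe_univ, Set.mem_univ, true_and, orbitOf_eq_iff] at ho ho'
    rw [mergeMap_eq_iff] at hoo
    rw [orbitOf_eq_iff]
    tauto
  · intro o ho
    obtain ⟨a, rfl⟩ := exists_orbitOf o
    refine ⟨orbitOf f a, ?_, rfl⟩
    simp only [Finset.coe_erase, Set.mem_sdiff, Set.mem_singleton_iff,
      Finset.coe_univ, Set.mem_univ, true_and, orbitOf_eq_iff, sameCycle_mul_swap_iff h] at ho ⊢
    have := Perm.SameCycle.refl f x
    tauto
  · intro o ho
    obtain ⟨a, rfl⟩ := exists_orbitOf o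
    simp only [Finset.mem_erase, Finset.mem_univ, and_true, ne_eq, orbitOf_eq_iff] at ho
    exact hFG a ho.2 ho.1

theorem numOrbits_mul_swap [Finite D] (h : ¬ f.SameCycle x y) :
    numOrbits f = numOrbits (f * swap x y) + 1 := by
  classical
  have := prod_mergeMap (M := Multiplicative ℕ) h (fun _ => Multiplicative.ofAdd 1)
    (fun _ => Multiplicative.ofAdd 1) fun _ _ _ => rfl
  rw [Finset.prod_const, Finset.prod_const] at this
  simp only [← ofAdd_nsmul, smul_eq_mul, mul_one] at this
  have h2 := Multiplicative.ofAdd.injective this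
  rw [Finset.card_erase_of_mem, Finset.card_erase_of_mem (Finset.mem_univ _),
    Finset.card_erase_of_mem (Finset.mem_univ _)] at h2
  · have h3 : 1 < Fintype.card (Orbit f) := Fintype.one_lt_card_iff.2
      ⟨orbitOf f x, orbitOf f y, fun hh => h (orbitOf_eq_iff.1 hh)⟩
    have h4 : 0 < Fintype.card (Orbit (f * swap x y)) :=
      Fintype.card_pos_iff.2 ⟨orbitOf _ x⟩
    simp only [Finset.card_univ] at h2
    simp only [numOrbits, Nat.card_eq_fintype_card]
    omega
  · simp only [Finset.mem_erase, Finset.mem_univ, and_true, ne_eq, orbitOf_eq_iff]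
    exact fun hh => h hh.symm

theorem size_mul_swap_of_not [Finite D] (h : ¬ f.SameCycle x y) {a : D} (hx : ¬ f.SameCycle a x)
    (hy : ¬ f.SameCycle a y) : (orbitOf (f * swap x y) a).size = (orbitOf f a).size := by
  refine size_congr fun d => ?_
  rw [sameCycle_mul_swap_iff h]
  tauto

theorem size_mul_swap [Finite D] (h : ¬ f.SameCycle x y) :
    (orbitOf (f * swap x y) x).size = (orbitOf f x).size + (orbitOf f y).size := by
  classical
  cases nonempty_fintype D
  simp only [size_orbitOf, Nat.card_eq_fintype_card]
  rw [← Fintype.card_subtype_or_disjoint]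
  · refine Fintype.card_congr (Equiv.subtypeEquivRight fun d => ?_)
    rw [sameCycle_mul_swap_iff h]
    have := Perm.SameCycle.refl f x
    tauto
  · rw [Pi.disjoint_iff]
    intro d
    simp only [Prop.disjoint_iff]
    rintro ⟨h1, h2⟩
    exact h (h1.symm.trans h2)

open Classical in
theorem innerProd_mul_swap [Finite D] (q : ℕ → ℝ) (h : ¬ f.SameCycle x y) :
    innerProd q f x = ENNReal.ofReal (q ((orbitOf f y).size / 2)) *
      innerProd q (f * swap x y) x := by
  rw [innerProd, innerProd, ← prod_mergeMap h (fun o => ENNReal.ofReal (q (o.size / 2))),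
    Finset.mul_prod_erase _ (fun o : Orbit f => ENNReal.ofReal (q (o.size / 2)))]
  · simp only [Finset.mem_erase, Finset.mem_univ, and_true, ne_eq, orbitOf_eq_iff]
    exact fun hh => h hh.symm
  · intro a hx hy
    rw [mergeMap_orbitOf, size_mul_swap_of_not h hx hy]

/-- Multiplication by a transposition of points of the same orbit splits the orbit. -/
theorem not_sameCycle_mul_swap [Finite D] (hne : x ≠ y) (h : f.SameCycle x y) :
    ¬ (f * swap x y).SameCycle x y := by
  classical
  have hex : ∃ p : ℕ, 0 < p ∧ (f ^ p) x = y := by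
    obtain ⟨i, hi⟩ := h.exists_nat_pow_eq
    refine ⟨i, Nat.pos_of_ne_zero ?_, hi⟩
    rintro rfl
    exact hne hi
  let n := Nat.find hex
  have hn : 0 < n ∧ (f ^ n) x = y := Nat.find_spec hex
  have hmin : ∀ i, 0 < i → i < n → (f ^ i) x ≠ y := fun i hi hin h =>
    Nat.find_min hex hin ⟨hi, h⟩
  have hx : ∀ i, 0 < i → i ≤ n → (f ^ i) x ≠ x := by
    intro i hi hin hix
    rcases hin.lt_or_eq with hin | rfl
    · refine hmin (n - i) (by omega) (by omega) ?_
      rw [← hn.2]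
      conv_rhs => rw [show n = (n - i) + i by omega, pow_add, Perm.mul_apply, hix]
    · exact hne (hix.symm.trans hn.2)
  intro hs
  -- The arc `f x, ..., f ^ n x = y` is closed under the product, because `y` is now sent back to `f
  -- x`; by minimality of `n` it does not contain `x`.
  have hS : ∀ d, (∃ i, 0 < i ∧ i ≤ n ∧ (f ^ i) x = d) →
      ∃ i, 0 < i ∧ i ≤ n ∧ (f ^ i) x = (f * swap x y) d := by
    rintro d ⟨i, h1, h2, rfl⟩
    rcases h2.lt_or_eq with h2 | rfl
    · refine ⟨i + 1, by omega, by omega, ?_⟩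
      rw [mul_swap_apply_of_ne (hx i h1 h2.le) (hmin i h1 h2), pow_succ', Perm.mul_apply]
    · refine ⟨1, by omega, by omega, ?_⟩
      rw [hn.2, mul_swap_apply_right, pow_one]
  have hpow : ∀ k : ℕ, ∃ i, 0 < i ∧ i ≤ n ∧ (f ^ i) x = ((f * swap x y) ^ k) y := by
    intro k
    induction k with
    | zero => exact ⟨n, hn.1, le_rfl, hn.2⟩
    | succ k ih =>
      rw [pow_succ', Perm.mul_apply]
      exact hS _ ih
  obtain ⟨k, hk⟩ := hs.symm.exists_nat_pow_eq
  obtain ⟨i, h1, h2, h3⟩ := hpow k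
  exact hx i h1 h2 (h3.trans hk)

end Swap

/-! ### Direct sums of permutations. -/

section Sum

variable {A B : Type} {f : Perm A} {g : Perm B}

theorem sumCongr_inl (a : A) : Perm.sumCongr f g (Sum.inl a) = Sum.inl (f a) := rfl

theorem sumCongr_inr (b : B) : Perm.sumCongr f g (Sum.inr b) = Sum.inr (g b) := rfl

theorem sameCycle_inl_inl {a b : A} :
    (Perm.sumCongr f g).SameCycle (Sum.inl a) (Sum.inl b) ↔ f.SameCycle a b := by
  constructor
  · intro h
    refine sameCycle_of_forall fun P hP ha => ?_
    exact (iff_of_sameCycle (P := fun d => Sum.elim P (fun _ => True) d)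
      (by rintro (d | d) <;> simp [hP]) h).1 ha
  · intro h
    refine sameCycle_of_forall fun P hP ha => ?_
    exact (iff_of_sameCycle (P := fun d => P (Sum.inl d)) (fun d => hP (Sum.inl d)) h).1 ha

theorem sameCycle_inr_inr {a b : B} :
    (Perm.sumCongr f g).SameCycle (Sum.inr a) (Sum.inr b) ↔ g.SameCycle a b := by
  constructor
  · intro h
    refine sameCycle_of_forall fun P hP ha => ?_
    exact (iff_of_sameCycle (P := fun d => Sum.elim (fun _ => True) P d)
      (by rintro (d | d) <;> simp [hP]) h).1 ha
  · intro h
    refine sameCycle_of_forall fun P hP ha => ?_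
    exact (iff_of_sameCycle (P := fun d => P (Sum.inr d)) (fun d => hP (Sum.inr d)) h).1 ha

theorem not_sameCycle_inl_inr {a : A} {b : B} :
    ¬ (Perm.sumCongr f g).SameCycle (Sum.inl a) (Sum.inr b) := by
  intro h
  simpa using iff_of_sameCycle (P := fun d => d.isLeft = true) (by rintro (d | d) <;> simp) h

theorem size_inl [Finite A] [Finite B] (a : A) :
    (orbitOf (Perm.sumCongr f g) (Sum.inl a)).size = (orbitOf f a).size := by
  rw [size_orbitOf, size_orbitOf]
  refine Nat.card_congr (Equiv.ofBijective
    (fun d => ⟨Sum.inl d.1, sameCycle_inl_inl.2 d.2⟩) ⟨fun d e h => ?_, ?_⟩).symm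
  · exact Subtype.ext (Sum.inl_injective (congrArg Subtype.val h))
  · rintro ⟨d | d, h⟩
    · exact ⟨⟨d, sameCycle_inl_inl.1 h⟩, rfl⟩
    · exact (not_sameCycle_inl_inr h.symm).elim

theorem size_inr [Finite A] [Finite B] (b : B) :
    (orbitOf (Perm.sumCongr f g) (Sum.inr b)).size = (orbitOf g b).size := by
  rw [size_orbitOf, size_orbitOf]
  refine Nat.card_congr (Equiv.ofBijective
    (fun d => ⟨Sum.inr d.1, sameCycle_inr_inr.2 d.2⟩) ⟨fun d e h => ?_, ?_⟩).symm
  · exact Subtype.ext (Sum.inr_injective (congrArg Subtype.val h))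
  · rintro ⟨d | d, h⟩
    · exact (not_sameCycle_inl_inr h).elim
    · exact ⟨⟨d, sameCycle_inr_inr.1 h⟩, rfl⟩

/-- The orbits of a direct sum of permutations. -/
def orbitSum (f : Perm A) (g : Perm B) : Orbit f ⊕ Orbit g ≃ Orbit (Perm.sumCongr f g) :=
  Equiv.ofBijective (Sum.elim (Quotient.map Sum.inl fun _ _ h => sameCycle_inl_inl.2 h)
    (Quotient.map Sum.inr fun _ _ h => sameCycle_inr_inr.2 h)) <| by
    constructor
    · rintro (⟨⟨a⟩⟩ | ⟨⟨a⟩⟩) (⟨⟨b⟩⟩ | ⟨⟨b⟩⟩) h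
      · exact congrArg Sum.inl (orbitOf_eq_iff.2 (sameCycle_inl_inl.1 (orbitOf_eq_iff.1 h)))
      · exact (not_sameCycle_inl_inr (orbitOf_eq_iff.1 h)).elim
      · exact (not_sameCycle_inl_inr (orbitOf_eq_iff.1 h).symm).elim
      · exact congrArg Sum.inr (orbitOf_eq_iff.2 (sameCycle_inr_inr.1 (orbitOf_eq_iff.1 h)))
    · rintro ⟨a | b⟩
      · exact ⟨Sum.inl (orbitOf f a), rfl⟩
      · exact ⟨Sum.inr (orbitOf g b), rfl⟩

theorem orbitSum_inl (a : A) :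
    orbitSum f g (Sum.inl (orbitOf f a)) = orbitOf _ (Sum.inl a) := rfl

theorem orbitSum_inr (b : B) :
    orbitSum f g (Sum.inr (orbitOf g b)) = orbitOf _ (Sum.inr b) := rfl

theorem numOrbits_sumCongr [Finite A] [Finite B] :
    numOrbits (Perm.sumCongr f g) = numOrbits f + numOrbits g := by
  rw [numOrbits, ← Nat.card_congr (orbitSum f g), Nat.card_sum]
  rfl

/-- The transposition merges exactly the two orbits omitted on the right into the one omitted on the
left; all other orbits keep their size. -/
theorem innerProd_sumCongr [Finite A] [Finite B] [DecidableEq (A ⊕ B)] (q : ℕ → ℝ) (x : A)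
    (y : B) :
    innerProd q (Perm.sumCongr f g * swap (Sum.inl x) (Sum.inr y)) (Sum.inl x) =
      innerProd q f x * innerProd q g y := by
  classical
  have h : ¬ (Perm.sumCongr f g).SameCycle (Sum.inl x) (Sum.inr y) := not_sameCycle_inl_inr
  rw [innerProd, ← prod_mergeMap h (fun o => ENNReal.ofReal (q (o.size / 2)))]
  · rw [innerProd, innerProd, ← Finset.prod_sumElim]
    symm
    refine Finset.prod_equiv (orbitSum f g) (fun o => ?_) fun o _ => ?_
    · rcases o with o | o
      · obtain ⟨a, rfl⟩ := exists_orbitOf o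
        rw [orbitSum_inl]
        simp only [Finset.mem_erase, Finset.mem_univ, and_true, ne_eq, orbitOf_eq_iff,
          Finset.inl_mem_disjSum, sameCycle_inl_inl, not_sameCycle_inl_inr, not_false_eq_true,
          true_and]
      · obtain ⟨a, rfl⟩ := exists_orbitOf o
        rw [orbitSum_inr]
        simp only [Finset.mem_erase, Finset.mem_univ, and_true, ne_eq, orbitOf_eq_iff,
          Finset.inr_mem_disjSum, sameCycle_inr_inr,
          Perm.sameCycle_comm (f := Perm.sumCongr f g) (x := Sum.inr a) (y := Sum.inl x),
          not_sameCycle_inl_inr, not_false_eq_true, and_true]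
    · rcases o with o | o
      · obtain ⟨a, rfl⟩ := exists_orbitOf o
        rw [orbitSum_inl, size_inl]
        rfl
      · obtain ⟨a, rfl⟩ := exists_orbitOf o
        rw [orbitSum_inr, size_inr]
        rfl
  · intro a hx hy
    rw [mergeMap_orbitOf, size_mul_swap_of_not h hx hy]

end Sum

/-! ### Connectivity and the non-negativity of the genus. -/

section Genus

variable {D : Type}

/-- Two permutations generate a transitive group: all invariant predicates are trivial. -/
def Conn (σ α : Perm D) : Prop :=
  ∀ P : D → Prop, (∀ d, P (σ d) ↔ P d) → (∀ d, P (α d) ↔ P d) → ∀ d e, P d → P e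

theorem conn_iff {σ α : Perm D} :
    Conn σ α ↔ ∀ d e, ∃ g ∈ Subgroup.closure {σ, α}, g d = e := by
  constructor
  · intro h d e
    refine h (fun e => ∃ g ∈ Subgroup.closure {σ, α}, g d = e) ?_ ?_ d e ⟨1, one_mem _, rfl⟩
    all_goals
      intro x
      constructor
    · rintro ⟨g, hg, hx⟩
      exact ⟨σ⁻¹ * g, mul_mem (inv_mem (Subgroup.subset_closure (by simp))) hg, by simp [hx]⟩
    · rintro ⟨g, hg, hx⟩
      exact ⟨σ * g, mul_mem (Subgroup.subset_closure (by simp)) hg, by simp [hx]⟩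
    · rintro ⟨g, hg, hx⟩
      exact ⟨α⁻¹ * g, mul_mem (inv_mem (Subgroup.subset_closure (by simp))) hg, by simp [hx]⟩
    · rintro ⟨g, hg, hx⟩
      exact ⟨α * g, mul_mem (Subgroup.subset_closure (by simp)) hg, by simp [hx]⟩
  · intro h P h1 h2 d e hd
    obtain ⟨g, hg, rfl⟩ := h d e
    have : ∀ d, P (g d) ↔ P d := by
      induction hg using Subgroup.closure_induction with
      | mem x hx =>
        rcases hx with rfl | rfl
        · exact h1
        · exact h2
      | one => simp
      | mul x y _ _ hx hy => intro d; rw [Perm.mul_apply, hx, hy]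
      | inv x _ hx => intro d; rw [← hx]; simp
    exact (this d).2 hd

/-- Composition with a permutation, as a linear map on functions. -/
def compPerm (f : Perm D) : (D → ℚ) →ₗ[ℚ] (D → ℚ) := LinearMap.funLeft ℚ ℚ f

theorem compPerm_apply (f : Perm D) (v : D → ℚ) (d : D) : compPerm f v d = v (f d) := rfl

/-- The functions fixed by `f` are those that factor through its orbits. Orbit counts thereby become
dimensions. -/
theorem finrank_ker_compPerm [Finite D] (f : Perm D) :
    Module.finrank ℚ (LinearMap.ker (compPerm f - 1)) = numOrbits f := by
  let e : (Orbit f → ℚ) →ₗ[ℚ] (D → ℚ) := LinearMap.funLeft ℚ ℚ (orbitOf f)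
  have he : Function.Injective e :=
    LinearMap.funLeft_injective_of_surjective ℚ ℚ _ exists_orbitOf
  have hr : LinearMap.range e = LinearMap.ker (compPerm f - 1) := by
    ext v
    simp only [LinearMap.mem_range, LinearMap.mem_ker, LinearMap.sub_apply, sub_eq_zero,
      Module.End.one_apply]
    constructor
    · rintro ⟨w, rfl⟩
      ext d
      change w (orbitOf f (f d)) = w (orbitOf f d)
      rw [orbitOf_eq_iff.2 (Perm.sameCycle_apply_left.2 (Perm.SameCycle.refl f d))]
    · intro hv
      refine ⟨fun o => Quotient.lift v (fun a b h => ?_) o, rfl⟩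
      refine ((iff_of_sameCycle (P := fun b => v a = v b) (fun d => ?_) h).1 rfl)
      rw [← compPerm_apply f v d, hv]
  rw [← hr, LinearMap.finrank_range_of_inj he, Module.finrank_fintype_fun_eq_card, numOrbits,
    Nat.card_eq_fintype_card]

theorem finrank_range_compPerm [Finite D] (f : Perm D) :
    Module.finrank ℚ (LinearMap.range (compPerm f - 1)) + numOrbits f = Nat.card D := by
  cases nonempty_fintype D
  rw [← finrank_ker_compPerm, LinearMap.finrank_range_add_finrank_ker,
    Module.finrank_fintype_fun_eq_card, Nat.card_eq_fintype_card]

/-- `β` maps into `ker δ`, and what it kills is detected by the single linear form `l`; so `(β, l)`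
embeds `U` into `ker δ × K`. -/
theorem finrank_le_finrank_ker_add_one {K U W X : Type*} [Field K] [AddCommGroup U] [Module K U]
    [AddCommGroup W] [Module K W] [AddCommGroup X] [Module K X] [FiniteDimensional K W]
    (δ : W →ₗ[K] X) (β : U →ₗ[K] W) (l : U →ₗ[K] K) (h : ∀ u, δ (β u) = 0)
    (hinj : ∀ u, β u = 0 → l u = 0 → u = 0) :
    Module.finrank K U ≤ Module.finrank K (LinearMap.ker δ) + 1 := by
  rw [← Module.finrank_self K, ← Module.finrank_prod]
  refine LinearMap.finrank_le_finrank_of_injective (f := (β.codRestrict _ h).prod l) ?_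
  refine (injective_iff_map_eq_zero _).2 fun u hu => ?_
  exact hinj u (congrArg Subtype.val (congrArg Prod.fst hu)) (congrArg Prod.snd hu)

/-- The genus of a connected map is non-negative. -/
theorem numOrbits_add_le [Finite D] {σ α : Perm D} (h : Conn σ α) :
    numOrbits σ + numOrbits α + numOrbits (σ * α) ≤ Nat.card D + 2 := by
  classical
  cases nonempty_fintype D
  rcases isEmpty_or_nonempty D with hD | ⟨⟨d₀⟩⟩
  · have : ∀ f : Perm D, numOrbits f = 0 := fun f =>
      @Nat.card_of_isEmpty _ ⟨fun o => hD.false (exists_orbitOf o).choose⟩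
    simp [this]
  let R (f : Perm D) := LinearMap.range (compPerm f - 1)
  -- `δ (u, w) = u ∘ α + w`, chosen so that the pair `(v ∘ σ - v, v ∘ α - v)` is sent to `v ∘ σ ∘ α
  -- - v`.
  let δ : (R σ × R α) →ₗ[ℚ] (D → ℚ) :=
    (compPerm α ∘ₗ (R σ).subtype).coprod (R α).subtype
  have h1 := LinearMap.finrank_range_add_finrank_ker δ
  rw [Module.finrank_prod] at h1
  have hR : ∀ f v, (compPerm f - 1) v ∈ R f := fun f v => LinearMap.mem_range_self _ v
  -- By connectivity the range contains every difference of two basis vectors, hence has codimension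
  -- at most one.
  have h2 : Nat.card D ≤ Module.finrank ℚ (LinearMap.range δ) + 1 := by
    have hα : R α ≤ LinearMap.range δ := fun w hw => ⟨(0, ⟨w, hw⟩), by simp [δ]⟩
    have hσ : R σ ≤ LinearMap.range δ := by
      intro w hw
      refine ⟨(⟨w, hw⟩, -⟨_, hR α w⟩), ?_⟩
      simp [δ]
    have hsub : ∀ (f : Perm D) (d : D), Pi.single d 1 - Pi.single (f d) 1 ∈ R f := by
      intro f d
      convert hR f (Pi.single (f d) 1) using 1
      ext e
      simp [compPerm_apply, Pi.single_apply]
    have hP : ∀ d, (Pi.single d 1 - Pi.single d₀ 1 : D → ℚ) ∈ LinearMap.range δ := by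
      intro d
      refine h (fun d => (Pi.single d 1 - Pi.single d₀ 1 : D → ℚ) ∈ LinearMap.range δ)
        ?_ ?_ d₀ d (by simp)
      · intro d
        rw [← Submodule.add_mem_iff_right _ (hσ (hsub σ d))]
        simp
      · intro d
        rw [← Submodule.add_mem_iff_right _ (hα (hsub α d))]
        simp
    have htop : LinearMap.range δ ⊔ Submodule.span ℚ {(Pi.single d₀ 1 : D → ℚ)} = ⊤ := by
      rw [eq_top_iff, ← (Pi.basisFun ℚ D).span_eq, Submodule.span_le]
      rintro _ ⟨d, rfl⟩
      rw [Pi.basisFun_apply, ← sub_add_cancel (Pi.single d 1 : D → ℚ) (Pi.single d₀ 1)]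
      exact Submodule.add_mem_sup (hP d) (Submodule.mem_span_singleton_self _)
    have h3 := Submodule.finrank_add_le_finrank_add_finrank (LinearMap.range δ)
      (Submodule.span ℚ {(Pi.single d₀ 1 : D → ℚ)})
    rw [htop, finrank_top, Module.finrank_fintype_fun_eq_card] at h3
    rw [Nat.card_eq_fintype_card]
    refine h3.trans (Nat.add_le_add_left ?_ _)
    exact (finrank_span_le_card _).trans (by simp)
  -- A function killed by `β` is invariant under `σ` and `α`, hence constant by connectivity, and is
  -- detected by its value at `d₀`.
  have h3 : numOrbits (σ * α) ≤ Module.finrank ℚ (LinearMap.ker δ) + 1 := by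
    let β : (D → ℚ) →ₗ[ℚ] (R σ × R α) :=
      (compPerm σ - 1).rangeRestrict.prod (compPerm α - 1).rangeRestrict
    rw [← finrank_ker_compPerm]
    refine finrank_le_finrank_ker_add_one δ (β ∘ₗ (LinearMap.ker (compPerm (σ * α) - 1)).subtype)
      ((LinearMap.proj d₀ : (D → ℚ) →ₗ[ℚ] ℚ) ∘ₗ (LinearMap.ker (compPerm (σ * α) - 1)).subtype)
      ?_ ?_
    · rintro ⟨v, hv⟩
      rw [LinearMap.mem_ker] at hv
      rw [← hv]
      ext d
      simp [δ, β, compPerm_apply]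
    rintro ⟨v, hv⟩ hγ1 hγ2
    change β v = 0 at hγ1
    change v d₀ = 0 at hγ2
    have hv1 : ∀ d, v (σ d) = v d := fun d =>
      sub_eq_zero.1 (congrFun (congrArg Subtype.val (congrArg Prod.fst hγ1)) d)
    have hv2 : ∀ d, v (α d) = v d := fun d =>
      sub_eq_zero.1 (congrFun (congrArg Subtype.val (congrArg Prod.snd hγ1)) d)
    ext d
    exact h (fun d => v d = 0) (fun d => by rw [hv1]) (fun d => by rw [hv2]) d₀ d hγ2
  have h4 := finrank_range_compPerm σ
  have h5 := finrank_range_compPerm α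
  change Module.finrank ℚ (R σ) + _ = _ at h4
  change Module.finrank ℚ (R α) + _ = _ at h5
  omega

end Genus

/-! ### Rooted rotation systems, planarity, parity of the perimeter, isomorphism classes. -/

/-- A rotation system with a root, not necessarily planar; fixed points of `flip` are
half-edges. -/
structure Pre (D : Type) where
  rot : Perm D
  flip : Perm D
  root : D

namespace Pre

variable {D E F : Type}

/-- The face permutation. -/
def face (m : Pre D) : Perm D := m.rot * m.flip

theorem face_apply (m : Pre D) (d : D) : m.face d = m.rot (m.flip d) := rfl

/-- Root preserving isomorphism. -/
def Iso (m : Pre D) (m' : Pre E) : Prop :=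
  ∃ e : D ≃ E, (∀ d, e (m.rot d) = m'.rot (e d)) ∧ (∀ d, e (m.flip d) = m'.flip (e d)) ∧
    e m.root = m'.root

theorem Iso.refl (m : Pre D) : m.Iso m := ⟨Equiv.refl _, fun _ => rfl, fun _ => rfl, rfl⟩

theorem Iso.symm {m : Pre D} {m' : Pre E} : m.Iso m' → m'.Iso m := by
  rintro ⟨e, h1, h2, h3⟩
  exact ⟨e.symm, fun d => by simp [Equiv.symm_apply_eq, h1],
    fun d => by simp [Equiv.symm_apply_eq, h2], by simp [Equiv.symm_apply_eq, h3]⟩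

theorem Iso.trans {m : Pre D} {m' : Pre E} {m'' : Pre F} : m.Iso m' → m'.Iso m'' → m.Iso m'' := by
  rintro ⟨e, h1, h2, h3⟩ ⟨e', h1', h2', h3'⟩
  exact ⟨e.trans e', fun d => by simp [h1, h1'], fun d => by simp [h2, h2'], by simp [h3, h3']⟩

/-- Transport along a bijection. -/
def transport (m : Pre D) (e : D ≃ E) : Pre E :=
  ⟨e.permCongr m.rot, e.permCongr m.flip, e m.root⟩

theorem iso_transport (m : Pre D) (e : D ≃ E) : m.Iso (m.transport e) :=
  ⟨e, fun d => by simp [transport], fun d => by simp [transport], rfl⟩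

/-- The degree of the root face. -/
def perim (m : Pre D) : ℕ := (orbitOf m.face m.root).size

/-- The weight of the faces other than the root face. -/
def inner [Finite D] (q : ℕ → ℝ) (m : Pre D) : ℝ≥0∞ := innerProd q m.face m.root

def numVertices (m : Pre D) : ℕ := numOrbits m.rot

/-- The two sides of the root edge belong to different faces. -/
def Simple (m : Pre D) : Prop := ¬ m.face.SameCycle m.root (m.flip m.root)

/-- Planar connected maps all of whose non-root faces have even degree. -/
structure Planar (m : Pre D) : Prop where
  flip_flip : ∀ d, m.flip (m.flip d) = d
  conn : Conn m.rot m.flip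
  -- Without half-edges the number of darts is twice the number of edges, and this is `V + F = E +
  -- 2`. A half-edge adds one dart and one orbit of `flip`, so the same formula serves with legs.
  euler : numOrbits m.rot + numOrbits m.face + numOrbits m.flip = Nat.card D + 2
  -- The root face is exempt because a leg makes its degree odd.
  even : ∀ d, ¬ m.face.SameCycle d m.root → Even (orbitOf m.face d).size

/-- Rooted maps without half-edges. -/
structure Rooted (m : Pre D) : Prop extends m.Planar where
  flip_ne : ∀ d, m.flip d ≠ d

/-- Maps where the root is the only half-edge. -/
structure Leg (m : Pre D) : Prop extends m.Planar where
  flip_eq_iff : ∀ d, m.flip d = d ↔ d = m.root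

section Iso

variable {m : Pre D} {m' : Pre E}

theorem Iso.face_conj {e : D ≃ E} (h1 : ∀ d, e (m.rot d) = m'.rot (e d))
    (h2 : ∀ d, e (m.flip d) = m'.flip (e d)) (d : D) : e (m.face d) = m'.face (e d) := by
  rw [face_apply, face_apply, h1, h2]

theorem Iso.perim_eq (h : m.Iso m') : m.perim = m'.perim := by
  obtain ⟨e, h1, h2, h3⟩ := h
  rw [perim, perim, ← h3, ← orbitEquiv_orbitOf e (face_conj h1 h2), orbitEquiv_size]

theorem Iso.inner_eq [Finite D] [Finite E] (h : m.Iso m') (q : ℕ → ℝ) :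
    m.inner q = m'.inner q := by
  obtain ⟨e, h1, h2, h3⟩ := h
  refine innerProd_congr (orbitEquiv e (face_conj h1 h2)) ?_ fun o _ => orbitEquiv_size _ _ o
  rw [orbitEquiv_orbitOf, h3]

theorem Iso.numVertices_eq (h : m.Iso m') : m.numVertices = m'.numVertices := by
  obtain ⟨e, h1, h2, h3⟩ := h
  exact Nat.card_congr (orbitEquiv e h1)

theorem Iso.card_eq (h : m.Iso m') : Nat.card D = Nat.card E := by
  obtain ⟨e, -⟩ := h
  exact Nat.card_congr e

theorem Iso.simple (h : m.Iso m') (hm : m.Simple) : m'.Simple := by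
  obtain ⟨e, h1, h2, h3⟩ := h
  rwa [Simple, ← h3, ← h2, sameCycle_iff_of_conj e (face_conj h1 h2)]

theorem Iso.planar (h : m.Iso m') (hm : m.Planar) : m'.Planar := by
  have hcard := h.card_eq
  obtain ⟨e, h1, h2, h3⟩ := h
  have hf := face_conj h1 h2
  refine ⟨fun d => ?_, fun P hP1 hP2 d d' hd => ?_, ?_, fun d hd => ?_⟩
  · obtain ⟨d, rfl⟩ := e.surjective d
    rw [← h2, ← h2, hm.flip_flip]
  · obtain ⟨d, rfl⟩ := e.surjective d
    obtain ⟨d', rfl⟩ := e.surjective d'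
    exact hm.conn (fun d => P (e d)) (fun d => by rw [h1, hP1]) (fun d => by rw [h2, hP2]) d d' hd
  · rw [← hcard, ← hm.euler]
    congr 1
    · congr 1
      · exact (Nat.card_congr (orbitEquiv e h1)).symm
      · exact (Nat.card_congr (orbitEquiv e hf)).symm
    · exact (Nat.card_congr (orbitEquiv e h2)).symm
  · obtain ⟨d, rfl⟩ := e.surjective d
    rw [← h3, sameCycle_iff_of_conj e hf] at hd
    rw [← orbitEquiv_orbitOf e hf, orbitEquiv_size]
    exact hm.even d hd

theorem Iso.rooted (h : m.Iso m') (hm : m.Rooted) : m'.Rooted := by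
  refine ⟨h.planar hm.toPlanar, ?_⟩
  obtain ⟨e, h1, h2, h3⟩ := h
  intro d
  obtain ⟨d, rfl⟩ := e.surjective d
  rw [← h2]
  exact fun hh => hm.flip_ne d (e.injective hh)

theorem Iso.leg (h : m.Iso m') (hm : m.Leg) : m'.Leg := by
  refine ⟨h.planar hm.toPlanar, ?_⟩
  obtain ⟨e, h1, h2, h3⟩ := h
  intro d
  obtain ⟨d, rfl⟩ := e.surjective d
  rw [← h2, ← h3, e.apply_eq_iff_eq, e.apply_eq_iff_eq]
  exact hm.flip_eq_iff d

end Iso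

section Parity

variable [Finite D] {m : Pre D}

theorem size_flip {f : Perm D} (hf : ∀ d, f (f d) = d) {d : D} (hd : f d ≠ d) :
    (orbitOf f d).size = 2 := by
  have : Fact (Nat.Prime 2) := ⟨Nat.prime_two⟩
  rw [← minimalPeriod_eq_size]
  exact Function.minimalPeriod_eq_prime (p := 2) (hf d) hd

theorem two_mul_numOrbits {f : Perm D} (hf : ∀ d, f (f d) = d) (hd : ∀ d, f d ≠ d) :
    2 * numOrbits f = Nat.card D := by
  rw [← sum_size f, Finset.sum_eq_card_nsmul (b := 2) (fun o _ => ?_)]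
  · rw [Finset.card_univ, numOrbits, Nat.card_eq_fintype_card, smul_eq_mul, mul_comm]
  · obtain ⟨d, rfl⟩ := exists_orbitOf o
    exact size_flip hf (hd d)

theorem odd_card_iff_odd_size {f : Perm D} {x : D}
    (h : ∀ d, ¬ f.SameCycle d x → Even (orbitOf f d).size) :
    Odd (Nat.card D) ↔ Odd (orbitOf f x).size := by
  classical
  rw [← sum_size f, ← Finset.add_sum_erase _ _ (Finset.mem_univ (orbitOf f x)), Nat.odd_add]
  refine iff_true_right (Finset.even_sum _ fun o ho => ?_)
  obtain ⟨d, rfl⟩ := exists_orbitOf o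
  exact h d fun hd => Finset.ne_of_mem_erase ho (orbitOf_eq_iff.2 hd)

/-- The other faces have even degree, so the root face carries the parity of the number of darts:
odd with one leg, even without half-edges. -/
theorem odd_perim_of_odd (hm : m.Planar) : Odd m.perim ↔ Odd (Nat.card D) :=
  (odd_card_iff_odd_size hm.even).symm

theorem odd_card_of_unique_fixed {f : Perm D} {x : D} (hf : ∀ d, f (f d) = d)
    (h : ∀ d, f d = d ↔ d = x) : Odd (Nat.card D) := by
  have hx := (h x).2 rfl
  rw [odd_card_iff_odd_size (f := f) (x := x), ← minimalPeriod_eq_size,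
    Function.minimalPeriod_eq_one_iff_isFixedPt.2 hx]
  · exact odd_one
  · intro d hd
    rw [size_flip hf]
    · exact even_two
    · intro h2
      rw [(h d).1 h2] at hd
      exact hd (Perm.SameCycle.refl _ _)

theorem Leg.odd_perim (hm : m.Leg) : Odd m.perim :=
  (odd_perim_of_odd hm.toPlanar).2 (odd_card_of_unique_fixed hm.flip_flip hm.flip_eq_iff)

theorem Rooted.even_perim (hm : m.Rooted) : Even m.perim := by
  rw [← Nat.not_odd_iff_even, odd_perim_of_odd hm.toPlanar, ← two_mul_numOrbits hm.flip_flip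
    hm.flip_ne]
  simp

theorem perim_pos (m : Pre D) : 0 < m.perim := size_pos _

end Parity

instance setoid : Setoid (Σ n : ℕ, Pre (Fin n)) where
  r m m' := m.2.Iso m'.2
  iseqv := ⟨fun m => Iso.refl m.2, Iso.symm, Iso.trans⟩

end Pre

/-- Isomorphism classes of rotation systems. -/
def PreClass : Type := Quotient Pre.setoid

variable {D E : Type} [Finite D] [Finite E]

/-- The isomorphism class. -/
def Pre.cls (m : Pre D) : PreClass :=
  Quotient.mk Pre.setoid ⟨Nat.card D, m.transport (Finite.equivFin D)⟩

theorem Pre.cls_eq_iff {m : Pre D} {m' : Pre E} : m.cls = m'.cls ↔ m.Iso m' := by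
  refine (Quotient.eq (r := Pre.setoid)).trans ?_
  constructor
  · exact fun h => ((m.iso_transport _).trans h).trans (m'.iso_transport _).symm
  · exact fun h => ((m.iso_transport _).symm.trans h).trans (m'.iso_transport _)

namespace PreClass

/-- A representative. -/
def rep (c : PreClass) : Pre (Fin (Quotient.out c).1) := (Quotient.out c).2

theorem cls_mk (m : Σ n : ℕ, Pre (Fin n)) : m.2.cls = Quotient.mk Pre.setoid m :=
  Quotient.sound (m.2.iso_transport _).symm

theorem cls_rep (c : PreClass) : c.rep.cls = c := (cls_mk _).trans (Quotient.out_eq c)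

theorem rep_cls_iso (m : Pre D) : m.cls.rep.Iso m := Pre.cls_eq_iff.1 (cls_rep _)

def perim (c : PreClass) : ℕ := c.rep.perim
def inner (q : ℕ → ℝ) (c : PreClass) : ℝ≥0∞ := c.rep.inner q
def numVertices (c : PreClass) : ℕ := c.rep.numVertices
def card (c : PreClass) : ℕ := (Quotient.out c).1
def Rooted (c : PreClass) : Prop := c.rep.Rooted
def Leg (c : PreClass) : Prop := c.rep.Leg
def Simple (c : PreClass) : Prop := c.rep.Simple

theorem perim_cls (m : Pre D) : m.cls.perim = m.perim := (rep_cls_iso m).perim_eq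

theorem inner_cls (q : ℕ → ℝ) (m : Pre D) : m.cls.inner q = m.inner q := (rep_cls_iso m).inner_eq q

theorem numVertices_cls (m : Pre D) : m.cls.numVertices = m.numVertices :=
  (rep_cls_iso m).numVertices_eq

theorem card_cls (m : Pre D) : m.cls.card = Nat.card D := by
  rw [← (rep_cls_iso m).card_eq, Nat.card_fin, card]

theorem rooted_cls {m : Pre D} : m.cls.Rooted ↔ m.Rooted :=
  ⟨(rep_cls_iso m).rooted, (rep_cls_iso m).symm.rooted⟩

theorem leg_cls {m : Pre D} : m.cls.Leg ↔ m.Leg :=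
  ⟨(rep_cls_iso m).leg, (rep_cls_iso m).symm.leg⟩

theorem simple_cls {m : Pre D} : m.cls.Simple ↔ m.Simple :=
  ⟨(rep_cls_iso m).simple, (rep_cls_iso m).symm.simple⟩

end PreClass

/-! ### Planar maps as classes of rooted rotation systems. -/

section PlanarMap

/-- The underlying rotation system of a rooted map. -/
def RootedMap.toPre (m : RootedMap D) : Pre D := ⟨m.rot, m.flip, m.root⟩

theorem RootedMap.rooted (m : RootedMap D) : m.toPre.Rooted := by
  refine ⟨⟨m.flip_flip, conn_iff.2 m.connected, ?_, fun d _ => m.even_degree _⟩, m.flip_ne⟩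
  have h1 := m.euler
  have h2 := Pre.two_mul_numOrbits m.flip_flip m.flip_ne
  simp only [numOrbits, RootedMap.toPre, Pre.face] at *
  omega

/-- The rooted map with a given rotation system. -/
def Pre.Rooted.toMap {m : Pre D} (h : m.Rooted) : RootedMap D where
  rot := m.rot
  flip := m.flip
  root := m.root
  flip_flip := h.flip_flip
  flip_ne := h.flip_ne
  connected := conn_iff.1 h.conn
  euler := by
    have h1 := h.euler
    have h2 := Pre.two_mul_numOrbits h.flip_flip h.flip_ne
    simp only [numOrbits, Pre.face] at *
    omega
  even_degree := by
    intro o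
    obtain ⟨d, rfl⟩ := exists_orbitOf o
    by_cases hd : (m.rot * m.flip).SameCycle d m.root
    · rw [orbitOf_eq_iff.2 hd]
      exact h.even_perim
    · exact h.even d hd

/-- Planar maps as classes of rotation systems. -/
def PlanarMap.toClass (m : PlanarMap) : PreClass :=
  Quotient.map (fun m : Σ n : ℕ, RootedMap (Fin n) => (⟨m.1, m.2.toPre⟩ : Σ n : ℕ, Pre (Fin n)))
    (fun _ _ h => h) m

theorem PlanarMap.toClass_mk (m : Σ n : ℕ, RootedMap (Fin n)) :
    PlanarMap.toClass (Quotient.mk isoSetoid m) = m.2.toPre.cls :=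
  (PreClass.cls_mk ⟨m.1, m.2.toPre⟩).symm

theorem PlanarMap.exists_mk (m : PlanarMap) :
    ∃ m' : Σ n : ℕ, RootedMap (Fin n), Quotient.mk isoSetoid m' = m := Quotient.exists_rep m

theorem PlanarMap.rooted_toClass (m : PlanarMap) : m.toClass.Rooted := by
  obtain ⟨m, rfl⟩ := m.exists_mk
  rw [toClass_mk, PreClass.rooted_cls]
  exact m.2.rooted

/-- Planar maps are the classes of rooted rotation systems. -/
def planarMapEquiv : PlanarMap ≃ {c : PreClass // c.Rooted} :=
  Equiv.ofBijective (fun m => ⟨m.toClass, m.rooted_toClass⟩) <| by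
    constructor
    · intro m m' h
      obtain ⟨m, rfl⟩ := m.exists_mk
      obtain ⟨m', rfl⟩ := m'.exists_mk
      have h2 := congrArg Subtype.val h
      dsimp only at h2
      rw [PlanarMap.toClass_mk, PlanarMap.toClass_mk, Pre.cls_eq_iff] at h2
      exact Quotient.sound h2
    · rintro ⟨c, hc⟩
      refine ⟨Quotient.mk isoSetoid ⟨_, Pre.Rooted.toMap hc⟩, Subtype.ext ?_⟩
      exact (PlanarMap.toClass_mk ⟨_, Pre.Rooted.toMap hc⟩).trans c.cls_rep

theorem PlanarMap.perim_toClass (m : PlanarMap) : m.toClass.perim = m.perimeter := by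
  obtain ⟨m, rfl⟩ := m.exists_mk
  rw [toClass_mk, PreClass.perim_cls]
  rfl

theorem PlanarMap.inner_toClass (q : ℕ → ℝ) (m : PlanarMap) :
    m.toClass.inner q = m.innerWeight q := by
  obtain ⟨m, rfl⟩ := m.exists_mk
  rw [toClass_mk, PreClass.inner_cls]
  rfl

theorem PlanarMap.numVertices_toClass (m : PlanarMap) :
    m.toClass.numVertices = m.numVertices := by
  obtain ⟨m, rfl⟩ := m.exists_mk
  rw [toClass_mk, PreClass.numVertices_cls]
  rfl

theorem PlanarMap.weight_eq (q : ℕ → ℝ) (m : PlanarMap) :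
    m.weight q = ENNReal.ofReal (q (m.perimeter / 2)) * m.innerWeight q := by
  classical
  obtain ⟨m, rfl⟩ := m.exists_mk
  exact (Finset.mul_prod_erase _ (fun o : m.2.Face => ENNReal.ofReal (q (o.size / 2)))
    (Finset.mem_univ m.2.rootFace)).symm

end PlanarMap

/-! ### Inserting a point into a permutation; attaching a leg to a map. -/

section Insert

variable {D E : Type}

/-- Insert a new point `none` into the cycle of `i`, just before `i`. -/
def insertBefore [DecidableEq D] (i : D) (σ : Perm D) : Perm (Option D) :=
  swap none (some i) * optionCongr σ

section

variable [DecidableEq D] {i : D} {σ : Perm D}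

@[simp]
theorem insertBefore_none : insertBefore i σ none = some i := by simp [insertBefore]

theorem insertBefore_some (d : D) :
    insertBefore i σ (some d) = if σ d = i then none else some (σ d) := by
  split_ifs with h
  · simp [insertBefore, h]
  · rw [insertBefore, Perm.mul_apply, optionCongr_apply, Option.map_some]
    exact swap_apply_of_ne_of_ne (by simp) (by simpa using h)

@[simp]
theorem removeNone_insertBefore : removeNone (insertBefore i σ) = σ :=
  congrArg Prod.snd (Perm.decomposeOption.right_inv (some i, σ))

theorem insertBefore_removeNone {g : Perm (Option D)} (h : g none = some i) :
    insertBefore i (removeNone g) = g := by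
  rw [insertBefore, map_equiv_removeNone, h, ← mul_assoc]
  simp

theorem insertBefore_mul_optionCongr {τ : Perm D} :
    insertBefore i σ * optionCongr τ = insertBefore i (σ * τ) := by
  rw [insertBefore, insertBefore, mul_assoc]
  congr 1
  ext1 (_ | d) <;> simp

theorem insertBefore_mul_swap (h : σ i = i) :
    insertBefore i σ * swap none (some i) = optionCongr σ := by
  ext1 (_ | d)
  · simp [insertBefore_some, h]
  · rw [Perm.mul_apply]
    by_cases hd : d = i
    · subst hd
      simp [h]
    · rw [swap_apply_of_ne_of_ne (by simp) (by simpa using hd), insertBefore_some, if_neg]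
      · simp
      · exact fun h' => hd (σ.injective (h'.trans h.symm))

theorem insertBefore_conj [DecidableEq E] {i' : E} {σ' : Perm E} (e : D ≃ E)
    (h : ∀ d, e (σ d) = σ' (e d)) (hi : e i = i') (d : Option D) :
    optionCongr e (insertBefore i σ d) = insertBefore i' σ' (optionCongr e d) := by
  subst hi
  rcases d with _ | d
  · simp
  · simp only [optionCongr_apply, Option.map_some, insertBefore_some, ← h, e.apply_eq_iff_eq]
    split_ifs <;> simp

end

theorem apply_some_of_none {e : Option D ≃ Option E} (h : e none = none) (d : D) :
    e (some d) = some (removeNone e d) := by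
  refine (removeNone_some e ?_).symm
  rcases h' : e (some d) with _ | x
  · rw [← h, e.apply_eq_iff_eq] at h'
    simp at h'
  · exact ⟨x, rfl⟩

theorem removeNone_conj {e : Option D ≃ Option E} (he : e none = none) {g : Perm (Option D)}
    {g' : Perm (Option E)} (h : ∀ d, e (g d) = g' (e d)) (d : D) :
    removeNone e (removeNone g d) = removeNone g' (removeNone e d) := by
  apply Option.some_injective
  rw [← apply_some_of_none he]
  rcases h1 : g (some d) with _ | x
  · have h2 : g' (some (removeNone e d)) = none := by
      rw [← apply_some_of_none he, ← h, h1, he]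
    rw [removeNone_none _ h1, removeNone_none _ h2, h, he]
  · have h2 : g' (some (removeNone e d)) = some (removeNone e x) := by
      rw [← apply_some_of_none he, ← h, h1, apply_some_of_none he]
    rw [removeNone_some _ ⟨_, h1⟩, removeNone_some _ ⟨_, h2⟩, h, apply_some_of_none he]

theorem conn_of_removeNone {σ α : Perm (Option D)} {y : D} (hy : σ none = some y)
    (h : Conn (removeNone σ) (removeNone α)) : Conn σ α := by
  intro P h1 h2
  have key : ∀ d, P d ↔ P (some y) := by
    have h3 := h (fun d => P (some d)) (iff_removeNone h1) (iff_removeNone h2)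
    rintro (_ | d)
    · rw [← h1, hy]
    · exact ⟨h3 d y, h3 y d⟩
  intro d e hd
  rwa [key e, ← key d]

theorem conn_removeNone {σ α : Perm (Option D)} (h : Conn σ α)
    (hα : ∀ P : D → Prop, (∀ d, P (removeNone σ d) ↔ P d) → (∀ d, P (removeNone α d) ↔ P d) →
      ∀ d, extendPred σ P (α d) ↔ extendPred σ P d) :
    Conn (removeNone σ) (removeNone α) := fun P h1 h2 d e =>
  h (extendPred σ P) (extendPred_apply_iff h1) (hα P h1 h2) (some d) (some e)

theorem numOrbits_insertBefore [DecidableEq D] {i : D} {σ : Perm D} :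
    numOrbits (insertBefore i σ) = numOrbits σ := by
  rw [← numOrbits_removeNone insertBefore_none, removeNone_insertBefore]

end Insert

namespace Pre

variable {D E : Type} [DecidableEq D] [DecidableEq E]

/-- Attach a half-edge at the root corner and root the map there. -/
def addLeg (m : Pre D) : Pre (Option D) :=
  ⟨insertBefore m.root m.rot, optionCongr m.flip, none⟩

theorem face_addLeg (m : Pre D) : m.addLeg.face = insertBefore m.root m.face :=
  insertBefore_mul_optionCongr

theorem perim_addLeg [Finite D] (m : Pre D) : m.addLeg.perim = m.perim + 1 := by
  change (orbitOf m.addLeg.face none).size = _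
  rw [face_addLeg, size_none insertBefore_none, removeNone_insertBefore, perim]

theorem inner_addLeg [Finite D] (q : ℕ → ℝ) (m : Pre D) : m.addLeg.inner q = m.inner q := by
  change innerProd q m.addLeg.face none = _
  rw [face_addLeg, ← innerProd_removeNone q insertBefore_none, removeNone_insertBefore, inner]

theorem numVertices_addLeg (m : Pre D) : m.addLeg.numVertices = m.numVertices :=
  numOrbits_insertBefore

theorem even_insertBefore_iff [Finite D] {i : D} {f : Perm D} :
    (∀ d, ¬ (insertBefore i f).SameCycle d none → Even (orbitOf (insertBefore i f) d).size) ↔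
      ∀ d, ¬ f.SameCycle d i → Even (orbitOf f d).size := by
  have h0 := sameCycle_none (g := insertBefore i f) insertBefore_none
  have h1 : ∀ d, (insertBefore i f).SameCycle (some d) none ↔ f.SameCycle d i := by
    intro d
    have := sameCycle_removeNone_iff (g := insertBefore i f) (a := d) (b := i)
    rw [removeNone_insertBefore] at this
    rw [this]
    exact ⟨fun h => h.trans h0, fun h => h.trans h0.symm⟩
  have h2 : ∀ d, ¬ f.SameCycle d i →
      (orbitOf (insertBefore i f) (some d)).size = (orbitOf f d).size := by
    intro d hd
    rw [size_some_of_not, removeNone_insertBefore]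
    rwa [Perm.sameCycle_comm, h1]
  constructor
  · intro h d hd
    rw [← h2 d hd]
    exact h (some d) (by rwa [h1])
  · rintro h (_ | d) hd
    · exact (hd (Perm.SameCycle.refl _ _)).elim
    · rw [h1] at hd
      rw [h2 d hd]
      exact h d hd

theorem planar_addLeg_iff [Finite D] {m : Pre D} : m.addLeg.Planar ↔ m.Planar := by
  have h1 : (∀ d, m.addLeg.flip (m.addLeg.flip d) = d) ↔ ∀ d, m.flip (m.flip d) = d := by
    simp [addLeg, Option.forall]
  have h2 : Conn m.addLeg.rot m.addLeg.flip ↔ Conn m.rot m.flip := by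
    have hr : removeNone m.addLeg.rot = m.rot := removeNone_insertBefore
    have hf : removeNone m.addLeg.flip = m.flip := removeNone_optionCongr _
    constructor
    · intro h
      have := conn_removeNone h ?_
      · rwa [hr, hf] at this
      · rw [hr, hf]
        rintro P - hP (_ | d)
        · rfl
        · exact hP d
    · intro h
      rw [← hr, ← hf] at h
      exact conn_of_removeNone insertBefore_none h
  have h3 : numOrbits m.addLeg.rot = numOrbits m.rot := numOrbits_insertBefore
  have h4 : numOrbits m.addLeg.face = numOrbits m.face := by
    rw [face_addLeg, numOrbits_insertBefore]
  have h5 : numOrbits m.addLeg.flip = numOrbits m.flip + 1 := by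
    rw [numOrbits_removeNone' (by simp [addLeg])]
    simp [addLeg]
  have h6 : Nat.card (Option D) = Nat.card D + 1 := Finite.card_option
  have h7 : (∀ d, ¬ m.addLeg.face.SameCycle d m.addLeg.root → Even (orbitOf m.addLeg.face d).size) ↔
      ∀ d, ¬ m.face.SameCycle d m.root → Even (orbitOf m.face d).size := by
    rw [face_addLeg]
    exact even_insertBefore_iff
  constructor
  · rintro ⟨g1, g2, g3, g4⟩
    exact ⟨h1.1 g1, h2.1 g2, by omega, h7.1 g4⟩
  · rintro ⟨g1, g2, g3, g4⟩
    exact ⟨h1.2 g1, h2.2 g2, by omega, h7.2 g4⟩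

theorem leg_addLeg_iff [Finite D] {m : Pre D} : m.addLeg.Leg ↔ m.Rooted := by
  have h : (∀ d, m.addLeg.flip d = d ↔ d = m.addLeg.root) ↔ ∀ d, m.flip d ≠ d := by
    simp [addLeg, Option.forall]
  exact ⟨fun g => ⟨planar_addLeg_iff.1 g.toPlanar, h.1 g.flip_eq_iff⟩,
    fun g => ⟨planar_addLeg_iff.2 g.toPlanar, h.2 g.flip_ne⟩⟩

/-- An isomorphism preserves the root `none`, so it restricts to the old darts; the old root is
recovered as the `rot`-successor of `none`. -/
theorem addLeg_iso_iff {m : Pre D} {m' : Pre E} : m.addLeg.Iso m'.addLeg ↔ m.Iso m' := by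
  constructor
  · rintro ⟨e, h1, h2, h3⟩
    have h3 : e none = none := h3
    refine ⟨removeNone e, fun d => ?_, fun d => ?_, ?_⟩
    · simpa [addLeg] using removeNone_conj h3 h1 d
    · simpa [addLeg] using removeNone_conj h3 h2 d
    · have := h1 none
      simp only [addLeg, h3, insertBefore_none] at this
      rw [apply_some_of_none h3] at this
      exact Option.some_injective _ this
  · rintro ⟨e, h1, h2, h3⟩
    refine ⟨optionCongr e, insertBefore_conj e h1 h3, fun d => ?_, rfl⟩
    rcases d with _ | d <;> simp [addLeg, h2]

theorem eq_addLeg {m : Pre (Option D)} (hroot : m.root = none) {y : D} (hy : m.rot none = some y)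
    (hf : m.flip none = none) : m = addLeg ⟨removeNone m.rot, removeNone m.flip, y⟩ := by
  rcases m with ⟨σ, α, r⟩
  simp only at *
  subst hroot
  simp [addLeg, insertBefore_removeNone hy, hf]
  rfl

/-- The vertex map. -/
def vertex : Pre Unit := ⟨1, 1, ()⟩

theorem leg_vertex : vertex.Leg := by
  have hs : ∀ f : Perm Unit, numOrbits f = 1 := by
    intro f
    rw [numOrbits, Nat.card_eq_one_iff_unique]
    exact ⟨⟨by rintro ⟨a⟩ ⟨b⟩; rfl⟩, ⟨orbitOf f ()⟩⟩
  refine ⟨⟨fun _ => rfl, fun _ _ _ _ _ h => h, ?_, fun d hd => ?_⟩, fun d => ?_⟩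
  · rw [hs, hs, hs, Nat.card_unique]
  · exact (hd (Perm.SameCycle.refl _ _)).elim
  · simp

theorem numVertices_vertex : vertex.numVertices = 1 := by
  rw [numVertices, numOrbits, Nat.card_eq_one_iff_unique]
  exact ⟨⟨by rintro ⟨a⟩ ⟨b⟩; rfl⟩, ⟨orbitOf _ ()⟩⟩

theorem perim_vertex : vertex.perim = 1 := by
  rw [perim, ← minimalPeriod_eq_size, Function.minimalPeriod_eq_one_iff_isFixedPt]
  rfl

theorem inner_vertex (q : ℕ → ℝ) : vertex.inner q = 1 := by
  classical
  rw [inner, innerProd]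
  refine Finset.prod_eq_one fun o ho => ?_
  obtain ⟨d, rfl⟩ := exists_orbitOf o
  exact (Finset.ne_of_mem_erase ho rfl).elim

/-- Every map can be relabelled so that its root is `none`. -/
theorem exists_iso_option {D : Type} (m : Pre D) :
    ∃ m' : Pre (Option {d // d ≠ m.root}), m.Iso m' ∧ m'.root = none := by
  classical
  exact ⟨m.transport (optionSubtypeNe m.root).symm, m.iso_transport _, by simp [transport]⟩

/-- If the leg is alone at its vertex, connectivity leaves no other dart and the map is `vertex`.
Otherwise the leg can be erased, its `rot`-successor becoming the root. -/
theorem Leg.exists_addLeg {D : Type} [Finite D] {m : Pre D} (hm : m.Leg) :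
    m.Iso vertex ∨ ∃ (C : Type) (_ : Finite C) (_ : DecidableEq C) (m' : Pre C),
      m.Iso m'.addLeg ∧ m'.Rooted := by
  classical
  obtain ⟨m₁, h1, hr⟩ := m.exists_iso_option
  have hm₁ := h1.leg hm
  have hf : m₁.flip none = none := (hm₁.flip_eq_iff none).2 hr.symm
  rcases hy : m₁.rot none with _ | y
  · left
    have huniq : ∀ d : Option {d // d ≠ m.root}, d = none := by
      intro d
      refine hm₁.conn (fun d => d = none) (fun d => ?_) (fun d => ?_) none d rfl
      · conv_lhs => rw [← hy]
        exact m₁.rot.apply_eq_iff_eq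
      · conv_lhs => rw [← hf]
        exact m₁.flip.apply_eq_iff_eq
    let e : Option {d // d ≠ m.root} ≃ Unit :=
      ⟨fun _ => (), fun _ => none, fun d => (huniq d).symm, fun _ => rfl⟩
    exact h1.trans ⟨e, fun _ => rfl, fun _ => rfl, rfl⟩
  · right
    have := eq_addLeg hr hy hf
    rw [this] at h1
    exact ⟨_, inferInstance, inferInstance, _, h1, leg_addLeg_iff.1 (h1.leg hm)⟩

end Pre

/-! ### The face permutation after an edge is drawn across the root face. -/

section SplitInsert

variable {C : Type} [DecidableEq C] {ψ : Perm C} {s y : C}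

/-- Insert `none` before `y`, then exchange the images of `none` and `s`. -/
def splitInsert (ψ : Perm C) (s y : C) : Perm (Option C) :=
  insertBefore y ψ * swap none (some s)

theorem splitInsert_none :
    splitInsert ψ s y none = if ψ s = y then none else some (ψ s) := by
  rw [splitInsert, mul_swap_apply_left, insertBefore_some]

theorem splitInsert_some {c : C} (h : c ≠ s) :
    splitInsert ψ s y (some c) = if ψ c = y then none else some (ψ c) := by
  rw [splitInsert, mul_swap_apply_of_ne (by simp) (by simpa using h), insertBefore_some]

theorem splitInsert_mul_swap : splitInsert ψ s y * swap none (some s) = insertBefore y ψ := by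
  rw [splitInsert, mul_assoc, swap_mul_self, mul_one]

variable [Finite C]

/-- The cycle of `none` runs through `ψ s, ψ (ψ s), ...` and closes up when `ψ` reaches `y`. Its
length therefore determines `y` from `s`, which makes the removal of an edge reversible once the
perimeter is known. -/
theorem pow_minimalPeriod_splitInsert (h : ¬ (splitInsert ψ s y).SameCycle none (some s)) :
    (ψ ^ Function.minimalPeriod (splitInsert ψ s y) none) s = y := by
  set φ := splitInsert ψ s y with hφ
  set p := Function.minimalPeriod φ none with hp
  have hp0 : 0 < p := by rw [hp, minimalPeriod_eq_size]; exact size_pos _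
  have hper : (φ ^ p) none = none := by
    rw [← Perm.iterate_eq_pow]
    exact Function.isPeriodicPt_minimalPeriod φ none
  have hmin : ∀ i, 0 < i → i < p → (φ ^ i) none ≠ none := by
    intro i h0 hi h1
    rw [← Perm.iterate_eq_pow] at h1
    exact Function.not_isPeriodicPt_of_pos_of_lt_minimalPeriod h0.ne' hi h1
  have key : ∀ i, i + 1 < p → (φ ^ (i + 1)) none = some ((ψ ^ (i + 1)) s) := by
    intro i
    induction i with
    | zero =>
      intro hi
      have h1 := hmin 1 one_pos hi
      rw [pow_one, hφ, splitInsert_none] at h1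
      rw [zero_add, pow_one, pow_one, hφ, splitInsert_none, if_neg (by simpa using h1)]
    | succ i ih =>
      intro hi
      have h1 := hmin (i + 1 + 1) (by omega) hi
      have h2 := ih (by omega)
      have h3 : (ψ ^ (i + 1)) s ≠ s := by
        intro h3
        rw [h3] at h2
        exact h ⟨(i + 1 : ℕ), by rw [zpow_natCast, h2]⟩
      rw [pow_succ' φ, Perm.mul_apply, h2, hφ, splitInsert_some h3] at h1 ⊢
      rw [if_neg (by simpa using h1), pow_succ' ψ (i + 1), Perm.mul_apply]
  by_cases h1 : p = 1
  · rw [h1, pow_one, hφ, splitInsert_none] at hper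
    rw [h1, pow_one]
    simpa using hper
  · have h2 := key (p - 2) (by omega)
    rw [show p - 2 + 1 = p - 1 by omega] at h2
    have h3 : (ψ ^ (p - 1)) s ≠ s := by
      intro h3
      rw [h3] at h2
      exact h ⟨(p - 1 : ℕ), by rw [zpow_natCast, h2]⟩
    rw [show p = p - 1 + 1 by omega, pow_succ', Perm.mul_apply, h2, hφ,
      splitInsert_some h3] at hper
    rw [show p = p - 1 + 1 by omega, pow_succ', Perm.mul_apply]
    simpa using hper

/-- Conversely, if `y` comes `p` steps after `s`, less than a full turn, the cycle of `none` is
`none, ψ s, ..., ψ ^ (p - 1) s` and closes before it can return to `s`. -/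
theorem splitInsert_spec {p : ℕ} (h0 : 0 < p) (hp : p < Function.minimalPeriod ψ s)
    (hy : (ψ ^ p) s = y) : ¬ (splitInsert ψ s y).SameCycle none (some s) ∧
      Function.minimalPeriod (splitInsert ψ s y) none = p := by
  set φ := splitInsert ψ s y with hφ
  have hinj : ∀ i j, i < Function.minimalPeriod ψ s → j < Function.minimalPeriod ψ s →
      (ψ ^ i) s = (ψ ^ j) s → i = j := by
    intro i j hi hj h
    rw [← Perm.iterate_eq_pow, ← Perm.iterate_eq_pow] at h
    exact Function.iterate_injOn_Iio_minimalPeriod hi hj h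
  have key : ∀ i, i + 1 < p → (φ ^ (i + 1)) none = some ((ψ ^ (i + 1)) s) := by
    intro i
    induction i with
    | zero =>
      intro hi
      rw [zero_add, pow_one, pow_one, hφ, splitInsert_none, if_neg]
      rw [← hy]
      intro h
      have := hinj 1 p (by omega) hp (by rwa [pow_one])
      omega
    | succ i ih =>
      intro hi
      have h1 : (ψ ^ (i + 1)) s ≠ s := by
        intro h
        have := hinj (i + 1) 0 (by omega) (by omega) h
        omega
      have h2 : ψ ((ψ ^ (i + 1)) s) ≠ y := by
        rw [← Perm.mul_apply, ← pow_succ', ← hy]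
        intro h
        have := hinj _ _ (by omega) hp h
        omega
      rw [pow_succ' φ, Perm.mul_apply, ih (by omega), hφ, splitInsert_some h1, if_neg h2,
        pow_succ' ψ (i + 1), Perm.mul_apply]
  have hper : (φ ^ p) none = none := by
    by_cases h1 : p = 1
    · rw [h1, pow_one] at hy
      rw [h1, pow_one, hφ, splitInsert_none, if_pos hy]
    · have h2 := key (p - 2) (by omega)
      rw [show p - 2 + 1 = p - 1 by omega] at h2
      rw [show p = p - 1 + 1 by omega, pow_succ', Perm.mul_apply, h2, hφ, splitInsert_some, if_pos]
      · rw [← Perm.mul_apply, ← pow_succ', show p - 1 + 1 = p by omega, hy]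
      · intro h
        have := hinj (p - 1) 0 (by omega) (by omega) h
        omega
  have hper' : Function.IsPeriodicPt φ p none := by
    rwa [Function.IsPeriodicPt, Function.IsFixedPt, Perm.iterate_eq_pow]
  constructor
  · intro h
    obtain ⟨k, hk⟩ := h.exists_nat_pow_eq
    rw [← Perm.iterate_eq_pow, ← hper'.iterate_mod_apply, Perm.iterate_eq_pow] at hk
    have hlt := Nat.mod_lt k h0
    rcases Nat.eq_zero_or_pos (k % p) with h1 | h1
    · rw [h1] at hk
      simp at hk
    · obtain ⟨j, hj⟩ : ∃ j, k % p = j + 1 := ⟨k % p - 1, by omega⟩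
      rw [hj, key j (by omega)] at hk
      have := hinj (j + 1) 0 (by omega) (by omega) (Option.some_injective _ hk)
      omega
  · refine le_antisymm (hper'.minimalPeriod_le h0) (not_lt.1 fun h => ?_)
    have hp0 : 0 < Function.minimalPeriod φ none := hper'.minimalPeriod_pos h0
    obtain ⟨j, hj⟩ : ∃ j, Function.minimalPeriod φ none = j + 1 :=
      ⟨Function.minimalPeriod φ none - 1, by omega⟩
    have h1 := Function.isPeriodicPt_minimalPeriod φ none
    rw [Function.IsPeriodicPt, Function.IsFixedPt, Perm.iterate_eq_pow, hj, key j (by omega)] at h1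
    simp at h1

theorem size_splitInsert (h : ¬ (splitInsert ψ s y).SameCycle none (some s)) :
    (orbitOf (splitInsert ψ s y) none).size + (orbitOf (splitInsert ψ s y) (some s)).size =
      (orbitOf ψ y).size + 1 := by
  rw [← size_mul_swap h, splitInsert_mul_swap, size_none insertBefore_none,
    removeNone_insertBefore]

theorem even_splitInsert_iff (h : ¬ (splitInsert ψ s y).SameCycle none (some s)) :
    (∀ d, ¬ (splitInsert ψ s y).SameCycle d none → Even (orbitOf (splitInsert ψ s y) d).size) ↔
      Even (orbitOf (splitInsert ψ s y) (some s)).size ∧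
        ∀ d, ¬ ψ.SameCycle d y → Even (orbitOf ψ d).size := by
  rw [← Pre.even_insertBefore_iff (i := y) (f := ψ), ← splitInsert_mul_swap (s := s)]
  have h1 := fun d => sameCycle_mul_swap_iff h (a := d) (b := none)
  constructor
  · refine fun H => ⟨H _ fun h' => h h'.symm, fun d hd => ?_⟩
    rw [h1] at hd
    have h2 : ¬ (splitInsert ψ s y).SameCycle d none := fun h' => hd (Or.inl h')
    have h3 : ¬ (splitInsert ψ s y).SameCycle d (some s) :=
      fun h' => hd (Or.inr ⟨Or.inr h', Or.inl (Perm.SameCycle.refl _ _)⟩)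
    rw [size_mul_swap_of_not h h2 h3]
    exact H d h2
  · rintro ⟨H1, H2⟩ d hd
    by_cases h3 : (splitInsert ψ s y).SameCycle d (some s)
    · rwa [orbitOf_eq_iff.2 h3]
    · rw [← size_mul_swap_of_not h hd h3]
      refine H2 d fun h' => ?_
      rw [h1] at h'
      tauto

theorem innerProd_splitInsert (q : ℕ → ℝ)
    (h : ¬ (splitInsert ψ s y).SameCycle none (some s)) :
    innerProd q (splitInsert ψ s y) none =
      ENNReal.ofReal (q ((orbitOf (splitInsert ψ s y) (some s)).size / 2)) * innerProd q ψ y := by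
  rw [innerProd_mul_swap q h, splitInsert_mul_swap, ← innerProd_removeNone q insertBefore_none,
    removeNone_insertBefore]

theorem numOrbits_splitInsert (h : ¬ (splitInsert ψ s y).SameCycle none (some s)) :
    numOrbits (splitInsert ψ s y) = numOrbits ψ + 1 := by
  rw [numOrbits_mul_swap h, splitInsert_mul_swap, numOrbits_insertBefore]

end SplitInsert

/-! ### Adding an edge whose two sides lie on different faces. -/

namespace Pre

variable {C E : Type} [DecidableEq C] [DecidableEq E]

/-- Join the root half-edge to the corner before `y` by an edge, which becomes the root edge. -/
def addEdgeAt (m : Pre C) (y : C) : Pre (Option C) :=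
  ⟨insertBefore y m.rot, insertBefore m.root m.flip, none⟩

/-- The new edge cuts off a root face of degree `2 ℓ`. -/
def addEdge (ℓ : ℕ) (m : Pre C) : Pre (Option C) := m.addEdgeAt ((m.face ^ (2 * ℓ)) m.root)

theorem face_addEdgeAt {m : Pre C} {y : C} (h : m.flip m.root = m.root) :
    (m.addEdgeAt y).face = splitInsert m.face m.root y := by
  have : (m.addEdgeAt y).flip = optionCongr m.flip * swap none (some m.root) := by
    rw [← insertBefore_mul_swap h, mul_assoc, swap_mul_self, mul_one]
    rfl
  rw [face, this, splitInsert, ← mul_assoc]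
  congr 1
  exact insertBefore_mul_optionCongr

theorem flip_addEdgeAt_iff {m : Pre C} {y : C} (h : m.flip m.root = m.root) :
    (∀ d, (m.addEdgeAt y).flip ((m.addEdgeAt y).flip d) = d) ↔ ∀ d, m.flip (m.flip d) = d := by
  have h1 : (m.addEdgeAt y).flip (some m.root) = none := by
    change insertBefore _ _ _ = _
    rw [insertBefore_some, if_pos h]
  have h2 : ∀ d, d ≠ m.root → (m.addEdgeAt y).flip (some d) = some (m.flip d) := by
    intro d hd
    change insertBefore _ _ _ = _
    rw [insertBefore_some, if_neg]
    exact fun h' => hd (m.flip.injective (h'.trans h.symm))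
  have h3 : (m.addEdgeAt y).flip none = some m.root := insertBefore_none
  rw [Option.forall, h3, h1, eq_self_iff_true, true_and]
  refine forall_congr' fun d => ?_
  by_cases hd : d = m.root
  · subst hd
    rw [h1, h3, h, h]
    simp
  · rw [h2 d hd, h2, Option.some_inj]
    exact fun h' => hd (m.flip.injective (h'.trans h.symm))

theorem flip_addEdgeAt_ne {m : Pre C} {y : C} (h : ∀ d, m.flip d = d ↔ d = m.root) (d : Option C) :
    (m.addEdgeAt y).flip d ≠ d := by
  rcases d with _ | d
  · change insertBefore _ _ _ ≠ _
    simp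
  · change insertBefore _ _ _ ≠ _
    rw [insertBefore_some]
    split_ifs with h1
    · simp
    · intro h2
      have h3 := Option.some_injective _ h2
      exact h1 (h3.trans ((h d).1 h3))

theorem conn_addEdgeAt_iff {m : Pre C} {y : C} (hy : m.face.SameCycle m.root y) :
    Conn (m.addEdgeAt y).rot (m.addEdgeAt y).flip ↔ Conn m.rot m.flip := by
  have hr : removeNone (m.addEdgeAt y).rot = m.rot := removeNone_insertBefore
  have hf : removeNone (m.addEdgeAt y).flip = m.flip := removeNone_insertBefore
  constructor
  · intro h
    have := conn_removeNone h ?_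
    · rwa [hr, hf] at this
    rw [hr, hf]
    intro P h1 h2
    have h3 : P m.root ↔ P y :=
      iff_of_sameCycle (f := m.face) (fun d => by rw [face_apply, h1, h2]) hy
    have h4 : extendPred (m.addEdgeAt y).rot P none ↔ P y := by
      have : (m.addEdgeAt y).rot none = some y := insertBefore_none
      simp [extendPred, this]
    rintro (_ | d)
    · have : (m.addEdgeAt y).flip none = some m.root := insertBefore_none
      rw [this, h4, ← h3]
      rfl
    · change extendPred _ P (insertBefore m.root m.flip (some d)) ↔ P d
      rw [insertBefore_some]
      split_ifs with h5
      · rw [h4, ← h3, ← h5, h2]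
      · exact h2 d
  · intro h
    rw [← hr, ← hf] at h
    exact conn_of_removeNone insertBefore_none h

/-- One dart and one face are gained while the vertices and the orbits of `flip` keep their number
(the fixed root becomes a 2-cycle), so Euler's relation persists. The parity of the new non-root
face is the only extra condition. -/
theorem planar_addEdgeAt_iff [Finite C] {m : Pre C} {y : C} (h : m.flip m.root = m.root)
    (hy : m.face.SameCycle m.root y)
    (hs : ¬ (splitInsert m.face m.root y).SameCycle none (some m.root)) :
    (m.addEdgeAt y).Planar ↔
      m.Planar ∧ Even (orbitOf (splitInsert m.face m.root y) (some m.root)).size := by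
  have h1 := flip_addEdgeAt_iff (y := y) h
  have h2 := conn_addEdgeAt_iff hy
  have h3 : numOrbits (m.addEdgeAt y).rot = numOrbits m.rot := numOrbits_insertBefore
  have h4 : numOrbits (m.addEdgeAt y).face = numOrbits m.face + 1 := by
    rw [face_addEdgeAt h, numOrbits_splitInsert hs]
  have h5 : numOrbits (m.addEdgeAt y).flip = numOrbits m.flip := numOrbits_insertBefore
  have h6 : Nat.card (Option C) = Nat.card C + 1 := Finite.card_option
  have h7 : (∀ d, ¬ m.face.SameCycle d m.root → Even (orbitOf m.face d).size) ↔
      ∀ d, ¬ m.face.SameCycle d y → Even (orbitOf m.face d).size := by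
    refine forall_congr' fun d => ?_
    rw [show m.face.SameCycle d m.root ↔ m.face.SameCycle d y from
      ⟨fun h => h.trans hy, fun h => h.trans hy.symm⟩]
  have h8 := even_splitInsert_iff hs
  rw [← face_addEdgeAt h] at h8 ⊢
  constructor
  · rintro ⟨g1, g2, g3, g4⟩
    have := h8.1 g4
    exact ⟨⟨h1.1 g1, h2.1 g2, by omega, h7.2 this.2⟩, this.1⟩
  · rintro ⟨⟨g1, g2, g3, g4⟩, g5⟩
    exact ⟨h1.2 g1, h2.2 g2, by omega, h8.2 ⟨g5, h7.1 g4⟩⟩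

section

variable [Finite C] {m : Pre C} {ℓ : ℕ}

theorem addEdge_aux (hm : m.Leg) (h0 : 1 ≤ ℓ) (hℓ : 2 * ℓ < m.perim) :
    ¬ (m.addEdge ℓ).face.SameCycle none (some m.root) ∧ (m.addEdge ℓ).perim = 2 * ℓ ∧
      (orbitOf (m.addEdge ℓ).face (some m.root)).size = m.perim + 1 - 2 * ℓ := by
  have h := (hm.flip_eq_iff m.root).2 rfl
  rw [perim, ← minimalPeriod_eq_size] at hℓ
  have h1 := splitInsert_spec (by omega) hℓ rfl
  have h2 := size_splitInsert h1.1
  rw [← face_addEdgeAt h] at h1 h2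
  have h3 : (orbitOf m.face ((m.face ^ (2 * ℓ)) m.root)).size = m.perim := by
    rw [perim, orbitOf_eq_iff.2 (Perm.sameCycle_pow_left.2 (Perm.SameCycle.refl _ _))]
  have h4 : (m.addEdge ℓ).perim = 2 * ℓ := by
    rw [perim, ← minimalPeriod_eq_size]
    exact h1.2
  refine ⟨h1.1, h4, ?_⟩
  rw [h3] at h2
  change (m.addEdge ℓ).perim + (orbitOf (m.addEdge ℓ).face (some m.root)).size = _ at h2
  omega

theorem perim_addEdge (hm : m.Leg) (h0 : 1 ≤ ℓ) (hℓ : 2 * ℓ < m.perim) :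
    (m.addEdge ℓ).perim = 2 * ℓ := (addEdge_aux hm h0 hℓ).2.1

theorem simple_addEdge (hm : m.Leg) (h0 : 1 ≤ ℓ) (hℓ : 2 * ℓ < m.perim) :
    (m.addEdge ℓ).Simple := by
  have := (addEdge_aux hm h0 hℓ).1
  have h2 : (m.addEdge ℓ).flip none = some m.root := insertBefore_none
  rw [← h2] at this
  exact this

theorem rooted_addEdge (hm : m.Leg) (h0 : 1 ≤ ℓ) (hℓ : 2 * ℓ < m.perim) :
    (m.addEdge ℓ).Rooted := by
  have h := (hm.flip_eq_iff m.root).2 rfl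
  have h1 := addEdge_aux hm h0 hℓ
  refine ⟨(planar_addEdgeAt_iff h (Perm.sameCycle_pow_right.2 (Perm.SameCycle.refl _ _)) ?_).2
    ⟨hm.toPlanar, ?_⟩, flip_addEdgeAt_ne hm.flip_eq_iff⟩
  · rw [← face_addEdgeAt h]
    exact h1.1
  · rw [← face_addEdgeAt h]
    change Even (orbitOf (m.addEdge ℓ).face (some m.root)).size
    rw [h1.2.2]
    obtain ⟨k, hk⟩ := hm.odd_perim
    exact ⟨k + 1 - ℓ, by omega⟩

theorem inner_addEdge (q : ℕ → ℝ) (hm : m.Leg) (h0 : 1 ≤ ℓ) (hℓ : 2 * ℓ < m.perim) :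
    (m.addEdge ℓ).inner q =
    ENNReal.ofReal (q ((m.perim + 1 - 2 * ℓ) / 2)) * m.inner q := by
  have h := (hm.flip_eq_iff m.root).2 rfl
  have h1 := addEdge_aux hm h0 hℓ
  have h2 := h1.1
  rw [addEdge, face_addEdgeAt h] at h2
  rw [← h1.2.2, inner, addEdge, face_addEdgeAt h]
  refine (innerProd_splitInsert q h2).trans ?_
  congr 1
  exact innerProd_eq_of_sameCycle (Perm.sameCycle_pow_left.2 (Perm.SameCycle.refl _ _))

end

theorem numVertices_addEdge (m : Pre C) (ℓ : ℕ) : (m.addEdge ℓ).numVertices = m.numVertices :=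
  numOrbits_insertBefore

/-- The smaller map has root `flip none`, and the corner where the edge ends is a fixed power of the
face permutation applied to that root, hence is respected by every isomorphism. -/
theorem addEdge_iso_iff {m : Pre C} {m' : Pre E} {ℓ : ℕ} :
    (m.addEdge ℓ).Iso (m'.addEdge ℓ) ↔ m.Iso m' := by
  constructor
  · rintro ⟨e, h1, h2, h3⟩
    have h3 : e none = none := h3
    refine ⟨removeNone e, fun d => ?_, fun d => ?_, ?_⟩
    · simpa [addEdge, addEdgeAt] using removeNone_conj h3 h1 d
    · simpa [addEdge, addEdgeAt] using removeNone_conj h3 h2 d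
    · have := h2 none
      simp only [addEdge, addEdgeAt, h3, insertBefore_none] at this
      rw [apply_some_of_none h3] at this
      exact Option.some_injective _ this
  · rintro ⟨e, h1, h2, h3⟩
    refine ⟨optionCongr e, insertBefore_conj e h1 ?_, insertBefore_conj e h2 h3, rfl⟩
    have key : ∀ k : ℕ, e ((m.face ^ k) m.root) = (m'.face ^ k) m'.root := by
      intro k
      induction k with
      | zero => exact h3
      | succ k ih => rw [pow_succ', pow_succ', Perm.mul_apply, Perm.mul_apply,
          Iso.face_conj h1 h2, ih]
    exact key _

theorem Rooted.exists_addEdge {D : Type} [Finite D] {m : Pre D} {ℓ : ℕ} (hm : m.Rooted)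
    (hs : m.Simple) (hp : m.perim = 2 * ℓ) :
    ∃ (C : Type) (_ : Finite C) (_ : DecidableEq C) (m' : Pre C),
      m.Iso (m'.addEdge ℓ) ∧ m'.Leg ∧ 2 * ℓ < m'.perim := by
  classical
  obtain ⟨m₁, h1, hr⟩ := m.exists_iso_option
  have hm₁ := h1.rooted hm
  have hs₁ := h1.simple hs
  have hp₁ := h1.perim_eq.symm.trans hp
  clear hm hs hp
  obtain ⟨s, hsf⟩ : ∃ s, m₁.flip none = some s := by
    rcases h : m₁.flip none with _ | s
    · exact (hm₁.flip_ne none h).elim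
    · exact ⟨s, rfl⟩
  have hfs : m₁.flip (some s) = none := by rw [← hsf, hm₁.flip_flip]
  have hs₂ : ¬ m₁.face.SameCycle none (some s) := by
    rwa [Simple, hr, hsf] at hs₁
  -- If the root dart were alone at its origin, the face permutation would send its reverse to it,
  -- and both sides of the root edge would lie on one face.
  obtain ⟨y, hy⟩ : ∃ y, m₁.rot none = some y := by
    rcases h : m₁.rot none with _ | y
    · refine (hs₂ ?_).elim
      have h2 : m₁.face (some s) = none := by rw [face_apply, hfs, h]
      rw [← h2, Perm.sameCycle_apply_left]
    · exact ⟨y, rfl⟩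
  let m' : Pre {d // d ≠ m.root} := ⟨removeNone m₁.rot, removeNone m₁.flip, s⟩
  have hroot' : m'.flip m'.root = m'.root := by
    apply Option.some_injective
    rw [← hsf]
    exact removeNone_none _ hfs
  have he : m₁ = m'.addEdgeAt y := by
    rcases m₁ with ⟨σ, α, r⟩
    simp only at *
    subst hr
    simp [addEdgeAt, m', insertBefore_removeNone hy, insertBefore_removeNone hsf]
  have hf₁ : m₁.face = splitInsert m'.face m'.root y := by rw [he, face_addEdgeAt hroot']
  have hs₃ := hs₂
  rw [hf₁] at hs₃
  have hp₂ : Function.minimalPeriod (splitInsert m'.face m'.root y) none = 2 * ℓ := by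
    rw [← hp₁, perim, ← minimalPeriod_eq_size, hf₁, hr]
  have hy₂ := pow_minimalPeriod_splitInsert hs₃
  rw [hp₂] at hy₂
  have hcyc : m'.face.SameCycle m'.root y := by
    rw [← hy₂, Perm.sameCycle_pow_right]
  have hpl := hm₁.toPlanar
  rw [he] at hpl
  have hpl' := (planar_addEdgeAt_iff hroot' hcyc hs₃).1 hpl
  have hsz := size_splitInsert hs₃
  rw [← minimalPeriod_eq_size, hp₂, ← orbitOf_eq_iff.2 hcyc] at hsz
  change _ = m'.perim + 1 at hsz
  have hsz2 := size_pos (orbitOf (splitInsert m'.face m'.root y) (some m'.root))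
  refine ⟨_, inferInstance, inferInstance, m', ?_, ⟨hpl'.1, fun d => ⟨fun h => ?_, ?_⟩⟩, ?_⟩
  · rw [addEdge, hy₂, ← he]
    exact h1
  · by_contra hd
    refine hm₁.flip_ne (some d) ?_
    rcases h2 : m₁.flip (some d) with _ | x
    · rw [← hfs] at h2
      exact (hd (Option.some_injective _ (m₁.flip.injective h2))).elim
    · rw [← h2, ← removeNone_some m₁.flip ⟨x, h2⟩]
      exact congrArg some h
  · rintro rfl
    exact hroot'
  · obtain ⟨k, hk⟩ := hpl'.2
    omega

end Pre

/-! ### Joining two maps by a bridge. -/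

theorem exists_sumCongr {A B A' B' : Type} (e : A ⊕ B ≃ A' ⊕ B')
    (h1 : ∀ a, (e (Sum.inl a)).isLeft = true) (h2 : ∀ b, (e (Sum.inr b)).isRight = true) :
    ∃ (e₁ : A ≃ A') (e₂ : B ≃ B'),
      (∀ a, e (Sum.inl a) = Sum.inl (e₁ a)) ∧ ∀ b, e (Sum.inr b) = Sum.inr (e₂ b) := by
  choose f₁ hf₁ using fun a => Sum.isLeft_iff.1 (h1 a)
  choose f₂ hf₂ using fun b => Sum.isRight_iff.1 (h2 b)
  have b1 : Function.Bijective f₁ := by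
    constructor
    · intro a a' h
      refine Sum.inl_injective (e.injective ?_)
      rw [hf₁, hf₁, h]
    · intro a'
      obtain ⟨a | b, hx⟩ := e.surjective (Sum.inl a')
      · exact ⟨a, Sum.inl_injective ((hf₁ a).symm.trans hx)⟩
      · rw [hf₂] at hx
        simp at hx
  have b2 : Function.Bijective f₂ := by
    constructor
    · intro a a' h
      refine Sum.inr_injective (e.injective ?_)
      rw [hf₂, hf₂, h]
    · intro b'
      obtain ⟨a | b, hx⟩ := e.surjective (Sum.inr b')
      · rw [hf₁] at hx
        simp at hx
      · exact ⟨b, Sum.inr_injective ((hf₂ b).symm.trans hx)⟩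
  exact ⟨Equiv.ofBijective f₁ b1, Equiv.ofBijective f₂ b2, hf₁, hf₂⟩

/-- Each side of a cut edge stays connected. An invariant predicate `P` on the side `Q` of `x` is
extended to all of `D` by `R`, which holds vacuously off `Q` and holds at both `x` and `y`; so `R`
is invariant under the original `α` as well. -/
theorem conn_subtypePerm {D : Type} [DecidableEq D] {σ α : Perm D} (h : Conn σ α) {x y : D}
    {Q : D → Prop} (h1 : ∀ d, Q (σ d) ↔ Q d) (h2 : ∀ d, Q ((α * swap x y) d) ↔ Q d)
    (hx : Q x) (hy : ¬ Q y) :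
    Conn (σ.subtypePerm h1) ((α * swap x y).subtypePerm h2) := by
  intro P hP1 hP2
  let R : D → Prop := fun d => ∀ h : Q d, (P ⟨d, h⟩ ↔ P ⟨x, hx⟩)
  have hβ : ∀ d, R ((α * swap x y) d) ↔ R d := by
    intro d
    constructor
    · intro hR hd
      rw [← hR ((h2 d).2 hd)]
      exact (hP2 ⟨d, hd⟩).symm
    · intro hR hd
      rw [← hR ((h2 d).1 hd)]
      exact hP2 ⟨d, (h2 d).1 hd⟩
  have hRx : R x := fun _ => Iff.rfl
  have hRy : R y := fun h => (hy h).elim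
  have key := h R (fun d => ?_) (fun d => ?_) x
  · rintro ⟨d, hd⟩ ⟨e, he⟩ hPd
    rw [key e hRx he, ← key d hRx hd]
    exact hPd
  · constructor
    · intro hR hd
      rw [← hR ((h1 d).2 hd)]
      exact (hP1 ⟨d, hd⟩).symm
    · intro hR hd
      rw [← hR ((h1 d).1 hd)]
      exact hP1 ⟨d, (h1 d).1 hd⟩
  · by_cases hdx : d = x
    · rw [hdx, ← mul_swap_apply_right (f := α) (x := x) (y := y), hβ]
      exact iff_of_true hRy hRx
    by_cases hdy : d = y
    · rw [hdy, ← mul_swap_apply_left (f := α) (x := x) (y := y), hβ]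
      exact iff_of_true hRx hRy
    rw [← hβ d, mul_swap_apply_of_ne hdx hdy]

namespace Pre

variable {A B A' B' : Type} [DecidableEq A] [DecidableEq B] [DecidableEq A'] [DecidableEq B']

/-- Join the root half-edges of two maps to an edge, which becomes the root edge. -/
def join (m₁ : Pre A) (m₂ : Pre B) : Pre (A ⊕ B) :=
  ⟨Perm.sumCongr m₁.rot m₂.rot,
    Perm.sumCongr m₁.flip m₂.flip * swap (Sum.inl m₁.root) (Sum.inr m₂.root), Sum.inl m₁.root⟩

variable {m₁ : Pre A} {m₂ : Pre B}

theorem face_join : (join m₁ m₂).face =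
    Perm.sumCongr m₁.face m₂.face * swap (Sum.inl m₁.root) (Sum.inr m₂.root) := by
  change Perm.sumCongr m₁.rot m₂.rot * (Perm.sumCongr m₁.flip m₂.flip * swap _ _) = _
  rw [← mul_assoc, Perm.sumCongr_mul]
  rfl

theorem flip_join_inl {a : A} (ha : a ≠ m₁.root) :
    (join m₁ m₂).flip (Sum.inl a) = Sum.inl (m₁.flip a) :=
  mul_swap_apply_of_ne (by simpa using ha) (by simp)

theorem flip_join_inr {b : B} (hb : b ≠ m₂.root) :
    (join m₁ m₂).flip (Sum.inr b) = Sum.inr (m₂.flip b) :=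
  mul_swap_apply_of_ne (by simp) (by simpa using hb)

theorem flip_join_inl_root (h : m₂.flip m₂.root = m₂.root) :
    (join m₁ m₂).flip (Sum.inl m₁.root) = Sum.inr m₂.root := by
  refine mul_swap_apply_left.trans ?_
  rw [sumCongr_inr, h]

theorem flip_join_inr_root (h : m₁.flip m₁.root = m₁.root) :
    (join m₁ m₂).flip (Sum.inr m₂.root) = Sum.inl m₁.root := by
  refine mul_swap_apply_right.trans ?_
  rw [sumCongr_inl, h]

theorem sumCongr_flip (m₁ : Pre A) (m₂ : Pre B) (d : A ⊕ B) : Perm.sumCongr m₁.flip m₂.flip d =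
    (join m₁ m₂).flip (swap (Sum.inl m₁.root) (Sum.inr m₂.root) d) := by
  simp [join]

theorem join_iso_iff {m₁' : Pre A'} {m₂' : Pre B'} (h₁ : m₁.Leg) (h₂ : m₂.Leg) (h₂' : m₂'.Leg) :
    (join m₁ m₂).Iso (join m₁' m₂') ↔ m₁.Iso m₁' ∧ m₂.Iso m₂' := by
  constructor
  · rintro ⟨e, hr, hf, hroot⟩
    have e1 : e (Sum.inl m₁.root) = Sum.inl m₁'.root := hroot
    have e2 : e (Sum.inr m₂.root) = Sum.inr m₂'.root := by
      rw [← flip_join_inl_root (m₁ := m₁) ((h₂.flip_eq_iff _).2 rfl), hf, e1,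
        flip_join_inl_root ((h₂'.flip_eq_iff _).2 rfl)]
    -- Undoing the exchange at the two roots, `e` intertwines the direct sums of the flips; by
    -- connectivity of each summand it then respects the two sides.
    have hf' : ∀ d, e (Perm.sumCongr m₁.flip m₂.flip d) =
        Perm.sumCongr m₁'.flip m₂'.flip (e d) := by
      intro d
      rw [sumCongr_flip, sumCongr_flip, hf]
      congr 1
      rw [← e1, ← e2]
      by_cases hd1 : d = Sum.inl m₁.root
      · simp [hd1]
      by_cases hd2 : d = Sum.inr m₂.root
      · simp [hd2]
      rw [swap_apply_of_ne_of_ne hd1 hd2, swap_apply_of_ne_of_ne]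
      · exact fun h => hd1 (e.injective h)
      · exact fun h => hd2 (e.injective h)
    have hl : ∀ (f : Perm A') (g : Perm B') d,
        (Perm.sumCongr f g d).isLeft = true ↔ d.isLeft = true := by
      rintro f g (d | d) <;> simp
    have hr' : ∀ (f : Perm A') (g : Perm B') d,
        (Perm.sumCongr f g d).isRight = true ↔ d.isRight = true := by
      rintro f g (d | d) <;> simp
    have hL : ∀ a, (e (Sum.inl a)).isLeft = true := by
      intro a
      refine h₁.conn (fun a => (e (Sum.inl a)).isLeft = true) (fun a => ?_) (fun a => ?_)
        m₁.root a ?_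
      · rw [← sumCongr_inl (g := m₂.rot)]
        exact (hr (Sum.inl a)) ▸ hl _ _ _
      · rw [← sumCongr_inl (g := m₂.flip), hf', hl]
      · simp [e1]
    have hR : ∀ a, (e (Sum.inr a)).isRight = true := by
      intro a
      refine h₂.conn (fun a => (e (Sum.inr a)).isRight = true) (fun a => ?_) (fun a => ?_)
        m₂.root a ?_
      · rw [← sumCongr_inr (f := m₁.rot)]
        exact (hr (Sum.inr a)) ▸ hr' _ _ _
      · rw [← sumCongr_inr (f := m₁.flip), hf', hr']
      · simp [e2]
    obtain ⟨e₁, e₂, g1, g2⟩ := exists_sumCongr e hL hR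
    refine ⟨⟨e₁, fun d => ?_, fun d => ?_, ?_⟩, ⟨e₂, fun d => ?_, fun d => ?_, ?_⟩⟩
    · have := hr (Sum.inl d)
      simpa [join, g1] using this
    · have := hf' (Sum.inl d)
      simpa [g1] using this
    · simpa [g1] using e1
    · have := hr (Sum.inr d)
      simpa [join, g2] using this
    · have := hf' (Sum.inr d)
      simpa [g2] using this
    · simpa [g2] using e2
  · rintro ⟨⟨e₁, g1, g2, g3⟩, ⟨e₂, k1, k2, k3⟩⟩
    refine ⟨Equiv.sumCongr e₁ e₂, ?_, ?_, ?_⟩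
    · rintro (d | d)
      · simp [join, g1]
      · simp [join, k1]
    · rintro (d | d)
      · by_cases hd : d = m₁.root
        · simp [join, hd, k2, k3, g3]
        · rw [flip_join_inl hd, sumCongr_apply, Sum.map_inl, sumCongr_apply, Sum.map_inl,
            flip_join_inl, g2]
          rw [← g3]
          exact fun h => hd (e₁.injective h)
      · by_cases hd : d = m₂.root
        · simp [join, hd, g2, k3, g3]
        · rw [flip_join_inr hd, sumCongr_apply, Sum.map_inr, sumCongr_apply, Sum.map_inr,
            flip_join_inr, k2]
          rw [← k3]
          exact fun h => hd (e₂.injective h)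
    · simp [join, g3]

theorem conn_join (h₁ : m₁.flip m₁.root = m₁.root) (h₂ : m₂.flip m₂.root = m₂.root)
    (c₁ : Conn m₁.rot m₁.flip) (c₂ : Conn m₂.rot m₂.flip) :
    Conn (join m₁ m₂).rot (join m₁ m₂).flip := by
  intro P hP1 hP2
  have k1 := c₁ (fun a => P (Sum.inl a)) (fun a => hP1 (Sum.inl a)) (fun a => by
    by_cases ha : a = m₁.root
    · rw [ha, h₁]
    · rw [← flip_join_inl (m₂ := m₂) ha, hP2])
  have k2 := c₂ (fun a => P (Sum.inr a)) (fun a => hP1 (Sum.inr a)) (fun a => by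
    by_cases ha : a = m₂.root
    · rw [ha, h₂]
    · rw [← flip_join_inr (m₁ := m₁) ha, hP2])
  have k3 : P (Sum.inr m₂.root) ↔ P (Sum.inl m₁.root) := by
    rw [← flip_join_inl_root (m₁ := m₁) h₂, hP2]
  have k4 : ∀ d, P d ↔ P (Sum.inl m₁.root) := by
    rintro (d | d)
    · exact ⟨k1 d _, k1 _ d⟩
    · rw [← k3]
      exact ⟨k2 d _, k2 _ d⟩
  intro d e hd
  rwa [k4, ← k4 d]

variable [Finite A] [Finite B]

theorem perim_join : (join m₁ m₂).perim = m₁.perim + m₂.perim := by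
  rw [perim, face_join]
  refine (size_mul_swap not_sameCycle_inl_inr).trans ?_
  rw [size_inl, size_inr]
  rfl

theorem inner_join (q : ℕ → ℝ) : (join m₁ m₂).inner q = m₁.inner q * m₂.inner q := by
  rw [inner, face_join]
  exact innerProd_sumCongr q _ _

theorem numVertices_join : (join m₁ m₂).numVertices = m₁.numVertices + m₂.numVertices :=
  numOrbits_sumCongr

theorem not_simple_join (h : m₂.flip m₂.root = m₂.root) : ¬ (join m₁ m₂).Simple := by
  rw [Simple, not_not]
  change (join m₁ m₂).face.SameCycle (Sum.inl m₁.root) ((join m₁ m₂).flip (Sum.inl m₁.root))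
  rw [flip_join_inl_root h, face_join]
  exact sameCycle_mul_swap_self not_sameCycle_inl_inr

theorem numOrbits_flip_join :
    numOrbits m₁.flip + numOrbits m₂.flip = numOrbits (join m₁ m₂).flip + 1 := by
  rw [← numOrbits_sumCongr]
  exact numOrbits_mul_swap not_sameCycle_inl_inr

theorem numOrbits_face_join :
    numOrbits m₁.face + numOrbits m₂.face = numOrbits (join m₁ m₂).face + 1 := by
  rw [← numOrbits_sumCongr, face_join]
  exact numOrbits_mul_swap not_sameCycle_inl_inr

theorem sameCycle_face_join_inl {a : A} :
    (join m₁ m₂).face.SameCycle (Sum.inl a) (Sum.inl m₁.root) ↔ m₁.face.SameCycle a m₁.root := by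
  rw [face_join, sameCycle_mul_swap_iff not_sameCycle_inl_inr]
  simp only [sameCycle_inl_inl, not_sameCycle_inl_inr, Perm.SameCycle.refl]
  tauto

theorem sameCycle_face_join_inr {b : B} :
    (join m₁ m₂).face.SameCycle (Sum.inr b) (Sum.inl m₁.root) ↔ m₂.face.SameCycle b m₂.root := by
  rw [face_join, sameCycle_mul_swap_iff not_sameCycle_inl_inr]
  have : ∀ a b, ¬ (Perm.sumCongr m₁.face m₂.face).SameCycle (Sum.inr b) (Sum.inl a) :=
    fun a b h => not_sameCycle_inl_inr h.symm
  simp only [sameCycle_inr_inr, this, Perm.SameCycle.refl]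
  tauto

theorem even_join_iff : (∀ d, ¬ (join m₁ m₂).face.SameCycle d (join m₁ m₂).root →
      Even (orbitOf (join m₁ m₂).face d).size) ↔
    (∀ d, ¬ m₁.face.SameCycle d m₁.root → Even (orbitOf m₁.face d).size) ∧
      ∀ d, ¬ m₂.face.SameCycle d m₂.root → Even (orbitOf m₂.face d).size := by
  have h : ¬ (Perm.sumCongr m₁.face m₂.face).SameCycle (Sum.inl m₁.root) (Sum.inr m₂.root) :=
    not_sameCycle_inl_inr
  have s1 : ∀ d, ¬ m₁.face.SameCycle d m₁.root →
      (orbitOf (join m₁ m₂).face (Sum.inl d)).size = (orbitOf m₁.face d).size := by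
    intro d hd
    rw [face_join, size_mul_swap_of_not h (by rwa [sameCycle_inl_inl]) not_sameCycle_inl_inr,
      size_inl]
  have s2 : ∀ d, ¬ m₂.face.SameCycle d m₂.root →
      (orbitOf (join m₁ m₂).face (Sum.inr d)).size = (orbitOf m₂.face d).size := by
    intro d hd
    rw [face_join, size_mul_swap_of_not h (fun h => not_sameCycle_inl_inr h.symm)
      (by rwa [sameCycle_inr_inr]), size_inr]
  constructor
  · refine fun H => ⟨fun d hd => ?_, fun d hd => ?_⟩
    · rw [← s1 d hd]
      exact H _ (sameCycle_face_join_inl.not.2 hd)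
    · rw [← s2 d hd]
      exact H _ (sameCycle_face_join_inr.not.2 hd)
  · rintro ⟨H1, H2⟩ (d | d) hd
    · have hd := sameCycle_face_join_inl.not.1 hd
      rw [s1 d hd]
      exact H1 d hd
    · have hd := sameCycle_face_join_inr.not.1 hd
      rw [s2 d hd]
      exact H2 d hd

theorem rooted_join (h₁ : m₁.Leg) (h₂ : m₂.Leg) : (join m₁ m₂).Rooted := by
  have r₁ := (h₁.flip_eq_iff _).2 rfl
  have r₂ := (h₂.flip_eq_iff _).2 rfl
  refine ⟨⟨?_, conn_join r₁ r₂ h₁.conn h₂.conn, ?_, even_join_iff.2 ⟨h₁.even, h₂.even⟩⟩, ?_⟩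
  · rintro (d | d)
    · by_cases hd : d = m₁.root
      · rw [hd, flip_join_inl_root r₂, flip_join_inr_root r₁]
      · rw [flip_join_inl hd, flip_join_inl, h₁.flip_flip]
        exact fun h => hd (m₁.flip.injective (h.trans r₁.symm))
    · by_cases hd : d = m₂.root
      · rw [hd, flip_join_inr_root r₁, flip_join_inl_root r₂]
      · rw [flip_join_inr hd, flip_join_inr, h₂.flip_flip]
        exact fun h => hd (m₂.flip.injective (h.trans r₂.symm))
  · have e1 := h₁.euler
    have e2 := h₂.euler
    have e3 := numOrbits_flip_join (m₁ := m₁) (m₂ := m₂)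
    have e4 := numOrbits_face_join (m₁ := m₁) (m₂ := m₂)
    have e5 : numOrbits (join m₁ m₂).rot = numOrbits m₁.rot + numOrbits m₂.rot :=
      numOrbits_sumCongr
    have e6 : Nat.card (A ⊕ B) = Nat.card A + Nat.card B := Nat.card_sum
    omega
  · rintro (d | d)
    · by_cases hd : d = m₁.root
      · rw [hd, flip_join_inl_root r₂]
        simp
      · rw [flip_join_inl hd]
        exact fun h => hd ((h₁.flip_eq_iff d).1 (Sum.inl_injective h))
    · by_cases hd : d = m₂.root
      · rw [hd, flip_join_inr_root r₁]
        simp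
      · rw [flip_join_inr hd]
        exact fun h => hd ((h₂.flip_eq_iff d).1 (Sum.inr_injective h))

/-- The genus is additive under `join` and non-negative on each part, so genus zero of the whole
forces it on both. -/
theorem leg_of_join (h : (join m₁ m₂).Planar) (c₁ : Conn m₁.rot m₁.flip)
    (c₂ : Conn m₂.rot m₂.flip) (i₁ : ∀ d, m₁.flip (m₁.flip d) = d)
    (i₂ : ∀ d, m₂.flip (m₂.flip d) = d) (f₁ : ∀ d, m₁.flip d = d ↔ d = m₁.root)
    (f₂ : ∀ d, m₂.flip d = d ↔ d = m₂.root) : m₁.Leg ∧ m₂.Leg := by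
  have g1 := numOrbits_add_le c₁
  have g2 := numOrbits_add_le c₂
  change numOrbits m₁.rot + numOrbits m₁.flip + numOrbits m₁.face ≤ _ at g1
  change numOrbits m₂.rot + numOrbits m₂.flip + numOrbits m₂.face ≤ _ at g2
  have e1 := h.euler
  have e3 := numOrbits_flip_join (m₁ := m₁) (m₂ := m₂)
  have e4 := numOrbits_face_join (m₁ := m₁) (m₂ := m₂)
  have e5 : numOrbits (join m₁ m₂).rot = numOrbits m₁.rot + numOrbits m₂.rot :=
    numOrbits_sumCongr
  have e6 : Nat.card (A ⊕ B) = Nat.card A + Nat.card B := Nat.card_sum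
  have h3 := even_join_iff.1 h.even
  exact ⟨⟨⟨i₁, c₁, by omega, h3.1⟩, f₁⟩, ⟨⟨i₂, c₂, by omega, h3.2⟩, f₂⟩⟩

theorem Rooted.exists_join {D : Type} [Finite D] {m : Pre D} (hm : m.Rooted) (hs : ¬ m.Simple) :
    ∃ (A : Type) (_ : Finite A) (_ : DecidableEq A) (m₁ : Pre A)
      (B : Type) (_ : Finite B) (_ : DecidableEq B) (m₂ : Pre B),
      m.Iso (join m₁ m₂) ∧ m₁.Leg ∧ m₂.Leg := by
  classical
  rw [Simple, not_not] at hs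
  set x := m.root with hx
  set y := m.flip m.root with hy
  have hxy : x ≠ y := (hm.flip_ne x).symm
  have hfx : m.flip x = y := rfl
  have hfy : m.flip y = x := hm.flip_flip x
  set β := m.flip * swap x y with hβ
  have hβx : β x = x := by rw [hβ, mul_swap_apply_left, hfy]
  have hβy : β y = y := by rw [hβ, mul_swap_apply_right, hfx]
  have hβd : ∀ d, d ≠ x → d ≠ y → β d = m.flip d := fun d h1 h2 => mul_swap_apply_of_ne h1 h2
  have hflip : m.flip = β * swap x y := by rw [hβ, mul_assoc, swap_mul_self, mul_one]
  -- Cutting the root edge into two half-edges adds an orbit of `flip` and splits the face on both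
  -- its sides. Were the result connected, two more orbits would contradict `numOrbits_add_le`;
  -- hence the edge is a bridge.
  have hnc : ¬ Conn m.rot β := by
    intro hc
    have h1 := numOrbits_add_le hc
    have h2 : numOrbits β = numOrbits m.flip + 1 := by
      rw [hflip]
      refine numOrbits_mul_swap fun h => hxy (h.eq_of_left hβx)
    have h3 : numOrbits (m.rot * β) = numOrbits m.face + 1 := by
      have : m.face = m.rot * β * swap x y := by rw [mul_assoc, ← hflip]; rfl
      rw [this]
      refine numOrbits_mul_swap ?_
      rw [hβ, ← mul_assoc]
      exact not_sameCycle_mul_swap hxy hs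
    have := hm.euler
    omega
  obtain ⟨Q, hQ1, hQ2, hQx, hQ⟩ : ∃ Q : D → Prop, (∀ d, Q (m.rot d) ↔ Q d) ∧
      (∀ d, Q (β d) ↔ Q d) ∧ Q x ∧ ¬ ∀ d, Q d := by
    simp only [Conn, not_forall] at hnc
    obtain ⟨P, h1, h2, d, e, hd, he⟩ := hnc
    refine ⟨fun d => P d ↔ P x, fun d => by simp only [h1], fun d => by simp only [h2], Iff.rfl, fun H => ?_⟩
    exact he ((H e).2 ((H d).1 hd))
  have hQy : ¬ Q y := by
    refine fun hQy => hQ fun d => hm.conn Q hQ1 (fun d => ?_) x d hQx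
    by_cases h1 : d = x
    · rw [h1, hfx]
      exact iff_of_true hQy hQx
    by_cases h2 : d = y
    · rw [h2, hfy]
      exact iff_of_true hQx hQy
    rw [← hβd d h1 h2, hQ2]
  have hβ' : β = m.flip * swap y x := by rw [hβ, swap_comm]
  have hN1 : ∀ d, ¬ Q (m.rot d) ↔ ¬ Q d := fun d => not_congr (hQ1 d)
  have hN2 : ∀ d, ¬ Q (β d) ↔ ¬ Q d := fun d => not_congr (hQ2 d)
  let m₁ : Pre {d // Q d} := ⟨m.rot.subtypePerm hQ1, β.subtypePerm hQ2, ⟨x, hQx⟩⟩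
  let m₂ : Pre {d // ¬ Q d} := ⟨m.rot.subtypePerm hN1, β.subtypePerm hN2, ⟨y, hQy⟩⟩
  have hiso : (join m₁ m₂).Iso m := by
    refine ⟨Equiv.sumCompl Q, ?_, ?_, rfl⟩
    · rintro (d | d) <;> rfl
    · rintro (⟨d, hd⟩ | ⟨d, hd⟩)
      · by_cases h1 : d = x
        · subst h1
          rw [show (⟨x, hd⟩ : {d // Q d}) = m₁.root from rfl, flip_join_inl_root]
          · rfl
          · exact Subtype.ext hβy
        · rw [flip_join_inl (fun h => h1 (congrArg Subtype.val h))]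
          refine hβd d h1 ?_
          rintro rfl
          exact hQy hd
      · by_cases h1 : d = y
        · subst h1
          rw [show (⟨y, hd⟩ : {d // ¬ Q d}) = m₂.root from rfl, flip_join_inr_root]
          · exact hfy.symm
          · exact Subtype.ext hβx
        · rw [flip_join_inr (fun h => h1 (congrArg Subtype.val h))]
          refine hβd d ?_ h1
          rintro rfl
          exact hd hQx
  have hinv : ∀ d, β (β d) = d := by
    intro d
    by_cases h1 : d = x
    · rw [h1, hβx, hβx]
    by_cases h2 : d = y
    · rw [h2, hβy, hβy]
    rw [hβd d h1 h2, hβd, hm.flip_flip]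
    · exact fun h => h2 (m.flip.injective (h.trans hfy.symm))
    · exact fun h => h1 (m.flip.injective (h.trans hfx.symm))
  have hfix : ∀ d, β d = d → d = x ∨ d = y := by
    intro d hd
    by_contra! h
    rw [hβd d h.1 h.2] at hd
    exact hm.flip_ne d hd
  have hlegs := leg_of_join (hiso.symm.planar hm.toPlanar)
    (conn_subtypePerm hm.conn hQ1 hQ2 hQx hQy)
    (by
      have := conn_subtypePerm hm.conn (x := y) (y := x) (Q := fun d => ¬ Q d) hN1 (by rwa [← hβ']) hQy
        (not_not.2 hQx)
      simp only [← hβ'] at this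
      exact this)
    (fun d => Subtype.ext (hinv d)) (fun d => Subtype.ext (hinv d)) ?_ ?_
  · exact ⟨_, inferInstance, inferInstance, m₁, _, inferInstance, inferInstance, m₂, hiso.symm,
      hlegs⟩
  · rintro ⟨d, hd⟩
    constructor
    · intro h
      rcases hfix d (congrArg Subtype.val h) with rfl | rfl
      · rfl
      · exact (hQy hd).elim
    · intro h
      rw [h]
      exact Subtype.ext hβx
  · rintro ⟨d, hd⟩
    constructor
    · intro h
      rcases hfix d (congrArg Subtype.val h) with rfl | rfl
      · exact (hd hQx).elim
      · rfl
    · intro h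
      rw [h]
      exact Subtype.ext hβy

end Pre

/-! ### Tutte's decomposition as an identity between sums over isomorphism classes. -/

theorem tsum_ite_eq_tsum_subtype {γ : Type*} (R : γ → Prop) [DecidablePred R] (F : γ → ℝ≥0∞) :
    ∑' c, (if R c then F c else 0) = ∑' c : {c // R c}, F c := by
  refine Eq.trans (tsum_congr fun c => ?_) (tsum_subtype {c | R c} F).symm
  simp [Set.indicator]

theorem tsum_ite_eq_of_bij {α β : Type*} {P : α → Prop} {Q : β → Prop} [DecidablePred P]
    [DecidablePred Q] (f : α → β)
    (hf : ∀ a, P a → Q (f a)) (hinj : ∀ a a', P a → P a' → f a = f a' → a = a')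
    (hsurj : ∀ b, Q b → ∃ a, P a ∧ f a = b) (G : β → ℝ≥0∞) :
    ∑' b, (if Q b then G b else 0) = ∑' a, if P a then G (f a) else 0 := by
  rw [tsum_ite_eq_tsum_subtype, tsum_ite_eq_tsum_subtype]
  let e : {a // P a} ≃ {b // Q b} := Equiv.ofBijective (fun a => ⟨f a.1, hf a.1 a.2⟩)
    ⟨fun a a' h => Subtype.ext (hinj _ _ a.2 a'.2 (congrArg Subtype.val h)), fun b => by
      obtain ⟨a, h1, h2⟩ := hsurj b.1 b.2
      exact ⟨⟨a, h1⟩, Subtype.ext h2⟩⟩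
  exact (e.tsum_eq (fun b : {b // Q b} => G b)).symm

namespace PreClass

def addLeg (c : PreClass) : PreClass := c.rep.addLeg.cls
def addEdge (ℓ : ℕ) (c : PreClass) : PreClass := (c.rep.addEdge ℓ).cls
def join (c₁ c₂ : PreClass) : PreClass := (Pre.join c₁.rep c₂.rep).cls

theorem eq_of_rep_iso {c c' : PreClass} (h : c.rep.Iso c'.rep) : c = c' := by
  rw [← c.cls_rep, ← c'.cls_rep]
  exact Pre.cls_eq_iff.2 h

theorem eq_cls {D : Type} [Finite D] {c : PreClass} {m : Pre D} (h : c.rep.Iso m) : c = m.cls := by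
  rw [← c.cls_rep]
  exact Pre.cls_eq_iff.2 h

theorem addLeg_cls {D : Type} [Finite D] [DecidableEq D] (m : Pre D) :
    m.cls.addLeg = m.addLeg.cls :=
  Pre.cls_eq_iff.2 (Pre.addLeg_iso_iff.2 (rep_cls_iso m))

theorem addEdge_cls {D : Type} [Finite D] [DecidableEq D] (ℓ : ℕ) (m : Pre D) :
    m.cls.addEdge ℓ = (m.addEdge ℓ).cls :=
  Pre.cls_eq_iff.2 (Pre.addEdge_iso_iff.2 (rep_cls_iso m))

theorem join_cls {A B : Type} [Finite A] [DecidableEq A] [Finite B] [DecidableEq B]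
    {m₁ : Pre A} {m₂ : Pre B} (h₁ : m₁.Leg) (h₂ : m₂.Leg) :
    join m₁.cls m₂.cls = (Pre.join m₁ m₂).cls :=
  Pre.cls_eq_iff.2 ((Pre.join_iso_iff ((rep_cls_iso m₁).symm.leg h₁)
    ((rep_cls_iso m₂).symm.leg h₂) h₂).2 ⟨rep_cls_iso m₁, rep_cls_iso m₂⟩)

/-- The class of the vertex map. -/
def vertex : PreClass := Pre.vertex.cls

theorem card_pos (c : PreClass) : 0 < c.card := by
  have := c.rep.root.pos
  exact this

theorem card_addLeg (c : PreClass) : c.addLeg.card = c.card + 1 := by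
  rw [addLeg, card_cls, Finite.card_option, Nat.card_fin, card]

theorem card_addEdge (ℓ : ℕ) (c : PreClass) : (c.addEdge ℓ).card = c.card + 1 := by
  rw [addEdge, card_cls, Finite.card_option, Nat.card_fin, card]

theorem card_join (c₁ c₂ : PreClass) : (join c₁ c₂).card = c₁.card + c₂.card := by
  rw [join, card_cls, Nat.card_sum, Nat.card_fin, Nat.card_fin, card, card]

theorem inner_addLeg (q : ℕ → ℝ) (c : PreClass) : c.addLeg.inner q = c.inner q := by
  rw [addLeg, inner_cls, Pre.inner_addLeg, inner]

theorem numVertices_addLeg (c : PreClass) : c.addLeg.numVertices = c.numVertices := by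
  rw [addLeg, numVertices_cls, Pre.numVertices_addLeg, numVertices]

theorem inner_addEdge (q : ℕ → ℝ) {c : PreClass} {ℓ : ℕ} (hc : c.Leg) (h0 : 1 ≤ ℓ)
    (hℓ : 2 * ℓ < c.perim) : (c.addEdge ℓ).inner q =
      ENNReal.ofReal (q ((c.perim + 1 - 2 * ℓ) / 2)) * c.inner q := by
  rw [addEdge, inner_cls, Pre.inner_addEdge q hc h0 hℓ, inner, perim]

theorem numVertices_addEdge (c : PreClass) (ℓ : ℕ) :
    (c.addEdge ℓ).numVertices = c.numVertices := by
  rw [addEdge, numVertices_cls, Pre.numVertices_addEdge, numVertices]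

theorem inner_join (q : ℕ → ℝ) (c₁ c₂ : PreClass) :
    (join c₁ c₂).inner q = c₁.inner q * c₂.inner q := by
  rw [join, inner_cls, Pre.inner_join, inner, inner]

theorem numVertices_join (c₁ c₂ : PreClass) :
    (join c₁ c₂).numVertices = c₁.numVertices + c₂.numVertices := by
  rw [join, numVertices_cls, Pre.numVertices_join, numVertices, numVertices]

/-- Maps with one half-edge and perimeter `2 ℓ + 1`. -/
def LegPerim (ℓ : ℕ) (c : PreClass) : Prop := c.Leg ∧ c.perim = 2 * ℓ + 1

/-- Rooted maps with perimeter `2 ℓ`. -/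
def RootedPerim (ℓ : ℕ) (c : PreClass) : Prop := c.Rooted ∧ c.perim = 2 * ℓ

theorem legPerim_zero_iff {c : PreClass} : LegPerim 0 c ↔ c = vertex := by
  constructor
  · rintro ⟨h1, h2⟩
    rcases Pre.Leg.exists_addLeg h1 with h | ⟨C, _, _, m', h, h'⟩
    · exact eq_cls h
    · have h3 := h.perim_eq
      rw [Pre.perim_addLeg] at h3
      have h4 := h'.even_perim
      have h5 := m'.perim_pos
      change c.rep.perim = _ at h2
      omega
  · rintro rfl
    exact ⟨leg_cls.2 Pre.leg_vertex, (perim_cls _).trans Pre.perim_vertex⟩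

section Sums

open Classical

/-- Sum over the maps with one half-edge and perimeter `2 ℓ + 1`. -/
def legSum (G : PreClass → ℝ≥0∞) (ℓ : ℕ) : ℝ≥0∞ :=
  ∑' c : PreClass, if LegPerim ℓ c then G c else 0

theorem legSum_congr {G G' : PreClass → ℝ≥0∞} {ℓ : ℕ} (h : ∀ c, LegPerim ℓ c → G c = G' c) :
    legSum G ℓ = legSum G' ℓ :=
  tsum_congr fun c => by
    split_ifs with hc
    · exact h c hc
    · rfl

theorem legSum_mono {G G' : PreClass → ℝ≥0∞} {ℓ : ℕ} (h : ∀ c, LegPerim ℓ c → G c ≤ G' c) :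
    legSum G ℓ ≤ legSum G' ℓ :=
  ENNReal.tsum_le_tsum fun c => by
    split_ifs with hc
    · exact h c hc
    · rfl

theorem legSum_mul_left (a : ℝ≥0∞) (G : PreClass → ℝ≥0∞) (ℓ : ℕ) :
    legSum (fun c => a * G c) ℓ = a * legSum G ℓ := by
  rw [legSum, legSum, ← ENNReal.tsum_mul_left]
  exact tsum_congr fun c => by rw [mul_ite, mul_zero]

theorem legSum_add (G G' : PreClass → ℝ≥0∞) (ℓ : ℕ) :
    legSum (fun c => G c + G' c) ℓ = legSum G ℓ + legSum G' ℓ := by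
  rw [legSum, legSum, legSum, ← ENNReal.tsum_add]
  exact tsum_congr fun c => by split_ifs <;> simp

theorem legSum_zero (G : PreClass → ℝ≥0∞) : legSum G 0 = G vertex := by
  rw [legSum, tsum_eq_single vertex]
  · rw [if_pos (legPerim_zero_iff.2 rfl)]
  · intro c hc
    rw [if_neg fun h => hc (legPerim_zero_iff.1 h)]

/-- Legs put the vertex map (`ℓ = 0`) and the rooted maps (`ℓ ≥ 1`) into one family, so the
decomposition needs no special case. -/
theorem legSum_eq_rooted (G : PreClass → ℝ≥0∞) {ℓ : ℕ} (hℓ : 1 ≤ ℓ) :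
    legSum G ℓ = ∑' c : PreClass, if RootedPerim ℓ c then G c.addLeg else 0 := by
  refine tsum_ite_eq_of_bij addLeg ?_ ?_ ?_ G
  · rintro c ⟨h1, h2⟩
    refine ⟨leg_cls.2 (Pre.leg_addLeg_iff.2 h1), ?_⟩
    rw [addLeg, perim_cls, Pre.perim_addLeg]
    exact congrArg (· + 1) h2
  · intro c c' _ _ h
    exact eq_of_rep_iso (Pre.addLeg_iso_iff.1 (Pre.cls_eq_iff.1 h))
  · rintro c ⟨h1, h2⟩
    rcases Pre.Leg.exists_addLeg h1 with h | ⟨C, _, _, m', h, h'⟩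
    · have := h.perim_eq
      rw [Pre.perim_vertex] at this
      change c.rep.perim = _ at h2
      omega
    · refine ⟨m'.cls, ⟨rooted_cls.2 h', ?_⟩, ?_⟩
      · have := h.perim_eq
        rw [Pre.perim_addLeg] at this
        change c.rep.perim = _ at h2
        rw [perim_cls]
        omega
      · rw [addLeg_cls]
        exact (eq_cls h).symm

/-- The index `k` records the degree `2 (k + 1)` of the face on the other side of the root edge;
once merged with the root face it leaves perimeter `2 (ℓ + k) + 1`, leg included. -/
theorem tsum_simple (F : PreClass → ℝ≥0∞) {ℓ : ℕ} (hℓ : 1 ≤ ℓ) :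
    ∑' c : PreClass, (if RootedPerim ℓ c ∧ c.Simple then F c else 0) =
      ∑' k : ℕ, legSum (fun c => F (c.addEdge ℓ)) (ℓ + k) := by
  have h1 : ∑' c : PreClass, (if RootedPerim ℓ c ∧ c.Simple then F c else 0) =
      ∑' c : PreClass, if c.Leg ∧ 2 * ℓ < c.perim then F (c.addEdge ℓ) else 0 := by
    refine tsum_ite_eq_of_bij (addEdge ℓ) ?_ ?_ ?_ F
    · rintro c ⟨h1, h2⟩
      refine ⟨⟨rooted_cls.2 (Pre.rooted_addEdge h1 hℓ h2), ?_⟩,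
        simple_cls.2 (Pre.simple_addEdge h1 hℓ h2)⟩
      rw [addEdge, perim_cls]
      exact Pre.perim_addEdge h1 hℓ h2
    · intro c c' _ _ h
      exact eq_of_rep_iso (Pre.addEdge_iso_iff.1 (Pre.cls_eq_iff.1 h))
    · rintro c ⟨⟨h1, h2⟩, h3⟩
      obtain ⟨C, _, _, m', g1, g2, g3⟩ := Pre.Rooted.exists_addEdge h1 h3 h2
      refine ⟨m'.cls, ⟨leg_cls.2 g2, ?_⟩, ?_⟩
      · rwa [perim_cls]
      · rw [addEdge_cls]
        exact (eq_cls g1).symm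
  rw [h1]
  simp only [legSum]
  rw [ENNReal.tsum_comm]
  refine tsum_congr fun c => ?_
  split_ifs with hc
  · obtain ⟨j, hj⟩ := hc.1.odd_perim
    change c.perim = _ at hj
    rw [tsum_eq_single (j - ℓ)]
    · rw [if_pos ⟨hc.1, by omega⟩]
    · intro k hk
      rw [if_neg]
      rintro ⟨-, h2⟩
      omega
  · symm
    rw [ENNReal.tsum_eq_zero]
    intro k
    rw [if_neg]
    rintro ⟨h1, h2⟩
    exact hc ⟨h1, by omega⟩

/-- Perimeters add under `join`: `(2i + 1) + (2j + 1) = 2 (n + 1)` means `i + j = n`. -/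
theorem tsum_not_simple (F : PreClass → ℝ≥0∞) (n : ℕ) :
    ∑' c : PreClass, (if RootedPerim (n + 1) c ∧ ¬ c.Simple then F c else 0) =
      ∑ p ∈ Finset.HasAntidiagonal.antidiagonal n,
        legSum (fun c₁ => legSum (fun c₂ => F (join c₁ c₂)) p.2) p.1 := by
  have h1 : ∑' c : PreClass, (if RootedPerim (n + 1) c ∧ ¬ c.Simple then F c else 0) =
      ∑' p : PreClass × PreClass,
        if (p.1.Leg ∧ p.2.Leg) ∧ p.1.perim + p.2.perim = 2 * (n + 1) then F (join p.1 p.2)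
        else 0 := by
    refine tsum_ite_eq_of_bij (fun p : PreClass × PreClass => join p.1 p.2) ?_ ?_ ?_ F
    · rintro ⟨c₁, c₂⟩ ⟨⟨h1, h2⟩, h3⟩
      refine ⟨⟨rooted_cls.2 (Pre.rooted_join h1 h2), ?_⟩,
        simple_cls.not.2 (Pre.not_simple_join ((h2.flip_eq_iff _).2 rfl))⟩
      change (join c₁ c₂).perim = _
      rw [join, perim_cls, Pre.perim_join]
      exact h3
    · rintro ⟨c₁, c₂⟩ ⟨c₁', c₂'⟩ ⟨⟨h1, h2⟩, -⟩ ⟨⟨h1', h2'⟩, -⟩ h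
      have := (Pre.join_iso_iff h1 h2 h2').1 (Pre.cls_eq_iff.1 h)
      exact Prod.ext (eq_of_rep_iso this.1) (eq_of_rep_iso this.2)
    · rintro c ⟨⟨h1, h2⟩, h3⟩
      obtain ⟨A, _, _, m₁, B, _, _, m₂, g1, g2, g3⟩ := Pre.Rooted.exists_join h1 h3
      refine ⟨(m₁.cls, m₂.cls), ⟨⟨leg_cls.2 g2, leg_cls.2 g3⟩, ?_⟩, ?_⟩
      · rw [perim_cls, perim_cls, ← Pre.perim_join, ← g1.perim_eq]
        exact h2
      · change join m₁.cls m₂.cls = c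
        rw [join_cls g2 g3]
        exact (eq_cls g1).symm
  have h2 : ∀ p : ℕ × ℕ, legSum (fun c₁ => legSum (fun c₂ => F (join c₁ c₂)) p.2) p.1 =
      ∑' c : PreClass × PreClass,
        if LegPerim p.1 c.1 ∧ LegPerim p.2 c.2 then F (join c.1 c.2) else 0 := by
    intro p
    rw [ENNReal.tsum_prod']
    refine tsum_congr fun c₁ => ?_
    split_ifs with hc
    · exact tsum_congr fun c₂ => by simp [hc]
    · symm
      rw [ENNReal.tsum_eq_zero]
      intro c₂
      rw [if_neg fun h => hc h.1]
  rw [h1, Finset.sum_congr rfl fun p _ => h2 p, ← Summable.tsum_finsetSum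
    fun _ _ => ENNReal.summable]
  refine tsum_congr fun c => ?_
  split_ifs with hc
  · obtain ⟨i, hi⟩ := hc.1.1.odd_perim
    obtain ⟨j, hj⟩ := hc.1.2.odd_perim
    change c.1.perim = _ at hi
    change c.2.perim = _ at hj
    rw [Finset.sum_eq_single (i, j)]
    · rw [if_pos ⟨⟨hc.1.1, hi⟩, ⟨hc.1.2, hj⟩⟩]
    · rintro ⟨i', j'⟩ _ hij
      rw [if_neg]
      rintro ⟨⟨-, h1⟩, ⟨-, h2⟩⟩
      refine hij (Prod.ext ?_ ?_) <;> dsimp only at * <;> omega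
    · intro h
      refine (h ?_).elim
      rw [Finset.HasAntidiagonal.mem_antidiagonal]
      omega
  · symm
    refine Finset.sum_eq_zero fun p hp => ?_
    rw [if_neg]
    rintro ⟨⟨h1, h2⟩, ⟨h3, h4⟩⟩
    rw [Finset.HasAntidiagonal.mem_antidiagonal] at hp
    exact hc ⟨⟨h1, h3⟩, by omega⟩

/-- Tutte's decomposition: removal of the root edge. -/
theorem legSum_succ (G : PreClass → ℝ≥0∞) (n : ℕ) :
    legSum G (n + 1) =
      ∑' k : ℕ, legSum (fun c => G (c.addEdge (n + 1)).addLeg) (n + 1 + k) +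
        ∑ p ∈ Finset.HasAntidiagonal.antidiagonal n,
          legSum (fun c₁ => legSum (fun c₂ => G (join c₁ c₂).addLeg) p.2) p.1 := by
  rw [legSum_eq_rooted G (Nat.le_add_left 1 n), ← tsum_simple (fun c => G c.addLeg)
    (Nat.le_add_left 1 n), ← tsum_not_simple (fun c => G c.addLeg), ← ENNReal.tsum_add]
  refine tsum_congr fun c => ?_
  by_cases h1 : RootedPerim (n + 1) c <;> by_cases h2 : c.Simple <;> simp [h1, h2]

/-- The sum is a supremum over finite sets of classes, and a finite set of classes has bounded
numbers of darts. -/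
theorem legSum_le_of_card_le {G : PreClass → ℝ≥0∞} {ℓ : ℕ} {v : ℝ≥0∞}
    (h : ∀ N, legSum (fun c => if c.card ≤ N then G c else 0) ℓ ≤ v) : legSum G ℓ ≤ v := by
  rw [legSum, ENNReal.tsum_eq_iSup_sum]
  refine iSup_le fun s => le_trans ?_ (h (s.sup card))
  refine le_trans (Finset.sum_le_sum fun c hc => ?_) (ENNReal.sum_le_tsum s)
  have hle : c.card ≤ s.sup card := Finset.le_sup hc
  simp only [hle, if_true, le_refl]

end Sums

end PreClass

/-! ### The loop equations for plain and pointed maps, and comparison with supersolutions. -/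

namespace PreClass

/-- The number of vertices as an extended real number. -/
def vert (c : PreClass) : ℝ≥0∞ := (c.numVertices : ℝ≥0∞)

/-- The weight of pointed maps. -/
def pointedInner (q : ℕ → ℝ) (c : PreClass) : ℝ≥0∞ := c.vert * c.inner q

open Classical in
/-- Restriction of a weight to maps with a bounded number of half-edges. -/
def cut (N : ℕ) (G : PreClass → ℝ≥0∞) (c : PreClass) : ℝ≥0∞ := if c.card ≤ N then G c else 0

theorem cut_zero (G : PreClass → ℝ≥0∞) (ℓ : ℕ) : legSum (cut 0 G) ℓ = 0 := by
  rw [legSum, ENNReal.tsum_eq_zero]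
  intro c
  have : ¬ c.card ≤ 0 := by have := c.card_pos; omega
  simp [cut, this]

theorem cut_le (N : ℕ) (G : PreClass → ℝ≥0∞) (c : PreClass) : cut N G c ≤ G c := by
  unfold cut
  split_ifs <;> simp

theorem inner_vertex (q : ℕ → ℝ) : vertex.inner q = 1 := by
  rw [vertex, inner_cls, Pre.inner_vertex]

theorem vert_vertex : vertex.vert = 1 := by
  rw [vert, vertex, numVertices_cls, Pre.numVertices_vertex, Nat.cast_one]

theorem vert_addLeg (c : PreClass) : c.addLeg.vert = c.vert := by
  rw [vert, numVertices_addLeg, vert]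

theorem vert_addEdge (c : PreClass) (ℓ : ℕ) : (c.addEdge ℓ).vert = c.vert := by
  rw [vert, numVertices_addEdge, vert]

theorem vert_join (c₁ c₂ : PreClass) : (join c₁ c₂).vert = c₁.vert + c₂.vert := by
  rw [vert, numVertices_join, Nat.cast_add, vert, vert]

/-- The new non-root face has degree `(2 (n + 1 + k) + 1) + 1 - 2 (n + 1) = 2 (k + 1)`. -/
theorem inner_addEdge_of_legPerim (q : ℕ → ℝ) {n k : ℕ} {c : PreClass}
    (hc : LegPerim (n + 1 + k) c) :
    (c.addEdge (n + 1)).inner q = ENNReal.ofReal (q (k + 1)) * c.inner q := by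
  have h := hc.2
  rw [inner_addEdge q hc.1 (by omega) (by omega)]
  congr 4
  omega

theorem legSum_inner_zero (q : ℕ → ℝ) : legSum (inner q) 0 = 1 := by
  rw [legSum_zero, inner_vertex]

theorem legSum_pointedInner_zero (q : ℕ → ℝ) : legSum (pointedInner q) 0 = 1 := by
  rw [legSum_zero, pointedInner, inner_vertex, vert_vertex, mul_one]

theorem legSum_inner_succ (q : ℕ → ℝ) (n : ℕ) : legSum (inner q) (n + 1) =
    ∑' k : ℕ, ENNReal.ofReal (q (k + 1)) * legSum (inner q) (n + 1 + k) +
      ∑ p ∈ Finset.HasAntidiagonal.antidiagonal n,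
        legSum (inner q) p.1 * legSum (inner q) p.2 := by
  rw [legSum_succ]
  congr 1
  · refine tsum_congr fun k => ?_
    rw [← legSum_mul_left]
    refine legSum_congr fun c hc => ?_
    rw [inner_addLeg, inner_addEdge_of_legPerim q hc]
  · refine Finset.sum_congr rfl fun p _ => ?_
    rw [mul_comm, ← legSum_mul_left]
    refine legSum_congr fun c₁ _ => ?_
    rw [mul_comm, ← legSum_mul_left]
    refine legSum_congr fun c₂ _ => ?_
    rw [inner_addLeg, inner_join]

/-- Pointing acts as a derivation: vertex numbers add under `join`, and the symmetry of the
antidiagonal turns the two resulting sums into the factor `2`. -/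
theorem legSum_pointedInner_succ (q : ℕ → ℝ) (n : ℕ) : legSum (pointedInner q) (n + 1) =
    ∑' k : ℕ, ENNReal.ofReal (q (k + 1)) * legSum (pointedInner q) (n + 1 + k) +
      2 * ∑ p ∈ Finset.HasAntidiagonal.antidiagonal n,
        legSum (inner q) p.1 * legSum (pointedInner q) p.2 := by
  rw [legSum_succ]
  congr 1
  · refine tsum_congr fun k => ?_
    rw [← legSum_mul_left]
    refine legSum_congr fun c hc => ?_
    rw [pointedInner, vert_addLeg, vert_addEdge, inner_addLeg, inner_addEdge_of_legPerim q hc,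
      pointedInner]
    ring
  · have h : ∀ p : ℕ × ℕ, legSum (fun c₁ => legSum (fun c₂ => pointedInner q (join c₁ c₂).addLeg)
        p.2) p.1 = legSum (inner q) p.2 * legSum (pointedInner q) p.1 +
          legSum (inner q) p.1 * legSum (pointedInner q) p.2 := by
      intro p
      rw [← legSum_mul_left, mul_comm (legSum (inner q) p.1), ← legSum_mul_left, ← legSum_add]
      refine legSum_congr fun c₁ _ => ?_
      rw [mul_comm (legSum (inner q) p.2), mul_comm (legSum (pointedInner q) p.2),
        ← legSum_mul_left, ← legSum_mul_left, ← legSum_add]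
      refine legSum_congr fun c₂ _ => ?_
      rw [pointedInner, vert_addLeg, inner_addLeg, vert_join, inner_join, pointedInner,
        pointedInner]
      ring
    rw [Finset.sum_congr rfl fun p _ => h p, Finset.sum_add_distrib, two_mul]
    congr 1
    exact Finset.Nat.sum_antidiagonal_swap
      (f := fun p : ℕ × ℕ => legSum (inner q) p.1 * legSum (pointedInner q) p.2)

/-- Every piece of the decomposition has strictly fewer darts than the whole, so the truncation
level drops by one and induction on `N` becomes possible. -/
theorem legSum_cut_inner_succ_le (q : ℕ → ℝ) (N n : ℕ) :
    legSum (cut (N + 1) (inner q)) (n + 1) ≤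
      ∑' k : ℕ, ENNReal.ofReal (q (k + 1)) * legSum (cut N (inner q)) (n + 1 + k) +
      ∑ p ∈ Finset.HasAntidiagonal.antidiagonal n,
        legSum (cut N (inner q)) p.1 * legSum (cut N (inner q)) p.2 := by
  rw [legSum_succ]
  refine add_le_add (ENNReal.tsum_le_tsum fun k => ?_) (Finset.sum_le_sum fun p _ => ?_)
  · rw [← legSum_mul_left]
    refine legSum_mono fun c hc => ?_
    have hcard : (c.addEdge (n + 1)).addLeg.card = c.card + 1 + 1 := by
      rw [card_addLeg, card_addEdge]
    unfold cut
    split_ifs with h1 h2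
    · rw [inner_addLeg, inner_addEdge_of_legPerim q hc]
    · omega
    · simp
    · simp
  · rw [mul_comm, ← legSum_mul_left]
    refine legSum_mono fun c₁ _ => ?_
    rw [mul_comm, ← legSum_mul_left]
    refine legSum_mono fun c₂ _ => ?_
    have hcard : (join c₁ c₂).addLeg.card = c₁.card + c₂.card + 1 := by
      rw [card_addLeg, card_join]
    rw [cut]
    split_ifs with h1
    · rw [inner_addLeg, inner_join, cut, cut, if_pos (by omega), if_pos (by omega)]
    · simp

theorem legSum_cut_pointedInner_succ_le (q : ℕ → ℝ) (N n : ℕ) :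
    legSum (cut (N + 1) (pointedInner q)) (n + 1) ≤
      ∑' k : ℕ, ENNReal.ofReal (q (k + 1)) * legSum (cut N (pointedInner q)) (n + 1 + k) +
      2 * ∑ p ∈ Finset.HasAntidiagonal.antidiagonal n,
        legSum (inner q) p.1 * legSum (cut N (pointedInner q)) p.2 := by
  rw [legSum_succ]
  refine add_le_add (ENNReal.tsum_le_tsum fun k => ?_) ?_
  · rw [← legSum_mul_left]
    refine legSum_mono fun c hc => ?_
    have hcard : (c.addEdge (n + 1)).addLeg.card = c.card + 1 + 1 := by
      rw [card_addLeg, card_addEdge]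
    unfold cut
    split_ifs with h1 h2
    · rw [pointedInner, vert_addLeg, vert_addEdge, inner_addLeg, inner_addEdge_of_legPerim q hc,
        pointedInner]
      exact (by ring : _ = _).le
    · omega
    · simp
    · simp
  · have h : ∀ p : ℕ × ℕ, legSum (fun c₁ => legSum
        (fun c₂ => cut (N + 1) (pointedInner q) (join c₁ c₂).addLeg)
        p.2) p.1 ≤ legSum (inner q) p.2 * legSum (cut N (pointedInner q)) p.1 +
          legSum (inner q) p.1 * legSum (cut N (pointedInner q)) p.2 := by
      intro p
      rw [← legSum_mul_left, mul_comm (legSum (inner q) p.1), ← legSum_mul_left, ← legSum_add]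
      refine legSum_mono fun c₁ _ => ?_
      rw [mul_comm (legSum (inner q) p.2), mul_comm (legSum (cut N (pointedInner q)) p.2),
        ← legSum_mul_left, ← legSum_mul_left, ← legSum_add]
      refine legSum_mono fun c₂ _ => ?_
      have hcard : (join c₁ c₂).addLeg.card = c₁.card + c₂.card + 1 := by
        rw [card_addLeg, card_join]
      rw [cut]
      split_ifs with h1
      · rw [pointedInner, vert_addLeg, inner_addLeg, vert_join, inner_join, cut, cut,
          if_pos (by omega), if_pos (by omega), pointedInner, pointedInner]
        exact (by ring : _ = _).le
      · simp
    refine (Finset.sum_le_sum fun p _ => h p).trans ?_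
    rw [Finset.sum_add_distrib, two_mul]
    refine add_le_add_left (le_of_eq ?_) _
    exact Finset.Nat.sum_antidiagonal_swap
      (f := fun p : ℕ × ℕ => legSum (inner q) p.1 * legSum (cut N (pointedInner q)) p.2)

theorem legSum_le_of_cut_le {G : PreClass → ℝ≥0∞} {ℓ : ℕ} {v : ℝ≥0∞}
    (h : ∀ N, legSum (cut N G) ℓ ≤ v) : legSum G ℓ ≤ v := legSum_le_of_card_le h

/-- Solutions of Tutte's equation dominate the partition functions. -/
theorem legSum_inner_le (q : ℕ → ℝ) (V : ℕ → ℝ≥0∞) (h0 : 1 ≤ V 0)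
    (h : ∀ n, ∑' k : ℕ, ENNReal.ofReal (q (k + 1)) * V (n + 1 + k) +
      ∑ p ∈ Finset.HasAntidiagonal.antidiagonal n, V p.1 * V p.2 ≤ V (n + 1)) (ℓ : ℕ) :
    legSum (inner q) ℓ ≤ V ℓ := by
  refine legSum_le_of_cut_le fun N => ?_
  -- All perimeters are treated at once, since the equation at `n + 1` involves arbitrarily large
  -- ones; what decreases is the bound on the number of darts.
  induction N generalizing ℓ with
  | zero => rw [cut_zero]; exact zero_le
  | succ N ih =>
    rcases ℓ with _ | n
    · refine (legSum_mono fun c _ => cut_le _ _ c).trans ?_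
      rwa [legSum_inner_zero]
    · refine (legSum_cut_inner_succ_le q N n).trans (le_trans ?_ (h n))
      gcongr <;> exact ih _

theorem legSum_pointedInner_le (q : ℕ → ℝ) (P : ℕ → ℝ≥0∞) (h0 : 1 ≤ P 0)
    (h : ∀ n, ∑' k : ℕ, ENNReal.ofReal (q (k + 1)) * P (n + 1 + k) +
      2 * ∑ p ∈ Finset.HasAntidiagonal.antidiagonal n, legSum (inner q) p.1 * P p.2 ≤ P (n + 1))
    (ℓ : ℕ) : legSum (pointedInner q) ℓ ≤ P ℓ := by
  refine legSum_le_of_cut_le fun N => ?_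
  induction N generalizing ℓ with
  | zero => rw [cut_zero]; exact zero_le
  | succ N ih =>
    rcases ℓ with _ | n
    · refine (legSum_mono fun c _ => cut_le _ _ c).trans ?_
      rwa [legSum_pointedInner_zero]
    · refine (legSum_cut_pointedInner_succ_le q N n).trans (le_trans ?_ (h n))
      gcongr <;> exact ih _

end PreClass

open PreClass

/-! ### The sums over planar maps in terms of the loop equations. -/

section PlanarMap

open Classical

theorem tsum_planarMap (F : PreClass → ℝ≥0∞) :
    ∑' m : PlanarMap, F m.toClass = ∑' c : PreClass, if c.Rooted then F c else 0 := by
  rw [tsum_ite_eq_tsum_subtype]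
  exact planarMapEquiv.tsum_eq (fun c : {c : PreClass // c.Rooted} => F c)

theorem partitionFunction_eq (q : ℕ → ℝ) (ℓ : ℕ) :
    partitionFunction q ℓ = legSum (inner q) ℓ := by
  rw [partitionFunction]
  split_ifs with h
  · rw [h, legSum_inner_zero]
  · rw [legSum_eq_rooted _ (by omega), ← tsum_ite_eq_tsum_subtype
      (fun m : PlanarMap => m.perimeter = 2 * ℓ) (fun m => m.innerWeight q)]
    have := tsum_planarMap (fun c => if c.perim = 2 * ℓ then c.inner q else 0)
    simp only [PlanarMap.perim_toClass, PlanarMap.inner_toClass] at this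
    rw [this]
    refine tsum_congr fun c => ?_
    simp only [inner_addLeg, RootedPerim]
    by_cases h1 : c.Rooted <;> simp [h1]

/-- Maps are grouped by perimeter, the root face supplying the factor `q (k + 1)`. It is used with
`H = 1` and with `H` the number of vertices. -/
theorem tsum_mul_weight (q : ℕ → ℝ) (H : PreClass → ℝ≥0∞) (hH : ∀ c, H c.addLeg = H c) :
    ∑' m : PlanarMap, H m.toClass * m.weight q =
      ∑' k : ℕ, ENNReal.ofReal (q (k + 1)) * legSum (fun c => H c * c.inner q) (k + 1) := by
  have h1 : ∀ m : PlanarMap, H m.toClass * m.weight q = (fun c : PreClass =>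
      ENNReal.ofReal (q (c.perim / 2)) * (H c * c.inner q)) m.toClass := by
    intro m
    simp only [PlanarMap.perim_toClass, PlanarMap.inner_toClass, PlanarMap.weight_eq]
    ring
  rw [tsum_congr h1, tsum_planarMap (fun c : PreClass =>
      ENNReal.ofReal (q (c.perim / 2)) * (H c * c.inner q))]
  have h2 : ∀ k : ℕ, ENNReal.ofReal (q (k + 1)) * legSum (fun c => H c * c.inner q) (k + 1) =
      ∑' c : PreClass, if RootedPerim (k + 1) c then
        ENNReal.ofReal (q (k + 1)) * (H c * c.inner q) else 0 := by
    intro k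
    rw [legSum_eq_rooted _ (by omega), ← ENNReal.tsum_mul_left]
    refine tsum_congr fun c => ?_
    rw [mul_ite, mul_zero, hH, inner_addLeg]
  rw [tsum_congr h2, ENNReal.tsum_comm]
  refine tsum_congr fun c => ?_
  split_ifs with hc
  · obtain ⟨j, hj⟩ := hc.even_perim
    have hpos := c.rep.perim_pos
    change c.perim = _ at hj
    change 0 < c.perim at hpos
    rw [tsum_eq_single (j - 1), if_pos ⟨hc, by omega⟩]
    · congr 4
      omega
    · intro k hk
      rw [if_neg]
      rintro ⟨-, h⟩
      omega
  · symm
    rw [ENNReal.tsum_eq_zero]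
    intro k
    rw [if_neg fun h => hc h.1]

theorem tsum_weight (q : ℕ → ℝ) : ∑' m : PlanarMap, m.weight q =
    ∑' k : ℕ, ENNReal.ofReal (q (k + 1)) * legSum (inner q) (k + 1) := by
  have := tsum_mul_weight q (fun _ => 1) fun _ => rfl
  simpa using this

theorem tsum_numVertices_mul_weight (q : ℕ → ℝ) :
    ∑' m : PlanarMap, (m.numVertices : ℝ≥0∞) * m.weight q =
      ∑' k : ℕ, ENNReal.ofReal (q (k + 1)) * legSum (pointedInner q) (k + 1) := by
  have := tsum_mul_weight q vert vert_addLeg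
  simp only [vert, PlanarMap.numVertices_toClass] at this
  exact this

end PlanarMap

section

open Filter Asymptotics Topology

/-! ### Asymptotics of quotients of Gamma values. -/

section GammaRatio

theorem Gamma_add_nat {x : ℝ} (hx : ∀ m : ℕ, x ≠ -m) (n : ℕ) :
    Real.Gamma (x + n) = Real.Gamma x * ∏ j ∈ Finset.range n, (x + j) := by
  induction n with
  | zero => simp
  | succ n ih =>
    have h : x + n ≠ 0 := fun h => hx n (by linarith)
    rw [Finset.prod_range_succ, ← mul_assoc, ← ih, Nat.cast_succ, ← add_assoc,
      Real.Gamma_add_one h, mul_comm]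

/-- This is Euler's limit formula: the expression equals `Γ(x)` divided by `Real.GammaSeq x n`. -/
theorem tendsto_Gamma_div_GammaSeq {x : ℝ} (hx : ∀ m : ℕ, x ≠ -m) :
    Tendsto (fun n : ℕ => Real.Gamma (x + n) * (x + n) / ((n : ℝ) ^ x * n.factorial))
      atTop (𝓝 1) := by
  have h0 := Real.Gamma_ne_zero hx
  have h1 := (Real.GammaSeq_tendsto_Gamma x).inv₀ h0
  have h2 := h1.const_mul (Real.Gamma x)
  rw [mul_inv_cancel₀ h0] at h2
  refine h2.congr fun n => ?_
  rw [Gamma_add_nat hx, Real.GammaSeq, Finset.prod_range_succ, inv_div]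
  ring

theorem isEquivalent_Gamma_div {x y : ℝ} (hx : ∀ m : ℕ, x ≠ -m) (hy : ∀ m : ℕ, y ≠ -m) :
    (fun n : ℕ => Real.Gamma (x + n) / Real.Gamma (y + n)) ~[atTop]
      fun n : ℕ => (n : ℝ) ^ (x - y) := by
  have hlin : Tendsto (fun n : ℕ => (y + n) / (x + n)) atTop (𝓝 1) := by
    have h1 : Tendsto (fun n : ℕ => (x + n : ℝ)) atTop atTop :=
      tendsto_atTop_add_const_left _ _ tendsto_natCast_atTop_atTop
    have h2 : Tendsto (fun n : ℕ => 1 + (y - x) / (x + n : ℝ)) atTop (𝓝 (1 + 0)) :=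
      tendsto_const_nhds.add (h1.const_div_atTop _)
    rw [add_zero] at h2
    refine h2.congr fun n => ?_
    have : x + n ≠ 0 := fun h => hx n (by linarith)
    field_simp
    ring
  have key := ((tendsto_Gamma_div_GammaSeq hx).div (tendsto_Gamma_div_GammaSeq hy)
    one_ne_zero).mul hlin
  rw [isEquivalent_iff_tendsto_one]
  · rw [div_one, mul_one] at key
    refine key.congr' ?_
    filter_upwards [eventually_gt_atTop 0] with n hn
    have hn' : (0 : ℝ) < n := Nat.cast_pos.2 hn
    have h1 : x + n ≠ 0 := fun h => hx n (by linarith)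
    have h2 : y + n ≠ 0 := fun h => hy n (by linarith)
    have h3 : Real.Gamma (y + n) ≠ 0 := Real.Gamma_ne_zero fun m h =>
      hy (n + m) (by push_cast; linarith)
    have h4 := (Real.rpow_pos_of_pos hn' x).ne'
    have h5 := (Real.rpow_pos_of_pos hn' y).ne'
    have h6 : (n.factorial : ℝ) ≠ 0 := Nat.cast_ne_zero.2 n.factorial_ne_zero
    simp only [Pi.div_apply]
    rw [Real.rpow_sub hn']
    field_simp
  · filter_upwards [eventually_gt_atTop 0] with n hn h
    exact ((Real.rpow_pos_of_pos (Nat.cast_pos.2 hn) _).ne' h).elim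

theorem eq_Gamma_of_ratio {x y : ℝ} (hx : ∀ m : ℕ, x ≠ -m) (hy : ∀ m : ℕ, y ≠ -m) {s : ℕ → ℝ}
    (hs : ∀ n : ℕ, (y + n) * s (n + 1) = (x + n) * s n) (n : ℕ) :
    s n = s 0 * (Real.Gamma y / Real.Gamma x) * (Real.Gamma (x + n) / Real.Gamma (y + n)) := by
  have hx0 := Real.Gamma_ne_zero hx
  have hy0 := Real.Gamma_ne_zero hy
  induction n with
  | zero =>
    simp only [Nat.cast_zero, add_zero]
    field_simp
  | succ n ih =>
    have h1 : x + n ≠ 0 := fun h => hx n (by linarith)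
    have h2 : y + n ≠ 0 := fun h => hy n (by linarith)
    have h3 : Real.Gamma (y + n) ≠ 0 := Real.Gamma_ne_zero fun m h =>
      hy (n + m) (by push_cast; linarith)
    refine mul_left_cancel₀ h2 ?_
    rw [hs, ih, Nat.cast_succ, ← add_assoc, ← add_assoc, Real.Gamma_add_one h1,
      Real.Gamma_add_one h2]
    field_simp

/-- The recursion determines `s` up to a scalar as a quotient of Gamma values, whose growth is
known. This yields the decay of the step law at both ends, and of `hDown`. -/
theorem isBigO_of_ratio {x y : ℝ} (hx : ∀ m : ℕ, x ≠ -m) (hy : ∀ m : ℕ, y ≠ -m) {s : ℕ → ℝ}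
    (hs : ∀ n : ℕ, (y + n) * s (n + 1) = (x + n) * s n) :
    s =O[atTop] fun n : ℕ => (n : ℝ) ^ (x - y) := by
  rw [funext (eq_Gamma_of_ratio hx hy hs)]
  exact (isEquivalent_Gamma_div hx hy).isBigO.const_mul_left _

end GammaRatio

/-! ### Bilateral sums and the telescoping identity. -/

section Int

theorem isBigO_int {u : ℤ → ℝ} {p : ℝ} (h1 : (fun n : ℕ => u n) =O[atTop] fun n : ℕ => (n : ℝ) ^ p)
    (h2 : (fun n : ℕ => u (-n)) =O[atTop] fun n : ℕ => (n : ℝ) ^ p) :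
    u =O[cofinite] fun k : ℤ => |(k : ℝ)| ^ p := by
  rw [Int.cofinite_eq]
  refine IsBigO.sup ?_ ?_
  · have h3 : (fun k : ℤ => u (-k)) =O[atTop] fun k : ℤ => |(k : ℝ)| ^ p := by
      rw [← Nat.map_cast_int_atTop, isBigO_map]
      exact h2.congr_right fun n => by simp
    refine (h3.comp_tendsto tendsto_neg_atBot_atTop).congr (fun k => ?_) fun k => ?_ <;> simp
  · rw [← Nat.map_cast_int_atTop, isBigO_map]
    refine h1.congr_right fun n => ?_
    simp

theorem tendsto_abs_cofinite : Tendsto (fun k : ℤ => |(k : ℝ)|) cofinite atTop := by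
  rw [Int.cofinite_eq, tendsto_sup]
  exact ⟨tendsto_abs_atBot_atTop.comp (tendsto_intCast_atBot_iff.2 tendsto_id),
    tendsto_abs_atTop_atTop.comp tendsto_intCast_atTop_atTop⟩

theorem isBigO_shift (p : ℝ) (l : ℤ) :
    (fun k : ℤ => |((l + k : ℤ) : ℝ)| ^ p) =O[cofinite] fun k : ℤ => |(k : ℝ)| ^ p := by
  have h1 : (fun _ : ℤ => (l : ℝ)) =o[cofinite] fun k : ℤ => (k : ℝ) :=
    isLittleO_const_left.2 (Or.inr tendsto_abs_cofinite)
  have h2 : (fun k : ℤ => ((l + k : ℤ) : ℝ)) =Θ[cofinite] fun k : ℤ => (k : ℝ) := by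
    simp only [Int.cast_add]
    exact h1.right_isTheta_add.symm
  have h3 : (fun k : ℤ => |((l + k : ℤ) : ℝ)|) =Θ[cofinite] fun k : ℤ => |(k : ℝ)| :=
    h2.norm_left.norm_right
  exact (h3.rpow (Eventually.of_forall fun k => abs_nonneg _)
    (Eventually.of_forall fun k => abs_nonneg _)).isBigO

theorem tsum_telescope {F G : ℤ → ℝ} (hF : Summable F) (h : ∀ k, F k = G (k + 1) - G k)
    (hG : Tendsto G cofinite (𝓝 0)) : ∑' k, F k = 0 := by
  rw [Int.cofinite_eq, tendsto_sup] at hG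
  have hinj : Function.Injective fun n : ℕ => -((n : ℤ) + 1) := fun a b hab => by
    simp only at hab
    omega
  have s1 : Summable fun n : ℕ => F n := hF.comp_injective Nat.cast_injective
  have s2 : Summable fun n : ℕ => F (-(n + 1)) := hF.comp_injective hinj
  rw [tsum_of_nat_of_neg_add_one s1 s2]
  have e1 : ∀ N : ℕ, ∑ n ∈ Finset.range N, F n = G N - G 0 := by
    intro N
    induction N with
    | zero => simp
    | succ N ih =>
      rw [Finset.sum_range_succ, ih, h]
      push_cast
      ring
  have e2 : ∀ N : ℕ, ∑ n ∈ Finset.range N, F (-(n + 1)) = G 0 - G (-N) := by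
    intro N
    induction N with
    | zero => simp
    | succ N ih =>
      rw [Finset.sum_range_succ, ih, h, show -((N : ℤ) + 1) + 1 = -N by ring]
      push_cast
      ring
  have t1 : ∑' n : ℕ, F n = 0 - G 0 := by
    refine tendsto_nhds_unique s1.hasSum.tendsto_sum_nat ?_
    simp only [e1]
    exact (hG.2.comp tendsto_natCast_atTop_atTop).sub_const _
  have t2 : ∑' n : ℕ, F (-(n + 1)) = G 0 - 0 := by
    refine tendsto_nhds_unique s2.hasSum.tendsto_sum_nat ?_
    simp only [e2]
    exact (hG.1.comp (tendsto_neg_atTop_atBot.comp tendsto_natCast_atTop_atTop)).const_sub _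
  rw [t1, t2]
  ring

/-- A bilateral hypergeometric sum which vanishes. -/
theorem tsum_mul_shift_eq_zero {u g : ℤ → ℝ} {b γ p r : ℝ}
    (hu : ∀ k : ℤ, (3 / 2 + k) * u (k + 1) = (b + k) * u k)
    (hg : ∀ m : ℤ, (γ + m) * g (m + 1) = (1 / 2 + m) * g m)
    (hup : u =O[cofinite] fun k : ℤ => |(k : ℝ)| ^ p)
    (hgr : g =O[cofinite] fun k : ℤ => |(k : ℝ)| ^ r) (hpr : p + r < -1)
    (hne : ∀ ℓ : ℕ, b - ℓ - γ ≠ 0) (ℓ : ℕ) (hℓ : 1 ≤ ℓ) :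
    (Summable fun k : ℤ => u k * g (ℓ + k)) ∧ ∑' k : ℤ, u k * g (ℓ + k) = 0 := by
  have hO : ∀ l : ℕ, (fun k : ℤ => u k * g (l + k)) =O[cofinite]
      fun k : ℤ => |(k : ℝ)| ^ (p + r) := by
    intro l
    have h1 : (fun k : ℤ => g (l + k)) =O[cofinite] fun k : ℤ => |(k : ℝ)| ^ r :=
      (hgr.comp_tendsto (add_right_injective (l : ℤ)).tendsto_cofinite).trans (isBigO_shift r l)
    refine (hup.mul h1).congr' EventuallyEq.rfl ?_
    filter_upwards [tendsto_abs_cofinite.eventually_gt_atTop 0] with k hk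
    rw [Real.rpow_add hk]
  have hS : ∀ l : ℕ, Summable fun k : ℤ => u k * g (l + k) := fun l =>
    summable_of_isBigO (by
      simpa using Real.summable_abs_int_rpow (b := -(p + r)) (by linarith)) (hO l)
  have hG : ∀ l : ℕ, Tendsto (fun k : ℤ => (1 / 2 + k) * (u k * g (l + k))) cofinite (𝓝 0) := by
    intro l
    have h1 : (fun _ : ℤ => (1 / 2 : ℝ)) =O[cofinite] fun k : ℤ => |(k : ℝ)| :=
      (isLittleO_const_left.2 (Or.inr (tendsto_abs_atTop_atTop.comp tendsto_abs_cofinite))).isBigO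
    have h2 : (fun k : ℤ => (k : ℝ)) =O[cofinite] fun k : ℤ => |(k : ℝ)| :=
      (isBigO_refl _ _).norm_right
    refine ((h1.add h2).mul (hO l)).trans_tendsto ?_
    have h3 : Tendsto (fun k : ℤ => |(k : ℝ)| ^ (-(-(p + r + 1)))) cofinite (𝓝 0) :=
      (tendsto_rpow_neg_atTop (by linarith)).comp tendsto_abs_cofinite
    refine h3.congr' ?_
    filter_upwards [tendsto_abs_cofinite.eventually_gt_atTop 0] with k hk
    rw [neg_neg, Real.rpow_add_one hk.ne', mul_comm]
  -- With `S_l = ∑ u k * g (l + k)`, the combination `(b - l - γ) S_(l+1) + l S_l` is the sum of the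
  -- differences of `(1/2 + k) * u k * g (l + k)`: the recursion of `u` rewrites the shifted term,
  -- that of `g` the unshifted one.
  have key : ∀ l : ℕ, (b - l - γ) * ∑' k : ℤ, u k * g ((l + 1 : ℕ) + k) +
      l * ∑' k : ℤ, u k * g (l + k) = 0 := by
    intro l
    rw [← tsum_mul_left, ← tsum_mul_left, ← Summable.tsum_add ((hS _).mul_left _)
      ((hS _).mul_left _)]
    refine tsum_telescope (((hS _).mul_left _).add ((hS _).mul_left _)) (fun k => ?_) (hG l)
    have h1 := hu k
    have h2 := hg (l + k)
    rw [show ((l + 1 : ℕ) : ℤ) + k = l + k + 1 by push_cast; ring,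
      show (l : ℤ) + (k + 1) = l + k + 1 by ring]
    push_cast at h2 ⊢
    linear_combination (-g (l + k + 1)) * h1 - u k * h2
  refine ⟨hS ℓ, ?_⟩
  induction ℓ, hℓ using Nat.le_induction with
  | base =>
    -- At `l = 0` the coefficient of `S_0` vanishes, which starts the induction.
    have := key 0
    simp only [Nat.cast_zero, zero_mul, add_zero, mul_eq_zero] at this
    rcases this with h | h
    · exact (hne 0 (by simpa using h)).elim
    · simpa using h
  | succ l _ ih =>
    have := key l
    rw [ih, mul_zero, add_zero, mul_eq_zero] at this
    exact this.resolve_left (hne l)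

end Int

end

/-! ### The functions `hDown` and `hUp`, the step law, and its harmonic functions. -/

section

open Filter Asymptotics Topology

/-- The function `ℓ ↦ 2 ^ (-2 ℓ) binom(2 ℓ, ℓ)`, extended by `0` to the negative integers. -/
def hDown (m : ℤ) : ℝ := if 0 ≤ m then (m.toNat.centralBinom : ℝ) / 4 ^ m.toNat else 0

theorem hDown_natCast (n : ℕ) : hDown n = (n.centralBinom : ℝ) / 4 ^ n := by simp [hDown]

theorem hDown_zero : hDown 0 = 1 := by simp [hDown]

theorem hDown_one : hDown 1 = 1 / 2 := by
  norm_num [hDown, Nat.centralBinom, Nat.choose]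

theorem hDown_of_neg {m : ℤ} (h : m < 0) : hDown m = 0 := by simp [hDown, h]

theorem hDown_nonneg (m : ℤ) : 0 ≤ hDown m := by
  rw [hDown]
  split_ifs <;> positivity

/-- The recursion survives extension by zero to all of `ℤ` because the factor `1 + m` vanishes
exactly at the step from `-1` to `0`. For `hUp` the factor `0 + m` plays this role at the step from
`0` to `1`. -/
theorem hDown_succ (m : ℤ) : (1 + m) * hDown (m + 1) = (1 / 2 + m) * hDown m := by
  obtain h | rfl | h : m < -1 ∨ m = -1 ∨ 0 ≤ m := by omega
  · rw [hDown_of_neg (by omega), hDown_of_neg (by omega), mul_zero, mul_zero]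
  · rw [hDown_of_neg (m := -1) (by norm_num)]
    simp
  · lift m to ℕ using h
    have h1 : ((m : ℝ) + 1) * (m + 1).centralBinom = 2 * (2 * m + 1) * m.centralBinom := by
      exact_mod_cast Nat.succ_mul_centralBinom_succ m
    rw [show (m : ℤ) + 1 = (m + 1 : ℕ) by push_cast; ring, hDown_natCast, hDown_natCast, pow_succ]
    field_simp
    push_cast
    linear_combination 2 * h1

theorem hUp_eq (m : ℤ) : hUp m = 2 * m * hDown m := by
  obtain h | rfl | h := lt_trichotomy m 0
  · rw [hDown_of_neg h, hUp, if_neg (by omega), mul_zero]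
  · simp [hUp]
  · lift m to ℕ using h.le
    rw [hUp, if_pos h, hDown_natCast, Int.toNat_natCast, Nat.centralBinom,
      show -2 * (m : ℤ) = -((2 * m : ℕ) : ℤ) by push_cast; ring, zpow_neg, zpow_natCast, pow_mul]
    norm_num
    ring

theorem hUp_succ (m : ℤ) : (0 + m) * hUp (m + 1) = (1 / 2 + m) * hUp m := by
  rw [hUp_eq, hUp_eq]
  push_cast
  linear_combination 2 * (m : ℝ) * hDown_succ m

theorem ne_neg_natCast_of_pos {x : ℝ} (h : 0 < x) (m : ℕ) : x ≠ -m := by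
  have : (0 : ℝ) ≤ m := m.cast_nonneg
  linarith

theorem ne_neg_natCast_of_mem {x : ℝ} (h : x ∈ Set.Ioo (-1 : ℝ) 0) (m : ℕ) : x ≠ -m := by
  rintro rfl
  obtain ⟨h1, h2⟩ := h
  have h3 : m < 1 := by exact_mod_cast (by linarith : (m : ℝ) < 1)
  have h4 : 0 < m := by exact_mod_cast (by linarith : (0 : ℝ) < m)
  omega

theorem hDown_natCast_isBigO :
    (fun n : ℕ => hDown n) =O[atTop] fun n : ℕ => (n : ℝ) ^ (-(1 / 2) : ℝ) := by
  have := isBigO_of_ratio (x := 1 / 2) (y := 1) (s := fun n : ℕ => hDown n)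
    (ne_neg_natCast_of_pos (by norm_num)) (ne_neg_natCast_of_pos (by norm_num)) fun n => by
      simpa using hDown_succ n
  norm_num at this ⊢
  exact this

theorem hDown_isBigO : hDown =O[cofinite] fun k : ℤ => |(k : ℝ)| ^ (-(1 / 2) : ℝ) := by
  refine isBigO_int hDown_natCast_isBigO ?_
  refine IsBigO.of_bound 1 ?_
  filter_upwards [eventually_gt_atTop 0] with n hn
  rw [hDown_of_neg (by omega)]
  simp

theorem hUp_isBigO : hUp =O[cofinite] fun k : ℤ => |(k : ℝ)| ^ (1 / 2 : ℝ) := by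
  have h2 : (fun k : ℤ => 2 * (k : ℝ)) =O[cofinite] fun k : ℤ => |(k : ℝ)| :=
    ((isBigO_refl _ _).norm_right).const_mul_left 2
  refine (h2.mul hDown_isBigO).congr' (Eventually.of_forall fun k => (hUp_eq k).symm) ?_
  filter_upwards [tendsto_abs_cofinite.eventually_gt_atTop 0] with k hk
  rw [← Real.rpow_one_add' hk.le (by norm_num)]
  norm_num

theorem tendsto_hDown : Tendsto (fun n : ℕ => hDown n) atTop (𝓝 0) :=
  hDown_natCast_isBigO.trans_tendsto
    ((tendsto_rpow_neg_atTop (by norm_num)).comp tendsto_natCast_atTop_atTop)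

/-- The solution with value `1` at `0` of `(3 / 2 + k) * u (k + 1) = (b + k) * u k`. -/
def gammaRatio (b : ℝ) (k : ℤ) : ℝ :=
  Real.sqrt Real.pi / (2 * Real.Gamma b) * (Real.Gamma (b + k) / Real.Gamma (3 / 2 + k))

/-- The step law, with parameter `b = 3 / 2 - a`. -/
def step (b : ℝ) (k : ℤ) : ℝ := (if k = 0 then 1 else 0) - gammaRatio b k

variable {b : ℝ}

theorem add_intCast_ne_zero (hb : b ∈ Set.Ioo (-1 : ℝ) 0) (k : ℤ) : b + k ≠ 0 := by
  intro h
  have h0 : b = ((-k : ℤ) : ℝ) := by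
    push_cast
    linarith
  obtain ⟨h1, h2⟩ := hb
  rw [h0] at h1 h2
  have h3 : -1 < -k := by exact_mod_cast h1
  have h4 : -k < 0 := by exact_mod_cast h2
  omega

theorem three_halves_add_intCast_ne_zero (k : ℤ) : (3 / 2 + k : ℝ) ≠ 0 := by
  intro h
  have : (3 + 2 * k : ℤ) = 0 := by
    exact_mod_cast (by linarith : (3 + 2 * (k : ℝ)) = 0)
  omega

theorem gammaRatio_succ (hb : b ∈ Set.Ioo (-1 : ℝ) 0) (k : ℤ) :
    (3 / 2 + k) * gammaRatio b (k + 1) = (b + k) * gammaRatio b k := by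
  have h1 := add_intCast_ne_zero hb k
  have h2 := three_halves_add_intCast_ne_zero k
  have h3 : Real.Gamma (3 / 2 + k) ≠ 0 := Real.Gamma_ne_zero fun m h =>
    three_halves_add_intCast_ne_zero (k + m) (by push_cast; linarith)
  rw [gammaRatio, gammaRatio, Int.cast_add, Int.cast_one, ← add_assoc, ← add_assoc,
    Real.Gamma_add_one h1, Real.Gamma_add_one h2]
  generalize Real.Gamma (3 / 2 + k) = G at *
  generalize (3 / 2 + k : ℝ) = t at *
  field_simp

theorem gammaRatio_zero (hb : b ∈ Set.Ioo (-1 : ℝ) 0) : gammaRatio b 0 = 1 := by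
  have h1 : Real.Gamma b ≠ 0 := Real.Gamma_ne_zero (ne_neg_natCast_of_mem hb)
  have h2 : Real.Gamma (3 / 2) = 1 / 2 * Real.sqrt Real.pi := by
    rw [show (3 / 2 : ℝ) = 1 / 2 + 1 by norm_num, Real.Gamma_add_one (by norm_num),
      Real.Gamma_one_half_eq]
  have h3 : Real.sqrt Real.pi ≠ 0 := (Real.sqrt_pos.2 Real.pi_pos).ne'
  rw [gammaRatio, Int.cast_zero, add_zero, add_zero, h2]
  field_simp

theorem gammaRatio_isBigO (hb : b ∈ Set.Ioo (-1 : ℝ) 0) :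
    gammaRatio b =O[cofinite] fun k : ℤ => |(k : ℝ)| ^ (b - 3 / 2) := by
  refine isBigO_int ?_ ?_
  · exact isBigO_of_ratio (ne_neg_natCast_of_mem hb) (ne_neg_natCast_of_pos (by norm_num))
      fun n => by simpa using gammaRatio_succ hb n
  · have := isBigO_of_ratio (x := -(1 / 2)) (y := 1 - b) (s := fun n : ℕ => gammaRatio b (-n))
      (ne_neg_natCast_of_mem (by norm_num)) (ne_neg_natCast_of_pos (by linarith [hb.2]))
      fun n => by
        have := gammaRatio_succ hb (-(n : ℤ) - 1)
        rw [show -(n : ℤ) - 1 + 1 = -n by ring, show -(n : ℤ) - 1 = -(n + 1 : ℕ) by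
          push_cast; ring] at this
        push_cast at this ⊢
        linear_combination this
    rwa [show -(1 / 2) - (1 - b) = b - 3 / 2 by ring] at this

/-- The factor `b / (3/2)` leading from `0` to `1` is negative and the later ones are positive,
since `-1 < b < 0`. Going down from `0` there is likewise one change of sign, so the step law is
positive off `0`. -/
theorem gammaRatio_natCast_succ_neg (hb : b ∈ Set.Ioo (-1 : ℝ) 0) (n : ℕ) :
    gammaRatio b (n + 1) < 0 := by
  obtain ⟨hb1, hb2⟩ := hb
  induction n with
  | zero =>
    have h := gammaRatio_succ ⟨hb1, hb2⟩ 0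
    rw [gammaRatio_zero ⟨hb1, hb2⟩] at h
    simp only [Int.cast_zero, zero_add, add_zero, mul_one, Nat.cast_zero] at h ⊢
    linarith
  | succ n ih =>
    have h := gammaRatio_succ ⟨hb1, hb2⟩ (n + 1)
    push_cast at h ⊢
    have hn : (0 : ℝ) ≤ n := n.cast_nonneg
    have h1 : (b + (n + 1)) * gammaRatio b (n + 1) < 0 := mul_neg_of_pos_of_neg (by linarith) ih
    rw [← h] at h1
    exact neg_of_mul_neg_right h1 (by linarith)

theorem gammaRatio_neg_succ_neg (hb : b ∈ Set.Ioo (-1 : ℝ) 0) (n : ℕ) :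
    gammaRatio b (-1 - n) < 0 := by
  obtain ⟨hb1, hb2⟩ := hb
  induction n with
  | zero =>
    have h := gammaRatio_succ ⟨hb1, hb2⟩ (-1)
    norm_num at h ⊢
    rw [gammaRatio_zero ⟨hb1, hb2⟩] at h
    by_contra! h'
    nlinarith
  | succ n ih =>
    have h := gammaRatio_succ ⟨hb1, hb2⟩ (-1 - (n + 1 : ℕ))
    rw [show (-1 - ((n + 1 : ℕ) : ℤ) + 1) = -1 - n by push_cast; ring] at h
    have hn : (0 : ℝ) ≤ n := n.cast_nonneg
    have h1 : 0 < (3 / 2 + ((-1 - (n + 1 : ℕ) : ℤ) : ℝ)) * gammaRatio b (-1 - n) :=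
      mul_pos_of_neg_of_neg (by push_cast; linarith) ih
    rw [h] at h1
    exact neg_of_mul_pos_right h1 (by push_cast; linarith)

theorem step_of_ne {k : ℤ} (h : k ≠ 0) : step b k = -gammaRatio b k := by simp [step, h]

theorem step_zero (hb : b ∈ Set.Ioo (-1 : ℝ) 0) : step b 0 = 0 := by
  simp [step, gammaRatio_zero hb]

theorem step_pos (hb : b ∈ Set.Ioo (-1 : ℝ) 0) {k : ℤ} (h : k ≠ 0) : 0 < step b k := by
  rw [step_of_ne h, neg_pos]
  obtain h | h := h.lt_or_gt
  · obtain ⟨n, rfl⟩ : ∃ n : ℕ, k = -1 - n := ⟨(-1 - k).toNat, by omega⟩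
    exact gammaRatio_neg_succ_neg hb n
  · obtain ⟨n, rfl⟩ : ∃ n : ℕ, k = n + 1 := ⟨(k - 1).toNat, by omega⟩
    exact gammaRatio_natCast_succ_neg hb n

theorem step_nonneg (hb : b ∈ Set.Ioo (-1 : ℝ) 0) (k : ℤ) : 0 ≤ step b k := by
  obtain rfl | h := eq_or_ne k 0
  · exact (step_zero hb).ge
  · exact (step_pos hb h).le

theorem step_neg_one (hb : b ∈ Set.Ioo (-1 : ℝ) 0) : step b (-1) = 1 / (2 * (1 - b)) := by
  have h := gammaRatio_succ hb (-1)
  norm_num at h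
  rw [gammaRatio_zero hb] at h
  have h1 : 1 - b ≠ 0 := by linarith [hb.2]
  rw [step_of_ne (by norm_num)]
  field_simp
  linear_combination -2 * h

/-- In `step = δ_0 - gammaRatio` the first part contributes `g ℓ` and the second sums to zero. The
bound on `b + r` is absolute convergence, as `gammaRatio` decays like `|k| ^ (b - 3/2)`; `0 ≤ γ` and
`b < 0` keep `b - l - γ` away from zero. -/
theorem hasSum_step_mul {g : ℤ → ℝ} {γ r : ℝ} (hb : b ∈ Set.Ioo (-1 : ℝ) 0)
    (hg : ∀ m : ℤ, (γ + m) * g (m + 1) = (1 / 2 + m) * g m)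
    (hgr : g =O[cofinite] fun k : ℤ => |(k : ℝ)| ^ r) (hr : b + r < 1 / 2)
    (hγ : 0 ≤ γ) {ℓ : ℕ} (hℓ : 1 ≤ ℓ) :
    HasSum (fun k : ℤ => step b k * g (ℓ + k)) (g ℓ) := by
  obtain ⟨h1, h2⟩ := tsum_mul_shift_eq_zero (gammaRatio_succ hb) hg (gammaRatio_isBigO hb) hgr
    (by linarith) (fun l => by
      have : (0 : ℝ) ≤ l := l.cast_nonneg
      linarith [hb.2]) ℓ hℓ
  have h3 := h1.hasSum
  rw [h2] at h3
  have h4 := (hasSum_ite_eq (0 : ℤ) (g ℓ)).sub h3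
  rw [sub_zero] at h4
  refine h4.congr_fun fun k => ?_
  rw [step, sub_mul]
  split_ifs with h
  · simp [h]
  · simp

theorem hasSum_step (hb : b ∈ Set.Ioo (-1 : ℝ) 0) : HasSum (step b) 1 := by
  have := hasSum_step_mul (g := fun _ => 1) (γ := 1 / 2) (r := 0) hb (fun _ => rfl)
    (by simpa using isBigO_refl (fun _ : ℤ => (1 : ℝ)) cofinite) (by linarith [hb.2]) (by norm_num) le_rfl
  simpa using this

theorem hasSum_step_mul_hDown (hb : b ∈ Set.Ioo (-1 : ℝ) 0) {ℓ : ℕ} (hℓ : 1 ≤ ℓ) :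
    HasSum (fun k : ℤ => step b k * hDown (ℓ + k)) (hDown ℓ) :=
  hasSum_step_mul hb hDown_succ hDown_isBigO (by linarith [hb.2]) zero_le_one hℓ

theorem hasSum_step_mul_hUp (hb : b ∈ Set.Ioo (-1 : ℝ) 0) {ℓ : ℕ} (hℓ : 1 ≤ ℓ) :
    HasSum (fun k : ℤ => step b k * hUp (ℓ + k)) (hUp ℓ) :=
  hasSum_step_mul hb hUp_succ hUp_isBigO (by linarith [hb.2]) le_rfl hℓ

/-- The reflected `gammaRatio` satisfies the recursion with `γ = 2 - b`. The factor `2` arises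
because the point mass in the second factor adds `step b (-1 - ℓ)` at `k = -1 - ℓ` to the harmonic
value. -/
theorem hasSum_step_mul_step (hb : b ∈ Set.Ioo (-1 : ℝ) 0) {ℓ : ℕ} (hℓ : 1 ≤ ℓ) :
    HasSum (fun k : ℤ => step b k * step b (-1 - (ℓ + k))) (2 * step b (-1 - ℓ)) := by
  have hinj : Function.Injective fun k : ℤ => -1 - k := sub_right_injective
  have h1 := hasSum_step_mul (g := fun m => gammaRatio b (-1 - m)) (γ := 2 - b) (r := b - 3 / 2)
    hb (fun m => by
      have := gammaRatio_succ hb (-1 - (m + 1))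
      rw [show -1 - (m + 1) + 1 = -1 - m by ring] at this
      push_cast at this
      linear_combination this) (by
      have := (gammaRatio_isBigO hb).comp_tendsto hinj.tendsto_cofinite
      refine this.trans ?_
      refine (isBigO_shift (b - 3 / 2) 1).congr_left fun k => ?_
      simp only [Function.comp_apply]
      rw [← abs_neg]
      push_cast
      ring_nf) (by linarith [hb.2]) (by linarith [hb.2]) hℓ
  have h2 := (hasSum_ite_eq (-1 - ℓ : ℤ) (step b (-1 - ℓ))).sub h1
  rw [show 2 * step b (-1 - ℓ) = step b (-1 - ℓ) - gammaRatio b (-1 - ℓ) by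
    rw [step_of_ne (by omega)]; ring]
  refine h2.congr_fun fun k => ?_
  have h3 : step b (-1 - (ℓ + k)) =
    (if -1 - (ℓ + k) = 0 then 1 else 0) - gammaRatio b (-1 - (ℓ + k)) := rfl
  rw [h3, mul_sub]
  congr 1
  by_cases h : k = -1 - ℓ
  · rw [if_pos (by omega), if_pos h, h, mul_one]
  · rw [if_neg (by omega), if_neg h, mul_zero]

end

/-! ### Solving the loop equations: domination and the maximum principle. -/

section

open Filter Topology

open Finset.HasAntidiagonal (antidiagonal)

/-- For a walk at `n + 1` the three parts are the jumps with `k ≥ 0`, the jumps landing on `p.2` in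
`{0, ..., n}`, and those landing on negative integers. -/
theorem tsum_int_split {F : ℤ → ℝ} (hF : Summable F) (n : ℕ) :
    ∑' k, F k = ∑' k : ℕ, F k + ∑ p ∈ antidiagonal n, F (-1 - p.1) +
      ∑' k : ℕ, F (-1 - ((n + 1 : ℕ) + k)) := by
  have s1 : Summable fun k : ℕ => F k := hF.comp_injective Nat.cast_injective
  have s2 : Summable fun k : ℕ => F (-(k + 1)) := hF.comp_injective fun a b h => by
    omega
  rw [tsum_of_nat_of_neg_add_one s1 s2, ← s2.sum_add_tsum_nat_add (n + 1), ← add_assoc,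
    Finset.Nat.sum_antidiagonal_eq_sum_range_succ_mk]
  congr 1
  · congr 1
    exact Finset.sum_congr rfl fun i _ => congrArg F (by ring)
  · exact tsum_congr fun k => congrArg F (by push_cast; ring)

variable {b : ℝ}

theorem summable_step_mul_hDown (hb : b ∈ Set.Ioo (-1 : ℝ) 0) (n : ℕ) :
    Summable fun k : ℕ => step b k * hDown ((n + 1 + k : ℕ) : ℤ) := by
  refine ((hasSum_step_mul_hDown hb (Nat.succ_pos n)).summable.comp_injective
    (i := fun k : ℕ => (k : ℤ)) Nat.cast_injective).congr fun k => ?_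
  simp

theorem hDown_recursion (hb : b ∈ Set.Ioo (-1 : ℝ) 0) (n : ℕ) :
    hDown ((n + 1 : ℕ) : ℤ) = ∑' k : ℕ, step b k * hDown ((n + 1 + k : ℕ) : ℤ) +
      ∑ p ∈ antidiagonal n, step b (-1 - p.1) * hDown p.2 := by
  have h := hasSum_step_mul_hDown hb (Nat.succ_pos n)
  have h0 := h.tsum_eq
  rw [tsum_int_split h.summable n] at h0
  rw [← h0]
  have h1 : ∀ k : ℕ, step b (-1 - ((n + 1 : ℕ) + k)) *
      hDown (((n + 1 : ℕ) : ℤ) + (-1 - ((n + 1 : ℕ) + k))) = 0 := fun k => by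
    rw [hDown_of_neg (by omega), mul_zero]
  simp only [Nat.succ_eq_add_one, h1, tsum_zero, add_zero]
  congr 1
  refine Finset.sum_congr rfl fun p hp => ?_
  rw [Finset.HasAntidiagonal.mem_antidiagonal] at hp
  congr 2
  omega

theorem summable_step_mul_step (hb : b ∈ Set.Ioo (-1 : ℝ) 0) (n : ℕ) :
    Summable fun k : ℕ => step b k * step b (-1 - (n + 1 + k : ℕ)) := by
  refine ((hasSum_step_mul_step hb (Nat.succ_pos n)).summable.comp_injective
    (i := fun k : ℕ => (k : ℤ)) Nat.cast_injective).congr fun k => ?_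
  simp

/-- The involution `k ↦ -1 - (n + 1 + k)` exchanges the first and third parts of `tsum_int_split`
and preserves the summand; half of `hasSum_step_mul_step` is then Tutte's equation in rescaled form.
-/
theorem step_recursion (hb : b ∈ Set.Ioo (-1 : ℝ) 0) (n : ℕ) :
    step b (-1 - (n + 1 : ℕ)) = ∑' k : ℕ, step b k * step b (-1 - (n + 1 + k : ℕ)) +
      (∑ p ∈ antidiagonal n, step b (-1 - p.1) * step b (-1 - p.2)) / 2 := by
  have h := hasSum_step_mul_step hb (Nat.succ_pos n)
  have h0 := h.tsum_eq
  rw [tsum_int_split h.summable n] at h0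
  have h1 : ∀ k : ℕ, step b (-1 - ((n + 1 : ℕ) + k)) *
      step b (-1 - (((n + 1 : ℕ) : ℤ) + (-1 - ((n + 1 : ℕ) + k)))) =
      step b k * step b (-1 - (n + 1 + k : ℕ)) := fun k => by
    rw [mul_comm]
    congr 2
    · ring
  have h2 : ∑ p ∈ antidiagonal n, step b (-1 - p.1) *
      step b (-1 - (((n + 1 : ℕ) : ℤ) + (-1 - p.1))) =
      ∑ p ∈ antidiagonal n, step b (-1 - p.1) * step b (-1 - p.2) := by
    refine Finset.sum_congr rfl fun p hp => ?_
    rw [Finset.HasAntidiagonal.mem_antidiagonal] at hp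
    congr 2
    omega
  simp only [Nat.succ_eq_add_one, h1] at h0
  rw [h2] at h0
  push_cast at h0 ⊢
  linarith

/-- The maximum principle for functions on the non-negative integers which are subharmonic on the
positive integers. -/
theorem eq_zero_of_subharmonic (hb : b ∈ Set.Ioo (-1 : ℝ) 0) {δ : ℕ → ℝ} (h0 : δ 0 = 0)
    (hδ : ∀ n, 0 ≤ δ n) (hlim : Tendsto δ atTop (𝓝 0))
    (hsub : ∀ n, δ (n + 1) ≤ ∑' k : ℕ, step b k * δ (n + 1 + k) +
      ∑ p ∈ antidiagonal n, step b (-1 - p.1) * δ p.2) (n : ℕ) : δ n = 0 := by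
  by_contra hn
  have hpos : 0 < δ n := (hδ n).lt_of_ne' hn
  obtain ⟨N, hN⟩ := eventually_atTop.1 (hlim.eventually_lt_const hpos)
  obtain ⟨m, -, hm⟩ := (Finset.range (N + n + 1)).exists_max_image δ ⟨n, by simp⟩
  have hmax : ∀ i, δ i ≤ δ m := fun i => by
    by_cases hi : i < N + n + 1
    · exact hm i (Finset.mem_range.2 hi)
    · exact (hN i (by omega)).le.trans (hm n (by simp))
  have hmpos : 0 < δ m := hpos.trans_le (hmax n)
  obtain _ | m := m
  · exact hmpos.ne' h0
  have hs := hasSum_step hb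
  have e1 := tsum_int_split hs.summable m
  rw [hs.tsum_eq] at e1
  have s1 : Summable fun k : ℕ => step b k := hs.summable.comp_injective Nat.cast_injective
  have i1 : ∑' k : ℕ, step b k * δ (m + 1 + k) ≤ (∑' k : ℕ, step b k) * δ (m + 1) := by
    rw [← tsum_mul_right]
    have hle : ∀ k : ℕ, step b k * δ (m + 1 + k) ≤ step b k * δ (m + 1) := fun k =>
      mul_le_mul_of_nonneg_left (hmax _) (step_nonneg hb _)
    exact Summable.tsum_le_tsum hle (Summable.of_nonneg_of_le
      (fun k => mul_nonneg (step_nonneg hb _) (hδ _)) hle (s1.mul_right _)) (s1.mul_right _)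
  -- Strictness comes from the jump to `0`, which has positive probability and lands where `δ`
  -- vanishes.
  have i2 : ∑ p ∈ antidiagonal m, step b (-1 - p.1) * δ p.2 <
      (∑ p ∈ antidiagonal m, step b (-1 - p.1)) * δ (m + 1) := by
    rw [Finset.sum_mul]
    refine Finset.sum_lt_sum (fun p _ =>
      mul_le_mul_of_nonneg_left (hmax _) (step_nonneg hb _)) ⟨(m, 0), ?_, ?_⟩
    · simp [Finset.HasAntidiagonal.mem_antidiagonal]
    · rw [h0, mul_zero]
      exact mul_pos (step_pos hb (by simp only; omega)) hmpos
  have i3 : 0 ≤ ∑' k : ℕ, step b (-1 - ((m + 1 : ℕ) + k)) := tsum_nonneg fun k => step_nonneg hb _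
  have i4 := hsub m
  nlinarith

section Recursion

variable {q : ℕ → ℝ} {κ : ℝ} {X : ℕ → ℝ≥0∞} {A : ℝ≥0∞} {n : ℕ}

/-- Rescaling of the real form of a loop equation. -/
theorem toReal_recursion (hb : b ∈ Set.Ioo (-1 : ℝ) 0) (hκ : 0 < κ)
    (hq : ∀ k : ℕ, q (k + 1) = step b k * κ ^ k) (hX : ∀ m, X m ≠ ∞)
    (h : X (n + 1) = ∑' k : ℕ, ENNReal.ofReal (q (k + 1)) * X (n + 1 + k) + A) :
    (Summable fun k : ℕ => step b k * (κ ^ (n + 1 + k) * (X (n + 1 + k)).toReal)) ∧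
      κ ^ (n + 1) * (X (n + 1)).toReal =
        ∑' k : ℕ, step b k * (κ ^ (n + 1 + k) * (X (n + 1 + k)).toReal) +
          κ ^ (n + 1) * A.toReal := by
  have hA : A ≠ ∞ := ne_top_of_le_ne_top (hX (n + 1)) (h ▸ le_add_self)
  have hS : ∑' k : ℕ, ENNReal.ofReal (q (k + 1)) * X (n + 1 + k) ≠ ∞ :=
    ne_top_of_le_ne_top (hX (n + 1)) (h ▸ le_self_add)
  have hterm : ∀ k : ℕ, κ ^ (n + 1) * (ENNReal.ofReal (q (k + 1)) * X (n + 1 + k)).toReal =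
      step b k * (κ ^ (n + 1 + k) * (X (n + 1 + k)).toReal) := fun k => by
    rw [ENNReal.toReal_mul, ENNReal.toReal_ofReal (by
      rw [hq]; exact mul_nonneg (step_nonneg hb _) (by positivity)), hq, pow_add κ (n + 1) k]
    ring
  refine ⟨((ENNReal.summable_toReal hS).mul_left (κ ^ (n + 1))).congr hterm, ?_⟩
  rw [h, ENNReal.toReal_add hS hA, mul_add,
    ENNReal.tsum_toReal_eq (fun k => ENNReal.mul_ne_top ENNReal.ofReal_ne_top (hX _)),
    ← tsum_mul_left, tsum_congr hterm]

theorem ofReal_recursion (hb : b ∈ Set.Ioo (-1 : ℝ) 0) (hκ : 0 < κ)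
    (hq : ∀ k : ℕ, q (k + 1) = step b k * κ ^ k) {x : ℕ → ℝ} (hx : ∀ m, 0 ≤ x m)
    (hs : Summable fun k : ℕ => step b k * x (n + 1 + k)) :
    ∑' k : ℕ, ENNReal.ofReal (q (k + 1)) * ENNReal.ofReal (x (n + 1 + k) / κ ^ (n + 1 + k)) =
      ENNReal.ofReal ((∑' k : ℕ, step b k * x (n + 1 + k)) / κ ^ (n + 1)) := by
  have h1 : ∀ k : ℕ, ENNReal.ofReal (q (k + 1)) *
      ENNReal.ofReal (x (n + 1 + k) / κ ^ (n + 1 + k)) =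
      ENNReal.ofReal (step b k * x (n + 1 + k) / κ ^ (n + 1)) := fun k => by
    rw [← ENNReal.ofReal_mul (by rw [hq]; exact mul_nonneg (step_nonneg hb _) (by positivity)), hq,
      pow_add κ (n + 1) k]
    congr 1
    field_simp
  rw [tsum_congr h1, ← tsum_div_const, ENNReal.ofReal_tsum_of_nonneg (fun k =>
    div_nonneg (mul_nonneg (step_nonneg hb _) (hx _)) (by positivity)) (hs.div_const _)]

end Recursion

section Solution

variable {q : ℕ → ℝ} {κ : ℝ}

open PreClass

/-- By `step_recursion` the right-hand side solves Tutte's equation; `step b (-1) = 2 * κ` is the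
normalisation `W_0 = 1`. -/
theorem legSum_inner_le_step (hb : b ∈ Set.Ioo (-1 : ℝ) 0) (hκ : 0 < κ)
    (hκb : step b (-1) = 2 * κ) (hq : ∀ k : ℕ, q (k + 1) = step b k * κ ^ k) (n : ℕ) :
    legSum (inner q) n ≤ ENNReal.ofReal (step b (-1 - n) / (2 * κ) / κ ^ n) := by
  have hx : ∀ m : ℕ, 0 ≤ step b (-1 - m) / (2 * κ) := fun m =>
    div_nonneg (step_nonneg hb _) (by positivity)
  have hy : ∀ m : ℕ, 0 ≤ step b (-1 - m) / (2 * κ) / κ ^ m := fun m =>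
    div_nonneg (hx m) (by positivity)
  have hs := fun n => ((summable_step_mul_step hb n).div_const (2 * κ)).congr fun k =>
    mul_div_assoc _ _ _
  refine legSum_inner_le q (fun n => ENNReal.ofReal (step b (-1 - n) / (2 * κ) / κ ^ n))
    ?_ (fun n => ?_) n
  · simp [hκb, hκ.ne']
  · rw [ofReal_recursion hb hκ hq (x := fun m : ℕ => step b (-1 - m) / (2 * κ)) hx (hs n)]
    simp only [← ENNReal.ofReal_mul (hy _)]
    rw [← ENNReal.ofReal_sum_of_nonneg (fun p _ => mul_nonneg (hy _) (hy _)),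
      ← ENNReal.ofReal_add (div_nonneg (tsum_nonneg fun k => mul_nonneg (step_nonneg hb _) (hx _))
        (by positivity)) (Finset.sum_nonneg fun p _ => mul_nonneg (hy _) (hy _)),
      step_recursion hb n]
    refine (congrArg ENNReal.ofReal ?_).le
    have h1 : ∀ p ∈ antidiagonal n, step b (-1 - p.1) / (2 * κ) / κ ^ p.1 *
        (step b (-1 - p.2) / (2 * κ) / κ ^ p.2) =
        step b (-1 - p.1) * step b (-1 - p.2) / (2 * (2 * κ) * κ ^ (n + 1)) := by
      intro p hp
      rw [Finset.HasAntidiagonal.mem_antidiagonal] at hp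
      rw [← hp, pow_succ, pow_add]
      field_simp
    rw [Finset.sum_congr rfl h1, ← Finset.sum_div, add_div, add_div]
    congr 1
    · simp only [← mul_div_assoc, tsum_div_const]
    · field_simp

theorem legSum_inner_eq (hb : b ∈ Set.Ioo (-1 : ℝ) 0) (hκ : 0 < κ)
    (hκb : step b (-1) = 2 * κ) (hq : ∀ k : ℕ, q (k + 1) = step b k * κ ^ k) (n : ℕ) :
    legSum (inner q) n = ENNReal.ofReal (step b (-1 - n) / (2 * κ) / κ ^ n) := by
  have hle := legSum_inner_le_step hb hκ hκb hq
  have hfin : ∀ m, legSum (inner q) m ≠ ∞ := fun m => ne_top_of_le_ne_top ENNReal.ofReal_ne_top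
    (hle m)
  set w : ℕ → ℝ := fun m => κ ^ m * (legSum (inner q) m).toReal with hw
  have hw0 : ∀ m, 0 ≤ w m := fun m => mul_nonneg (by positivity) ENNReal.toReal_nonneg
  have hwle : ∀ m : ℕ, w m ≤ step b (-1 - m) / (2 * κ) := fun m => by
    have h1 := ENNReal.toReal_le_of_le_ofReal
      (div_nonneg (div_nonneg (step_nonneg hb _) (by positivity)) (by positivity)) (hle m)
    rw [le_div_iff₀ (by positivity)] at h1
    linarith [show w m = κ ^ m * _ from rfl]
  have hrec : ∀ m, (Summable fun k : ℕ => step b k * w (m + 1 + k)) ∧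
      w (m + 1) = ∑' k : ℕ, step b k * w (m + 1 + k) +
        κ * ∑ p ∈ antidiagonal m, w p.1 * w p.2 := fun m => by
    obtain ⟨h1, h2⟩ := toReal_recursion hb hκ hq hfin (legSum_inner_succ q m)
    refine ⟨h1, h2.trans ?_⟩
    congr 1
    rw [ENNReal.toReal_sum fun p _ => ENNReal.mul_ne_top (hfin _) (hfin _), pow_succ', mul_assoc,
      Finset.mul_sum]
    congr 1
    refine Finset.sum_congr rfl fun p hp => ?_
    rw [Finset.HasAntidiagonal.mem_antidiagonal] at hp
    rw [← hp, pow_add, ENNReal.toReal_mul]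
    simp only [hw]
    ring
  have hlim : Tendsto (fun m : ℕ => step b (-1 - m) / (2 * κ) - w m) atTop (𝓝 0) := by
    have h1 : Tendsto (fun m : ℕ => step b (-1 - m)) atTop (𝓝 0) :=
      (hasSum_step hb).summable.tendsto_cofinite_zero.comp (by
        rw [← Nat.cofinite_eq_atTop]
        exact Function.Injective.tendsto_cofinite fun a b h => by
          omega)
    have h2 := h1.div_const (2 * κ)
    rw [zero_div] at h2
    exact squeeze_zero (fun m => sub_nonneg.2 (hwle m)) (fun m => sub_le_self _ (hw0 m)) h2
  have hzero := eq_zero_of_subharmonic hb (δ := fun m : ℕ => step b (-1 - m) / (2 * κ) - w m)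
    (by simp [hw, hκb, hκ.ne', legSum_inner_zero]) (fun m => sub_nonneg.2 (hwle m)) hlim
    (fun m => by
      obtain ⟨hs, h1⟩ := hrec m
      have hs' : Summable fun k : ℕ => step b k * (step b (-1 - (m + 1 + k : ℕ)) / (2 * κ)) :=
        ((summable_step_mul_step hb m).div_const (2 * κ)).congr fun k => mul_div_assoc _ _ _
      simp only [mul_sub]
      rw [Summable.tsum_sub hs' hs, h1, step_recursion hb m, add_div, ← tsum_div_const]
      simp only [mul_div_assoc]
      -- With `v` the candidate, `(v_i - w_i) * (v_j - w_j) ≥ 0` bounds the quadratic difference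
      -- `v_i v_j - w_i w_j` by an expression linear in `v - w`, so that `v - w` is subharmonic for
      -- the step law.
      have h2 : (∑ p ∈ antidiagonal m, step b (-1 - p.1) * step b (-1 - p.2)) / 2 / (2 * κ) -
          κ * ∑ p ∈ antidiagonal m, w p.1 * w p.2 ≤
          ∑ p ∈ antidiagonal m, (step b (-1 - p.1) * (step b (-1 - p.2) / (2 * κ)) -
            step b (-1 - p.1) * w p.2) := by
        set v : ℕ → ℝ := fun m => step b (-1 - m) / (2 * κ) with hv
        have hv' : ∀ m : ℕ, step b (-1 - m) = 2 * κ * v m := fun m => by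
          rw [hv]
          field_simp
        have hv0 : ∀ m : ℕ, 0 ≤ v m := fun m => div_nonneg (step_nonneg hb _) (by positivity)
        have h3 : ∑ p ∈ antidiagonal m, v p.1 * w p.2 = ∑ p ∈ antidiagonal m, v p.2 * w p.1 := by
          rw [← Finset.Nat.sum_antidiagonal_swap]
          rfl
        have h4 : ∑ p ∈ antidiagonal m, (v p.1 * v p.2 - w p.1 * w p.2) ≤
            ∑ p ∈ antidiagonal m, (2 * (v p.1 * v p.2) - v p.1 * w p.2 - v p.2 * w p.1) :=
          Finset.sum_le_sum fun p _ => by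
            nlinarith [mul_nonneg (sub_nonneg.2 (hwle p.1)) (sub_nonneg.2 (hwle p.2))]
        simp only [Finset.sum_sub_distrib, ← Finset.mul_sum] at h4
        simp only [hv', Finset.sum_sub_distrib]
        have e1 : ∑ p ∈ antidiagonal m, 2 * κ * v p.1 * (2 * κ * v p.2) =
            4 * κ ^ 2 * ∑ p ∈ antidiagonal m, v p.1 * v p.2 := by
          rw [Finset.mul_sum]
          exact Finset.sum_congr rfl fun p _ => by ring
        have e2 : ∑ p ∈ antidiagonal m, 2 * κ * v p.1 * (2 * κ * v p.2 / (2 * κ)) =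
            2 * κ * ∑ p ∈ antidiagonal m, v p.1 * v p.2 := by
          rw [Finset.mul_sum]
          exact Finset.sum_congr rfl fun p _ => by field_simp
        have e3 : ∑ p ∈ antidiagonal m, 2 * κ * v p.1 * w p.2 =
            2 * κ * ∑ p ∈ antidiagonal m, v p.1 * w p.2 := by
          rw [Finset.mul_sum]
          exact Finset.sum_congr rfl fun p _ => by ring
        rw [e1, e2, e3]
        have e4 : 4 * κ ^ 2 * (∑ p ∈ antidiagonal m, v p.1 * v p.2) / 2 / (2 * κ) =
            κ * ∑ p ∈ antidiagonal m, v p.1 * v p.2 := by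
          field_simp
          ring
        rw [e4]
        rw [← h3] at h4
        nlinarith
      linarith)
  have h1 := hzero n
  simp only [hw] at h1
  rw [← ENNReal.ofReal_toReal (hfin n)]
  congr 1
  rw [eq_div_iff (by positivity)]
  linarith

theorem legSum_pointedInner_le_hDown (hb : b ∈ Set.Ioo (-1 : ℝ) 0) (hκ : 0 < κ)
    (hκb : step b (-1) = 2 * κ) (hq : ∀ k : ℕ, q (k + 1) = step b k * κ ^ k) (n : ℕ) :
    legSum (pointedInner q) n ≤ ENNReal.ofReal (hDown n / κ ^ n) := by
  have hy : ∀ m : ℕ, 0 ≤ hDown m / κ ^ m := fun m => div_nonneg (hDown_nonneg _) (by positivity)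
  have hv : ∀ m : ℕ, 0 ≤ step b (-1 - m) / (2 * κ) / κ ^ m := fun m =>
    div_nonneg (div_nonneg (step_nonneg hb _) (by positivity)) (by positivity)
  refine legSum_pointedInner_le q (fun n => ENNReal.ofReal (hDown n / κ ^ n)) ?_ (fun n => ?_) n
  · simp [hDown_zero]
  · simp only [legSum_inner_eq hb hκ hκb hq]
    rw [ofReal_recursion hb hκ hq (x := fun m : ℕ => hDown m) (fun m => hDown_nonneg _)
      (summable_step_mul_hDown hb n)]
    simp only [← ENNReal.ofReal_mul (hv _)]
    rw [← ENNReal.ofReal_sum_of_nonneg (fun p _ => mul_nonneg (hv _) (hy _)),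
      show (2 : ℝ≥0∞) = ENNReal.ofReal 2 by simp, ← ENNReal.ofReal_mul zero_le_two,
      ← ENNReal.ofReal_add (div_nonneg (tsum_nonneg fun k => mul_nonneg (step_nonneg hb _)
        (hDown_nonneg _)) (by positivity)) (mul_nonneg zero_le_two
          (Finset.sum_nonneg fun p _ => mul_nonneg (hv _) (hy _))), hDown_recursion hb n]
    refine (congrArg ENNReal.ofReal ?_).le
    rw [add_div, Finset.sum_div, Finset.mul_sum]
    congr 1
    refine Finset.sum_congr rfl fun p hp => ?_
    rw [Finset.HasAntidiagonal.mem_antidiagonal] at hp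
    rw [← hp, pow_succ, pow_add]
    field_simp

/-- Once `legSum_inner_eq` has identified the coefficients, the pointed equation is linear, and
`hDown` minus the rescaled partition function is harmonic on the positive integers. -/
theorem legSum_pointedInner_eq (hb : b ∈ Set.Ioo (-1 : ℝ) 0) (hκ : 0 < κ)
    (hκb : step b (-1) = 2 * κ) (hq : ∀ k : ℕ, q (k + 1) = step b k * κ ^ k) (n : ℕ) :
    legSum (pointedInner q) n = ENNReal.ofReal (hDown n / κ ^ n) := by
  have hle := legSum_pointedInner_le_hDown hb hκ hκb hq
  have hfin : ∀ m, legSum (pointedInner q) m ≠ ∞ := fun m =>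
    ne_top_of_le_ne_top ENNReal.ofReal_ne_top (hle m)
  set w : ℕ → ℝ := fun m => κ ^ m * (legSum (pointedInner q) m).toReal with hw
  have hw0 : ∀ m, 0 ≤ w m := fun m => mul_nonneg (by positivity) ENNReal.toReal_nonneg
  have hwle : ∀ m : ℕ, w m ≤ hDown m := fun m => by
    have h1 := ENNReal.toReal_le_of_le_ofReal (div_nonneg (hDown_nonneg _) (by positivity)) (hle m)
    rw [le_div_iff₀ (by positivity)] at h1
    linarith [show w m = κ ^ m * _ from rfl]
  have hzero := eq_zero_of_subharmonic hb (δ := fun m : ℕ => hDown m - w m)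
    (by simp [hw, hDown_zero, legSum_pointedInner_zero]) (fun m => sub_nonneg.2 (hwle m))
    (squeeze_zero (fun m => sub_nonneg.2 (hwle m)) (fun m => sub_le_self _ (hw0 m)) tendsto_hDown)
    (fun m => by
      obtain ⟨hs, h1⟩ := toReal_recursion hb hκ hq hfin (legSum_pointedInner_succ q m)
      have h2 : κ ^ (m + 1) * (2 * ∑ p ∈ antidiagonal m,
          legSum (inner q) p.1 * legSum (pointedInner q) p.2).toReal =
          ∑ p ∈ antidiagonal m, step b (-1 - p.1) * w p.2 := by
        simp only [legSum_inner_eq hb hκ hκb hq]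
        rw [ENNReal.toReal_mul, ENNReal.toReal_sum fun p _ =>
          ENNReal.mul_ne_top ENNReal.ofReal_ne_top (hfin _), ENNReal.toReal_ofNat, Finset.mul_sum,
          Finset.mul_sum]
        refine Finset.sum_congr rfl fun p hp => ?_
        rw [Finset.HasAntidiagonal.mem_antidiagonal] at hp
        rw [ENNReal.toReal_mul, ENNReal.toReal_ofReal (div_nonneg (div_nonneg (step_nonneg hb _)
          (by positivity)) (by positivity)), ← hp, pow_succ, pow_add]
        simp only [hw]
        field_simp
      rw [h2] at h1
      have h3 : w (m + 1) = _ := h1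
      simp only [mul_sub, Finset.sum_sub_distrib]
      rw [Summable.tsum_sub (summable_step_mul_hDown hb m) hs, h3, hDown_recursion hb m]
      exact le_of_eq (by ring))
  have h1 := hzero n
  simp only [hw] at h1
  rw [← ENNReal.ofReal_toReal (hfin n)]
  congr 1
  rw [eq_div_iff (by positivity)]
  linarith

end Solution

end

/-! ### Admissibility, criticality and the step law. -/

section

open Finset.HasAntidiagonal (antidiagonal)

section Criticality

variable {b : ℝ} {q : ℕ → ℝ} {κ : ℝ}

open PreClass

theorem isAdmissible_of_step (hb : b ∈ Set.Ioo (-1 : ℝ) 0) (hκ : 0 < κ)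
    (hκb : step b (-1) = 2 * κ) (hq : ∀ k : ℕ, q (k + 1) = step b k * κ ^ k) :
    IsAdmissible q := by
  refine ⟨⟨fun k hk => ?_, 2, one_le_two, ?_⟩, ?_⟩
  · obtain ⟨k, rfl⟩ := Nat.exists_eq_succ_of_ne_zero (Nat.one_le_iff_ne_zero.1 hk)
    rw [Nat.succ_eq_add_one, hq]
    exact mul_nonneg (step_nonneg hb _) (by positivity)
  · rw [hq 1]
    exact (mul_pos (step_pos hb (by norm_num)) (by positivity)).ne'
  · rw [tsum_weight]
    -- In the equation for `W_1`, the series over `k` is the total mass of the Boltzmann weight.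
    have h := legSum_inner_succ q 0
    refine ne_top_of_le_ne_top (b := legSum (inner q) 1) ?_ ?_
    · rw [legSum_inner_eq hb hκ hκb hq]
      exact ENNReal.ofReal_ne_top
    · rw [show legSum (inner q) 1 = _ from h]
      refine le_trans (le_of_eq (tsum_congr fun k => ?_)) le_self_add
      rw [show 0 + 1 + k = k + 1 by ring]

/-- The pointed equation at `n = 0` reads `P_1 = M + 2`, with `M` the sum of the weights times
vertex numbers, and `P_1 = hDown 1 / κ = 1 / (2κ)`; so `1 + M / 2 = 1 / (4κ)`. -/
theorem pointedPartitionFunction_eq (hb : b ∈ Set.Ioo (-1 : ℝ) 0) (hκ : 0 < κ)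
    (hκb : step b (-1) = 2 * κ) (hq : ∀ k : ℕ, q (k + 1) = step b k * κ ^ k) :
    pointedPartitionFunction q = ENNReal.ofReal (1 / (4 * κ)) := by
  have h := legSum_pointedInner_succ q 0
  rw [Finset.HasAntidiagonal.antidiagonal_zero, Finset.sum_singleton, legSum_inner_zero,
    legSum_pointedInner_zero, legSum_pointedInner_eq hb hκ hκb hq] at h
  have h1 : hDown ((0 + 1 : ℕ) : ℤ) / κ ^ (0 + 1) = 2 * (1 / (4 * κ)) := by
    rw [zero_add, Nat.cast_one, hDown_one]
    field_simp
    norm_num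
  rw [h1] at h
  have h2 : ∑' m : PlanarMap, (m.numVertices : ℝ≥0∞) * m.weight q + 2 =
      ENNReal.ofReal (2 * (1 / (4 * κ))) := by
    rw [tsum_numVertices_mul_weight, h, mul_one, mul_one]
    congr 1
    exact tsum_congr fun k => by rw [show 0 + 1 + k = k + 1 by ring]
  have h3 : (1 : ℝ≥0∞) = 2 / 2 := (ENNReal.div_self two_ne_zero ENNReal.ofNat_ne_top).symm
  rw [pointedPartitionFunction, h3, ← ENNReal.add_div, add_comm, h2, ENNReal.ofReal_mul zero_le_two,
    ENNReal.ofReal_ofNat, mul_comm, ENNReal.mul_div_cancel_right two_ne_zero ENNReal.ofNat_ne_top]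

theorem tsum_step_mul_hUp_one (hb : b ∈ Set.Ioo (-1 : ℝ) 0) :
    HasSum (fun k : ℕ => step b k * hUp (1 + k)) 1 := by
  have h := hasSum_step_mul_hUp hb le_rfl
  have h0 := h.tsum_eq
  have h1 : Summable fun k : ℕ => step b k * hUp (1 + k) :=
    (h.summable.comp_injective (i := fun k : ℕ => (k : ℤ)) Nat.cast_injective).congr fun k => by
      simp
  rw [tsum_int_split h.summable 0, Finset.HasAntidiagonal.antidiagonal_zero,
    Finset.sum_singleton] at h0
  have h2 : ∀ k : ℕ, step b (-1 - ((0 + 1 : ℕ) + k)) *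
      hUp (((1 : ℕ) : ℤ) + (-1 - ((0 + 1 : ℕ) + k))) = 0 := fun k => by
    rw [hUp, if_neg (by omega), mul_zero]
  simp only [h2, tsum_zero, add_zero] at h0
  have h3 : hUp 1 = 1 := by
    rw [hUp_eq, hDown_one]
    norm_num
  have h4 : hUp 0 = 0 := by simp [hUp]
  norm_num [h3, h4] at h0
  rw [← h0]
  exact h1.hasSum

/-- Harmonicity at `1` gives `∑ ν(k) (1 + k) hDown (1 + k) = 1/2` from `hUp` and `∑ ν(k) hDown (1 +
k) = 1/2 - 2κ` from `hDown`, over `k ≥ 0`. Their difference has weight `k` in place of `1 + k`. -/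
theorem hasSum_mul_step_mul_hDown (hb : b ∈ Set.Ioo (-1 : ℝ) 0) (hκb : step b (-1) = 2 * κ) :
    HasSum (fun j : ℕ => (j + 1 : ℝ) * hDown ((j + 2 : ℕ) : ℤ) * step b ((j + 1 : ℕ) : ℤ))
      (2 * κ) := by
  have h1 := (tsum_step_mul_hUp_one hb).div_const 2
  have h2 := (summable_step_mul_hDown hb 0).hasSum
  have h3 := hDown_recursion hb 0
  simp only [Finset.HasAntidiagonal.antidiagonal_zero, Finset.sum_singleton, Nat.cast_zero,
    sub_zero, hκb, hDown_zero, zero_add, Nat.cast_one, hDown_one, mul_one] at h2 h3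
  have h4 := h1.sub h2
  rw [show ∑' k : ℕ, step b k * hDown ((1 + k : ℕ) : ℤ) = 1 / 2 - 2 * κ by linarith,
    sub_sub_cancel] at h4
  have h5 := (hasSum_nat_add_iff' 1).2 h4
  simp only [Finset.sum_range_one, Nat.cast_zero, step_zero hb, zero_mul, zero_div, sub_zero] at h5
  refine h5.congr_fun fun j => ?_
  rw [hUp_eq, show (1 : ℤ) + ((j + 1 : ℕ) : ℤ) = ((j + 2 : ℕ) : ℤ) by push_cast; ring,
    show 1 + (j + 1) = j + 2 by ring]
  push_cast
  ring

/-- Since `binom(2j + 3, j + 2) = 4 ^ (j + 2) * hDown (j + 2) / 2`, the powers of `4κ` cancel and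
the general term is `8κ` times that of `hasSum_mul_step_mul_hDown`. -/
theorem derivSeries_eq (hb : b ∈ Set.Ioo (-1 : ℝ) 0) (hκ : 0 < κ)
    (hκb : step b (-1) = 2 * κ) (hq : ∀ k : ℕ, q (k + 1) = step b k * κ ^ k) :
    derivSeries q (ENNReal.ofReal (1 / (4 * κ))) = ENNReal.ofReal (16 * κ ^ 2) := by
  have h1 := (hasSum_mul_step_mul_hDown hb hκb).mul_left (8 * κ)
  rw [show 16 * κ ^ 2 = 8 * κ * (2 * κ) by ring, ← h1.tsum_eq, ENNReal.ofReal_tsum_of_nonneg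
    (fun j => mul_nonneg (by positivity) (mul_nonneg (mul_nonneg (by positivity)
      (hDown_nonneg _)) (step_nonneg hb _))) h1.summable, derivSeries]
  refine tsum_congr fun j => ?_
  have hq0 : 0 ≤ q (j + 2) := by
    rw [hq (j + 1)]
    exact mul_nonneg (step_nonneg hb _) (by positivity)
  rw [← ENNReal.ofReal_natCast, ← ENNReal.ofReal_natCast, ← ENNReal.ofReal_pow (by positivity),
    ← ENNReal.ofReal_mul (by positivity), ← ENNReal.ofReal_mul (by positivity),
    ← ENNReal.ofReal_mul (by positivity)]
  congr 1
  have h2 : ((j + 2).centralBinom : ℝ) = 2 * ((2 * j + 3).choose (j + 2) : ℝ) := by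
    have h3 : (2 * j + 3).choose (j + 2) = (2 * j + 3).choose (j + 1) :=
      Nat.choose_symm_of_eq_add (by ring)
    have h4 : (j + 2).centralBinom = 2 * (2 * j + 3).choose (j + 2) := by
      rw [Nat.centralBinom, show 2 * (j + 2) = 2 * j + 3 + 1 by ring,
        show j + 2 = j + 1 + 1 from rfl, Nat.choose_succ_succ' (2 * j + 3) (j + 1), ← h3]
      ring
    exact_mod_cast h4
  rw [hq (j + 1), hDown_natCast, h2, div_pow, one_pow, mul_pow, pow_succ 4, pow_succ 4, pow_succ κ]
  push_cast
  field_simp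
  ring

theorem isCritical_of_step (hb : b ∈ Set.Ioo (-1 : ℝ) 0) (hκ : 0 < κ)
    (hκb : step b (-1) = 2 * κ) (hq : ∀ k : ℕ, q (k + 1) = step b k * κ ^ k) :
    IsCritical q := by
  refine ⟨isAdmissible_of_step hb hκ hκb hq, ?_⟩
  rw [pointedPartitionFunction_eq hb hκ hκb hq, derivSeries_eq hb hκ hκb hq,
    ← ENNReal.ofReal_pow (by positivity), ← ENNReal.ofReal_mul (by positivity),
    ENNReal.ofReal_eq_one]
  field_simp
  norm_num

theorem stepWeight_eq (hb : b ∈ Set.Ioo (-1 : ℝ) 0) (hκ : 0 < κ)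
    (hκb : step b (-1) = 2 * κ) (hq : ∀ k : ℕ, q (k + 1) = step b k * κ ^ k) (k : ℤ) :
    stepWeight q κ k = ENNReal.ofReal (step b k) := by
  obtain n | n := k
  · rw [stepWeight, hq, zpow_neg, zpow_natCast, mul_assoc, mul_inv_cancel₀ (by positivity),
      mul_one]
    rfl
  · rw [stepWeight, partitionFunction_eq, legSum_inner_eq hb hκ hκb hq,
      show (2 : ℝ≥0∞) = ENNReal.ofReal 2 by simp, ← ENNReal.ofReal_mul zero_le_two,
      ← ENNReal.ofReal_mul (mul_nonneg zero_le_two (div_nonneg (div_nonneg (step_nonneg hb _)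
        (by positivity)) (by positivity))), Int.negSucc_eq, show -((n : ℤ) + 1) = -1 - n by ring]
    congr 1
    rw [pow_succ]
    field_simp

end Criticality

/-- The step law as a probability mass function. -/
def stepPMF {b : ℝ} (hb : b ∈ Set.Ioo (-1 : ℝ) 0) : PMF ℤ :=
  ⟨fun k => ENNReal.ofReal (step b k), by
    have h := hasSum_step hb
    rw [← ENNReal.ofReal_one, ← h.tsum_eq,
      ENNReal.ofReal_tsum_of_nonneg (step_nonneg hb) h.summable]
    exact ENNReal.summable.hasSum⟩

theorem stepPMF_apply {b : ℝ} (hb : b ∈ Set.Ioo (-1 : ℝ) 0) (k : ℤ) :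
    stepPMF hb k = ENNReal.ofReal (step b k) := rfl

theorem stepPMF_isHarmonicOnPos {b : ℝ} (hb : b ∈ Set.Ioo (-1 : ℝ) 0) :
    IsHarmonicOnPos (stepPMF hb) hUp := by
  intro ℓ hℓ
  lift ℓ to ℕ using hℓ.le
  refine (hasSum_step_mul_hUp hb (by omega)).congr_fun fun k => ?_
  rw [stepPMF_apply, ENNReal.toReal_ofReal (step_nonneg hb k), mul_comm]

theorem Gamma_neg_of_mem {b : ℝ} (hb : b ∈ Set.Ioo (-1 : ℝ) 0) : Real.Gamma b < 0 := by
  have h1 := Real.Gamma_add_one hb.2.ne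
  have h2 : 0 < Real.Gamma (b + 1) := Real.Gamma_pos_of_pos (by linarith [hb.1])
  rw [h1] at h2
  exact neg_of_mul_pos_right h2 hb.2.le

end

end BoltzmannMaps

end

theorem mainTheorem12 (a : ℝ) (ha : a ∈ Set.Ioo (3 / 2 : ℝ) (5 / 2)) (κ c : ℝ)
    (hκ : κ = 1 / (4 * a - 2))
    (hc : c = -Real.sqrt Real.pi / (2 * Real.Gamma (3 / 2 - a)))
    (q : ℕ → ℝ)
    (hq : ∀ k : ℕ, q k = if 2 ≤ k then
      c * κ ^ (k - 1) * (Real.Gamma (1 / 2 - a + k) / Real.Gamma (1 / 2 + k)) else 0) :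
    0 < c ∧ 0 < κ ∧
    Asymptotics.IsEquivalent Filter.atTop q
      (fun k : ℕ => c * κ ^ (k - 1) * (k : ℝ) ^ (-a)) ∧
    BoltzmannMaps.IsAdmissible q ∧ BoltzmannMaps.IsCritical q ∧
    ∃ ν : PMF ℤ,
      (∀ k : ℤ, ν k = BoltzmannMaps.stepWeight q κ k) ∧
      (∀ k : ℤ, (ν k).toReal = if k ≠ 0 then
        c * (Real.Gamma (3 / 2 - a + k) / Real.Gamma (3 / 2 + k)) else 0) ∧
      BoltzmannMaps.IsHarmonicOnPos ν BoltzmannMaps.hUp := by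
  obtain ⟨ha1, ha2⟩ := ha
  have hb : 3 / 2 - a ∈ Set.Ioo (-1 : ℝ) 0 := ⟨by linarith, by linarith⟩
  have hΓ := BoltzmannMaps.Gamma_neg_of_mem hb
  have hc0 : 0 < c := by
    rw [hc]
    exact div_pos_of_neg_of_neg (neg_neg_of_pos (Real.sqrt_pos.2 Real.pi_pos)) (by linarith)
  have hκ0 : 0 < κ := by
    rw [hκ]
    exact one_div_pos.2 (by linarith)
  have hstep : ∀ k : ℤ, k ≠ 0 → BoltzmannMaps.step (3 / 2 - a) k =
      c * (Real.Gamma (3 / 2 - a + k) / Real.Gamma (3 / 2 + k)) := fun k hk => by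
    rw [BoltzmannMaps.step_of_ne hk, BoltzmannMaps.gammaRatio, hc]
    ring
  -- This fixes `κ`: the step law must give `-1` the mass `2 W_0 κ = 2κ`.
  have hκb : BoltzmannMaps.step (3 / 2 - a) (-1) = 2 * κ := by
    rw [BoltzmannMaps.step_neg_one hb, hκ, show 2 * (1 - (3 / 2 - a)) = (4 * a - 2) / 2 by ring,
      one_div_div, mul_one_div]
  have hqs : ∀ k : ℕ, q (k + 1) = BoltzmannMaps.step (3 / 2 - a) k * κ ^ k := fun k => by
    obtain rfl | hk := Nat.eq_zero_or_pos k
    · rw [hq, if_neg (by norm_num), Nat.cast_zero, BoltzmannMaps.step_zero hb, zero_mul]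
    · rw [hq, if_pos (by omega), hstep k (by omega), Nat.add_sub_cancel, Nat.cast_succ,
        show 1 / 2 - a + ((k : ℝ) + 1) = 3 / 2 - a + (k : ℤ) by push_cast; ring,
        show 1 / 2 + ((k : ℝ) + 1) = 3 / 2 + (k : ℤ) by push_cast; ring]
      ring
  refine ⟨hc0, hκ0, ?_, BoltzmannMaps.isAdmissible_of_step hb hκ0 hκb hqs,
    BoltzmannMaps.isCritical_of_step hb hκ0 hκb hqs, BoltzmannMaps.stepPMF hb, fun k => ?_,
    fun k => ?_, BoltzmannMaps.stepPMF_isHarmonicOnPos hb⟩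
  · have h1 := BoltzmannMaps.isEquivalent_Gamma_div (x := 1 / 2 - a) (y := 1 / 2)
      -- No pole is met: `1/2 - a` is one less than `3/2 - a`, which lies strictly between `-1` and
      -- `0`.
      (fun m hm => BoltzmannMaps.add_intCast_ne_zero hb (m - 1) (by push_cast; linarith))
      (BoltzmannMaps.ne_neg_natCast_of_pos (by norm_num))
    rw [show 1 / 2 - a - 1 / 2 = -a by ring] at h1
    refine ((Asymptotics.IsEquivalent.refl (u := fun k : ℕ => c * κ ^ (k - 1))).mul
      h1).congr_left ?_
    filter_upwards [Filter.eventually_ge_atTop 2] with k hk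
    rw [hq, if_pos hk]
    rfl
  · rw [BoltzmannMaps.stepPMF_apply, BoltzmannMaps.stepWeight_eq hb hκ0 hκb hqs]
  · rw [BoltzmannMaps.stepPMF_apply, ENNReal.toReal_ofReal (BoltzmannMaps.step_nonneg hb k)]
    split_ifs with hk
    · exact hstep k hk
    · rw [not_not.1 hk, BoltzmannMaps.step_zero hb]
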